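/- Let $G=(V,E)$ be a finite simple graph with at least two vertices. For real $\beta$, $G$ is \emph{$\beta$-tough} if for every integer $p\ge 2$ it cannot be split into $p$ connected components by deleting fewer than $\beta p$ vertices. $G$ is \emph{$5$-chordal} if every cycle of length at least $5$ in $G$ has a chord in $G$. Two edges are \emph{remote} if they are disjoint and no edge of $G$ joins them. The degree of an edge $e=uv$ is $d(e)=|(N_G(u)\cup N_G(v))\setminus\{u,v\}|$. $G$ is \emph{prism-Hamiltonian} if the Cartesian product of $G$ with $K_2$ has a Hamiltonian cycle. Suppose that $G$ is $5$-chordal and $(1+\varepsilon)$-tough for some $\varepsilon>0$, and that for every three mutually remote edges $e_1,e_2,e_3$ of $G$, $$d(e_1)+d(e_2)+d(e_3)>\tfrac32\,(|V|-3).$$ Then $G$ is prism-Hamiltonian. -/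

import Mathlib

namespace SimpleGraph

/-- `G` is `β`-tough: for every `p ≥ 2`, `G` cannot be split into `p` components by deleting
fewer than `β * p` vertices. -/
def IsTough {V : Type*} (G : SimpleGraph V) (β : ℝ) : Prop :=
  ∀ (S : Finset V) (p : ℕ), 2 ≤ p →
    Nat.card (G.induce {v : V | v ∉ S}).ConnectedComponent = p → β * p ≤ S.card

/-- A closed walk has a chord: two of its vertices are joined by an edge of `G` that is not an
edge of the walk. -/
def Walk.HasChord {V : Type*} {G : SimpleGraph V} {v : V} (C : G.Walk v v) : Prop :=
  ∃ a ∈ C.support, ∃ b ∈ C.support, G.Adj a b ∧ s(a, b) ∉ C.edges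

/-- `G` is `k`-chordal: every cycle of `G` of length at least `k` has a chord in `G`. -/
def IsKChordal {V : Type*} (G : SimpleGraph V) (k : ℕ) : Prop :=
  ∀ (v : V) (C : G.Walk v v), C.IsCycle → k ≤ C.length → C.HasChord

/-- The prism over `G`, the Cartesian product of `G` with the complete graph `K₂`, is
Hamiltonian. -/
def IsPrismHamiltonian {V : Type*} [Fintype V] [DecidableEq V] (G : SimpleGraph V) : Prop :=
  (G □ completeGraph (Fin 2)).IsHamiltonian

/-- Two pairs of vertices (in use: two edges) are remote: they are disjoint and no edge of `G`
joins them. -/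
def Remote {V : Type*} (G : SimpleGraph V) (e f : Sym2 V) : Prop :=
  ∀ u ∈ e, ∀ v ∈ f, u ≠ v ∧ ¬ G.Adj u v

/-- The degree of an edge `e`: the number of vertices outside `e` with a neighbour in `e`. -/
noncomputable def edgeDegree {V : Type*} (G : SimpleGraph V) (e : Sym2 V) : ℕ :=
  {w : V | w ∉ e ∧ ∃ u ∈ e, G.Adj u w}.ncard

theorem edgeDegree_mk {V : Type*} (G : SimpleGraph V) (u v : V) :
    G.edgeDegree s(u, v) = ((G.neighborSet u ∪ G.neighborSet v) \ {u, v}).ncard := by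
  unfold edgeDegree
  congr 1
  ext w
  simp [and_comm]

end SimpleGraph

/-! A spine is a dominating even cycle, or two even cycles with exactly one common vertex that
together dominate; a single edge counts as an even cycle. A spine makes the prism Hamiltonian
(`EvenSpine.isPrismHamiltonian`, `DoubleSpine.isPrismHamiltonian`). Going around an even cycle and
crossing to the other level at every vertex closes up, and two even cycles can be joined at the two
copies of their common vertex. The vertices missed by the spine are independent, and toughness above
1 gives |N(J)| > |J| for sets J of at least two of them. By Hall's theorem they can be matched into
the spine, even avoiding one vertex, and each is inserted as a detour at its partner.

There is a dominating cycle (`exists_dominating_cycle`). Choose a cycle leaving the fewest edges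
undominated. A nontrivial component K outside it has three neighbours on the cycle. At their
successors one selects edges, leaving the cycle if possible. Rerouting through K shows that these
edges are mutually remote, and a crossing-edge count in the style of Ore bounds the degree sum of
any two by |V| - 4, against the hypothesis.

A dominating cycle yields a spine (`exists_spine_of_dominates`). Otherwise it is odd. Among odd
dominating cycles a, W, c, Z with an edge ac and |W| odd, take |W| minimal and then |Z| maximal. By
minimality, parity of position along W behaves like a 2-colouring, and 5-chordality then forces a
common neighbour t of a and c in W (`IsMinConfig.exists_common`). So a, t, c is a triangle whose
corners are joined along the cycle by three paths with evenly many inner vertices. The edges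
selected after the three corners are mutually remote, and so are those selected before them: a link
between two would create a spine. Of these six edges, two pairs have degree sum at most |V| - 3 by
`IsTri.edgeDegree_add_le`, and the remaining pair, at the two ends of W, by
`IsArc.edgeDegree_add_le`. The total is at most 3(|V| - 3), while the hypothesis, applied to both
triples, makes it larger (`IsMinConfig.false`). -/

namespace SimpleGraph

/-! ### Paths and cycles as lists of vertices -/

/-- `l` lists the vertices of a walk of `G` from `u` to `v`. -/
def ListPath {V : Type*} (G : SimpleGraph V) (u v : V) (l : List V) : Prop :=
  l.IsChain G.Adj ∧ l.head? = some u ∧ l.getLast? = some v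

namespace ListPath

variable {V : Type*} {G : SimpleGraph V} {u v w x y : V} {l l₁ l₂ : List V}

theorem single (u : V) : G.ListPath u u [u] := by simp [ListPath]

theorem ne_nil (h : G.ListPath u v l) : l ≠ [] := by
  rintro rfl; simpa using h.2.1

theorem append (h₁ : G.ListPath u v l₁) (ha : G.Adj v w) (h₂ : G.ListPath w x l₂) :
    G.ListPath u x (l₁ ++ l₂) := by
  obtain ⟨c₁, a₁, b₁⟩ := h₁
  obtain ⟨c₂, a₂, b₂⟩ := h₂
  refine ⟨List.isChain_append.2 ⟨c₁, c₂, ?_⟩, ?_, ?_⟩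
  · intro p hp q hq
    simp_all
  · simp [List.head?_append, a₁]
  · simp [List.getLast?_append, b₂]

theorem cons (ha : G.Adj u v) (h : G.ListPath v w l) : G.ListPath u w (u :: l) :=
  (single u).append ha h

theorem concat (h : G.ListPath u v l) (ha : G.Adj v w) : G.ListPath u w (l ++ [w]) :=
  h.append ha (single w)

theorem reverse (h : G.ListPath u v l) : G.ListPath v u l.reverse := by
  refine ⟨?_, by simpa using h.2.2, by simpa using h.2.1⟩
  rw [List.isChain_reverse]
  exact h.1.imp fun a b hab => hab.symm

theorem of_cons (h : G.ListPath u v (x :: l)) : u = x := by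
  have := h.2.1; simpa using this.symm

theorem head_mem (h : G.ListPath u v l) : u ∈ l := List.mem_of_mem_head? h.2.1

theorem last_mem (h : G.ListPath u v l) : v ∈ l := List.mem_of_mem_getLast? h.2.2

theorem of_concat (h : G.ListPath u v (l ++ [x])) : v = x := by
  have := h.2.2; simpa using this.symm

/-- Splitting a listed path in front of a vertex. -/
theorem split (h : G.ListPath u v (l₁ ++ x :: y :: l₂)) :
    G.ListPath u x (l₁ ++ [x]) ∧ G.Adj x y ∧ G.ListPath y v (y :: l₂) := by
  obtain ⟨c, a, b⟩ := h
  rw [List.isChain_append_cons_cons] at c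
  refine ⟨⟨c.1, ?_, by simp⟩, c.2.1, c.2.2, by simp, ?_⟩
  · cases l₁ <;> simp_all
  · simpa [List.getLast?_append] using b

theorem split_at (h : G.ListPath u v (l₁ ++ x :: l₂)) :
    G.ListPath u x (l₁ ++ [x]) ∧ G.ListPath x v (x :: l₂) := by
  obtain ⟨c, a, b⟩ := h
  rw [List.isChain_split] at c
  refine ⟨⟨c.1, ?_, by simp⟩, c.2, by simp, ?_⟩
  · cases l₁ <;> simp_all
  · simpa [List.getLast?_append] using b

theorem uncons (h : G.ListPath u v (x :: y :: l)) : G.Adj x y ∧ G.ListPath y v (y :: l) :=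
  (split (l₁ := []) h).2

/-- Splitting a listed path into two nonempty parts. -/
theorem split_append (h : G.ListPath u v (l₁ ++ l₂)) (h₁ : l₁ ≠ []) (h₂ : l₂ ≠ []) :
    ∃ x y, G.ListPath u x l₁ ∧ G.Adj x y ∧ G.ListPath y v l₂ := by
  obtain ⟨m, x, rfl⟩ := List.eq_nil_or_concat l₁ |>.resolve_left h₁
  obtain ⟨y, k, rfl⟩ := List.exists_cons_of_ne_nil h₂
  rw [List.concat_eq_append] at h ⊢
  refine ⟨x, y, split ?_⟩
  simpa using h

theorem exists_walk (h : G.ListPath u v l) : ∃ p : G.Walk u v, p.support = l := by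
  have hne := h.ne_nil
  obtain ⟨c, a, b⟩ := h
  have e₁ : l.head hne = u := by
    rw [List.head?_eq_some_head hne] at a; simpa using a
  have e₂ : l.getLast hne = v := by
    rw [List.getLast?_eq_some_getLast hne] at b; simpa using b
  subst e₁ e₂
  exact ⟨Walk.ofSupport l hne c, Walk.support_ofSupport hne c⟩

/-- A listed path without repetitions whose ends are adjacent closes up to a cycle. -/
theorem exists_isCycle (h : G.ListPath u v l) (ha : G.Adj v u) (hl : l.Nodup)
    (h3 : 3 ≤ l.length) :
    ∃ p : G.Walk u v, p.support = l ∧ (Walk.cons ha p).IsCycle := by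
  obtain ⟨p, hp⟩ := h.exists_walk
  refine ⟨p, hp, ?_⟩
  have hpath : p.IsPath := by rw [Walk.isPath_def, hp]; exact hl
  rw [Walk.cons_isCycle_iff]
  refine ⟨hpath, fun hm => ?_⟩
  have := hpath.length_eq_one_of_mem_edges (Sym2.eq_swap ▸ hm)
  have h4 := p.length_support
  rw [hp] at h4
  omega

theorem isHamiltonian [Fintype V] [DecidableEq V] (h : G.ListPath u v l) (ha : G.Adj v u)
    (hl : l.Nodup) (h3 : 3 ≤ l.length) (hall : ∀ x, x ∈ l) : G.IsHamiltonian := by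
  obtain ⟨p, hp, hc⟩ := h.exists_isCycle ha hl h3
  intro _
  refine ⟨v, Walk.cons ha p, ?_⟩
  rw [Walk.isHamiltonianCycle_iff_isCycle_and_support_count_tail_eq_one]
  refine ⟨hc, fun a => ?_⟩
  simp only [Walk.support_cons, List.tail_cons, hp]
  exact List.count_eq_one_of_mem hl (hall a)

end ListPath

/-- Every edge of `G` has an end in the list `l`. -/
def Dominates {V : Type*} (G : SimpleGraph V) (l : List V) : Prop :=
  ∀ u v, u ∉ l → v ∉ l → ¬ G.Adj u v

/-! ### Spines: even cycles and pairs of even cycles sharing a vertex -/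

/-- A dominating even cycle. -/
def EvenSpine {V : Type*} (G : SimpleGraph V) : Prop :=
  ∃ u v l, G.ListPath u v l ∧ G.Adj v u ∧ Even l.length ∧ l.Nodup ∧ G.Dominates l

/-- Two even cycles (single edges are allowed) that share exactly the vertex `w` and together
dominate all edges. -/
def DoubleSpine {V : Type*} (G : SimpleGraph V) : Prop :=
  ∃ w u₁ v₁ l₁ u₂ v₂ l₂, G.ListPath u₁ v₁ l₁ ∧ G.Adj w u₁ ∧ G.Adj v₁ w ∧ Odd l₁.length ∧
    G.ListPath u₂ v₂ l₂ ∧ G.Adj w u₂ ∧ G.Adj v₂ w ∧ Odd l₂.length ∧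
    (w :: (l₁ ++ l₂)).Nodup ∧ G.Dominates (w :: (l₁ ++ l₂))

/-! ### Hamiltonian cycles of the prism from a spine -/

section Zigzag

variable {V : Type*} {G : SimpleGraph V} (mate : V → Option V)

/-- The vertical edge of the prism at `v`, starting on level `s`, with a detour through the
mate of `v`. -/
def rung (s : Fin 2) (v : V) : List (V × Fin 2) :=
  match mate v with
  | none => [(v, s), (v, s + 1)]
  | some i => [(v, s), (i, s), (i, s + 1), (v, s + 1)]

/-- The rungs at the vertices of a list, on alternating levels. -/
def zigzag : Fin 2 → List V → List (V × Fin 2)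
  | _, [] => []
  | s, v :: l => rung mate s v ++ zigzag (s + 1) l

variable {mate}

theorem rung_path (hm : ∀ v i, mate v = some i → G.Adj v i) (s : Fin 2) (v : V) :
    (G □ completeGraph (Fin 2)).ListPath (v, s) (v, s + 1) (rung mate s v) := by
  have hs : s ≠ s + 1 := by fin_cases s <;> decide
  unfold rung
  cases h : mate v with
  | none => simp [ListPath, hs]
  | some i => simp [ListPath, hs, hm v i h, (hm v i h).symm]

/-- Every rung changes the level and every step along the list keeps it, so the final level depends
only on the parity of the number of rungs. -/
theorem zigzag_path (hm : ∀ v i, mate v = some i → G.Adj v i) {u v : V} {l : List V}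
    (h : G.ListPath u v l) (s : Fin 2) :
    (G □ completeGraph (Fin 2)).ListPath (u, s) (v, if Even l.length then s else s + 1)
      (zigzag mate s l) := by
  induction l generalizing u s with
  | nil => exact absurd rfl h.ne_nil
  | cons x l ih =>
    obtain rfl := h.of_cons
    cases l with
    | nil =>
      have : v = u := by have := h.2.2; simpa using this.symm
      subst this
      simpa [zigzag] using rung_path hm s v
    | cons y l =>
      obtain ⟨ha, h'⟩ := h.uncons
      have key := (rung_path hm s u).append (w := (y, s + 1)) (by simp [boxProd_adj, ha])
        (ih h' (s + 1))
      have hs : s + 1 + 1 = s := by fin_cases s <;> rfl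
      rw [hs] at key
      rw [zigzag]
      have e : Even (u :: y :: l).length ↔ ¬ Even (y :: l).length := by
        rw [List.length_cons (as := y :: l), Nat.even_add_one]
      convert key using 2
      by_cases he : Even (y :: l).length <;> simp only [e, he] <;> simp

theorem mem_rung {s t : Fin 2} {v x : V} : (x, t) ∈ rung mate s v ↔ x = v ∨ mate v = some x := by
  have ht : t = s ∨ t = s + 1 := by fin_cases s <;> fin_cases t <;> simp
  unfold rung
  cases h : mate v with
  | none => simp; tauto
  | some i =>
    simp only [List.mem_cons, Prod.mk.injEq, List.not_mem_nil, or_false, Option.some.injEq]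
    rw [eq_comm (a := i)]
    tauto

theorem mem_zigzag {s t : Fin 2} {l : List V} {x : V} :
    (x, t) ∈ zigzag mate s l ↔ ∃ v ∈ l, x = v ∨ mate v = some x := by
  induction l generalizing s with
  | nil => simp [zigzag]
  | cons v l ih => simp [zigzag, mem_rung, ih]

theorem nodup_zigzag {l : List V} (hl : l.Nodup) (hm : ∀ v i, mate v = some i → i ∉ l)
    (hinj : ∀ v w i, mate v = some i → mate w = some i → v = w) (s : Fin 2) :
    (zigzag mate s l).Nodup := by
  induction l generalizing s with
  | nil => simp [zigzag]
  | cons v l ih =>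
    rw [List.nodup_cons] at hl
    have hs : s ≠ s + 1 := by fin_cases s <;> decide
    rw [zigzag, List.nodup_append]
    refine ⟨?_, ih hl.2 (fun w i h hi => hm w i h (List.mem_cons_of_mem _ hi)) _, ?_⟩
    · unfold rung
      cases h : mate v with
      | none => simp [hs]
      | some i =>
        have : v ≠ i := fun e => hm v i h (by simp [e])
        simp [hs, this, this.symm]
    · rintro ⟨x, t⟩ hx ⟨y, t'⟩ hy e
      rw [Prod.mk.injEq] at e
      obtain ⟨rfl, rfl⟩ := e
      rw [mem_rung] at hx
      obtain ⟨w, hw, hy⟩ := mem_zigzag.1 hy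
      rcases hx with rfl | hx <;> rcases hy with rfl | hy
      · exact hl.1 hw
      · exact hm w x hy (by simp)
      · exact hm v x hx (by simp [hw])
      · exact hl.1 (hinj v w x hx hy ▸ hw)

end Zigzag

/-! ### Consequences of toughness -/

/-- If deleting `S` leaves the vertices of `J` in different components, as witnessed by a map
`c` that is constant on components, then `S` has more elements than `J`. -/
theorem IsTough.card_lt {V : Type*} [Fintype V] {G : SimpleGraph V} {ε : ℝ} (hε : 0 < ε)
    (h : G.IsTough (1 + ε)) {α : Type*} (S J : Finset V) (c : V → α)
    (hc : ∀ x ∉ S, ∀ y ∉ S, G.Adj x y → c x = c y) (hJS : ∀ x ∈ J, x ∉ S)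
    (hinj : ∀ x ∈ J, ∀ y ∈ J, c x = c y → x = y) (h2 : 2 ≤ J.card) : J.card < S.card := by
  classical
  set H := G.induce {v : V | v ∉ S}
  have key : ∀ x y : {v : V | v ∉ S}, H.Reachable x y → c x = c y := by
    rintro x y ⟨p⟩
    induction p with
    | nil => rfl
    | @cons u v _ ha _ ih => exact (hc _ u.2 _ v.2 ha).trans ih
  have hle : J.card ≤ Nat.card H.ConnectedComponent := by
    rw [← Nat.card_eq_finsetCard]
    refine Nat.card_le_card_of_injective
      (fun x : J => H.connectedComponentMk ⟨x.1, hJS _ x.2⟩) fun x y hxy => ?_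
    exact Subtype.ext (hinj _ x.2 _ y.2 (key _ _ (ConnectedComponent.eq.1 hxy)))
  have := h S _ (h2.trans hle) rfl
  have h0 : (0 : ℝ) < Nat.card H.ConnectedComponent := by
    exact_mod_cast (by omega : 0 < Nat.card H.ConnectedComponent)
  have h1 : (Nat.card H.ConnectedComponent : ℝ) < S.card := by nlinarith
  have : Nat.card H.ConnectedComponent < S.card := by exact_mod_cast h1
  omega

section Tough

variable {V : Type*} [Fintype V] {G : SimpleGraph V} {ε : ℝ}

/-- A separating set has at least three elements. -/
theorem IsTough.two_lt_of_separates (hε : 0 < ε) (h : G.IsTough (1 + ε)) (S : Finset V)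
    (X : Set V) (hX : ∀ x ∈ X, ∀ y ∉ X, x ∉ S → y ∉ S → ¬ G.Adj x y) {a b : V} (ha : a ∈ X)
    (hb : b ∉ X) (haS : a ∉ S) (hbS : b ∉ S) : 2 < S.card := by
  classical
  have hab : a ≠ b := fun e => hb (e ▸ ha)
  have := h.card_lt hε S {a, b} (fun x => x ∈ X) ?_ (by simp [haS, hbS]) ?_
    (by rw [Finset.card_pair hab])
  · rwa [Finset.card_pair hab] at this
  · intro x hx y hy hxy
    by_contra hne
    by_cases h1 : x ∈ X <;> by_cases h2 : y ∈ X
    · simp [h1, h2] at hne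
    · exact hX x h1 y h2 hx hy hxy
    · exact hX y h2 x h1 hy hx hxy.symm
    · simp [h1, h2] at hne
  · intro x hx y hy hxy
    simp only [Finset.mem_insert, Finset.mem_singleton] at hx hy
    rcases hx with rfl | rfl <;> rcases hy with rfl | rfl <;> simp_all

/-- A vertex of a tough graph has at least three neighbours, or is adjacent to all others. -/
theorem IsTough.two_lt_degree (hε : 0 < ε) (h : G.IsTough (1 + ε)) {v u : V} (huv : u ≠ v)
    (hna : ¬ G.Adj v u) (S : Finset V) (hS : ∀ w, G.Adj v w → w ∈ S) (hvS : v ∉ S)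
    (huS : u ∉ S) : 2 < S.card :=
  h.two_lt_of_separates hε S {v} (by rintro x rfl y hy hx hyS hxy; exact hyS (hS y hxy)) rfl huv
    hvS huS

/-- A neighbourhood inside {p, q} would separate `v` from some fourth vertex by at most two
vertices. -/
theorem IsTough.exists_adj (hε : 0 < ε) (h : G.IsTough (1 + ε)) (hV : 4 ≤ Fintype.card V)
    (v p q : V) : ∃ w, G.Adj v w ∧ w ≠ p ∧ w ≠ q := by
  classical
  by_contra! hcon
  have hS : ∀ w, G.Adj v w → w ∈ ({p, q} : Finset V).erase v := fun w hw => by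
    have := hcon w hw
    have := hw.ne'
    by_cases w = p <;> simp_all
  obtain ⟨u, hu⟩ : ∃ u, u ∉ insert v (({p, q} : Finset V).erase v) := by
    by_contra! hall
    have h1 := Finset.card_le_card (fun x _ => hall x : (Finset.univ : Finset V) ⊆ _)
    have h2 := Finset.card_insert_le v (({p, q} : Finset V).erase v)
    have h3 := Finset.card_erase_le (a := v) (s := ({p, q} : Finset V))
    have h4 := Finset.card_le_two (a := p) (b := q)
    rw [Finset.card_univ] at h1
    omega
  rw [Finset.mem_insert, not_or] at hu
  have := h.two_lt_degree hε hu.1 (fun ha => hu.2 (hS u ha)) _ hS (by simp) hu.2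
  have h3 := Finset.card_erase_le (a := v) (s := ({p, q} : Finset V))
  have h4 := Finset.card_le_two (a := p) (b := q)
  omega

/-- The vertices missed by a dominating set can be matched into it, avoiding a given vertex. -/
theorem IsTough.exists_mate (hε : 0 < ε) (h : G.IsTough (1 + ε)) {l : List V}
    (hl : G.Dominates l) {p q : V} (hp : p ∈ l) (hq : q ∈ l) (hpq : p ≠ q) (w : V) :
    ∃ mate : V → Option V, (∀ v i, mate v = some i → G.Adj v i ∧ v ∈ l ∧ v ≠ w ∧ i ∉ l) ∧
      (∀ v v' i, mate v = some i → mate v' = some i → v = v') ∧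
      ∀ i ∉ l, ∃ v ∈ l, mate v = some i := by
  classical
  -- Hall's condition. The strict inequality |J| < |N(J)| leaves one neighbour to spare, which pays
  -- for the forbidden vertex `w`.
  have hall : ∀ J : Finset {i : V // i ∉ l},
      J.card ≤ (J.biUnion fun i => (G.neighborFinset i.1).erase w).card := by
    intro J
    rcases Nat.eq_zero_or_pos J.card with h0 | h0
    · omega
    set N := J.biUnion fun i => G.neighborFinset i.1 with hN
    have hsub : N.erase w ⊆ J.biUnion fun i => (G.neighborFinset i.1).erase w := by
      intro x hx
      simp only [hN, Finset.mem_erase, Finset.mem_biUnion] at hx ⊢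
      tauto
    have h1 := Finset.card_le_card hsub
    have h2 := Finset.pred_card_le_card_erase (s := N) (a := w)
    have hmem : ∀ x, x ∈ N ↔ ∃ i ∈ J, G.Adj i.1 x := by simp [hN]
    have hNl : ∀ x ∈ N, x ∈ l := by
      intro x hx
      obtain ⟨i, hi, hix⟩ := (hmem x).1 hx
      by_contra hxl
      exact hl _ _ i.2 hxl hix
    suffices J.card < N.card by omega
    rcases Nat.lt_or_ge 1 J.card with h3 | h3
    -- Deleting `N` isolates every vertex of `J`; the map gives each of them its own value and sends
    -- everything else to `none`.
    · have := h.card_lt hε N (J.map (Function.Embedding.subtype _))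
        (fun x => if x ∉ l ∧ ∃ hx : x ∉ l, (⟨x, hx⟩ : {i : V // i ∉ l}) ∈ J then some x else none)
        ?_ ?_ ?_ (by rw [Finset.card_map]; omega)
      · rwa [Finset.card_map] at this
      · intro x hx y hy hxy
        have hx' : ¬ (x ∉ l ∧ ∃ hx : x ∉ l, (⟨x, hx⟩ : {i : V // i ∉ l}) ∈ J) := by
          rintro ⟨_, hxl, hxJ⟩
          exact hy ((hmem y).2 ⟨_, hxJ, hxy⟩)
        have hy' : ¬ (y ∉ l ∧ ∃ hx : y ∉ l, (⟨y, hx⟩ : {i : V // i ∉ l}) ∈ J) := by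
          rintro ⟨_, hxl, hxJ⟩
          exact hx ((hmem x).2 ⟨_, hxJ, hxy.symm⟩)
        simp only [if_neg hx', if_neg hy']
      · intro x hx hxN
        simp only [Finset.mem_map, Function.Embedding.coe_subtype] at hx
        obtain ⟨i, _, rfl⟩ := hx
        exact i.2 (hNl _ hxN)
      · intro x hx y hy hxy
        simp only [Finset.mem_map, Function.Embedding.coe_subtype] at hx hy
        obtain ⟨i, hi, rfl⟩ := hx
        obtain ⟨j, hj, rfl⟩ := hy
        simpa [i.2, j.2, hi, hj] using hxy
    -- Toughness says nothing about a single component. Either `p` and `q` are both neighbours of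
    -- `i`, or one of them is separated from `i` by `N`.
    · obtain ⟨i, rfl⟩ := Finset.card_eq_one.1 (le_antisymm h3 h0)
      rw [Finset.card_singleton]
      have hmem' : ∀ x, x ∈ N ↔ G.Adj i.1 x := by simp [hN]
      have hiN : i.1 ∉ N := by rw [hmem']; exact G.irrefl
      have hip : p ≠ i.1 := fun e => i.2 (e ▸ hp)
      have hiq : q ≠ i.1 := fun e => i.2 (e ▸ hq)
      by_cases hpN : p ∈ N
      · by_cases hqN : q ∈ N
        · exact Finset.one_lt_card.2 ⟨p, hpN, q, hqN, hpq⟩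
        · have := h.two_lt_degree hε hiq (fun ha => hqN ((hmem' q).2 ha)) N
            (fun w hw => (hmem' w).2 hw) hiN hqN
          omega
      · have := h.two_lt_degree hε hip (fun ha => hpN ((hmem' p).2 ha)) N
          (fun w hw => (hmem' w).2 hw) hiN hpN
        omega
  obtain ⟨f, hf, hfN⟩ := (Finset.all_card_le_biUnion_card_iff_exists_injective _).1 hall
  have hfN' : ∀ i, f i ≠ w ∧ G.Adj i.1 (f i) := fun i => by
    have := hfN i
    simpa using this
  have hmate : ∀ v i, (if h : ∃ i, f i = v then some h.choose.1 else none) = some i ↔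
      ∃ hi : i ∉ l, f ⟨i, hi⟩ = v := by
    intro v i
    by_cases h : ∃ i, f i = v
    · rw [dif_pos h, Option.some.injEq]
      constructor
      · rintro rfl
        exact ⟨h.choose.2, h.choose_spec⟩
      · rintro ⟨hi, e⟩
        exact congrArg Subtype.val (hf (h.choose_spec.trans e.symm))
    · rw [dif_neg h]
      simp only [reduceCtorEq, false_iff]
      rintro ⟨hi, e⟩
      exact h ⟨_, e⟩
  have hfl : ∀ i, f i ∈ l := fun i => by
    by_contra hcon
    exact hl _ _ i.2 hcon (hfN' i).2
  refine ⟨fun v => if h : ∃ i, f i = v then some h.choose.1 else none, ?_, ?_, ?_⟩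
  · intro v i hvi
    obtain ⟨hi, rfl⟩ := (hmate v i).1 hvi
    exact ⟨(hfN' _).2.symm, hfl _, (hfN' _).1, hi⟩
  · intro v v' i hv hv'
    obtain ⟨hi, rfl⟩ := (hmate v i).1 hv
    obtain ⟨hi', rfl⟩ := (hmate v' i).1 hv'
    rfl
  · intro i hi
    exact ⟨_, hfl _, (hmate _ _).2 ⟨hi, rfl⟩⟩

end Tough

/-! ### A spine gives a Hamiltonian cycle of the prism -/

section Spine

variable {V : Type*} [Fintype V] [DecidableEq V] {G : SimpleGraph V} {ε : ℝ}

theorem EvenSpine.isPrismHamiltonian (hε : 0 < ε) (h : G.IsTough (1 + ε)) (hs : G.EvenSpine) :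
    G.IsPrismHamiltonian := by
  obtain ⟨u, v, l, hp, ha, he, hnd, hd⟩ := hs
  obtain ⟨mate, hm, hinj, hsurj⟩ := h.exists_mate hε hd hp.head_mem hp.last_mem ha.ne' u
  have hz := zigzag_path (fun v i hvi => (hm v i hvi).1) hp 0
  rw [if_pos he] at hz
  have hall : ∀ x, x ∈ zigzag mate 0 l := by
    rintro ⟨x, t⟩
    rw [mem_zigzag]
    by_cases hx : x ∈ l
    · exact ⟨x, hx, Or.inl rfl⟩
    · obtain ⟨v, hv, e⟩ := hsurj x hx
      exact ⟨v, hv, Or.inr e⟩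
  have hn := nodup_zigzag hnd (fun v i hvi => (hm v i hvi).2.2.2) hinj 0
  refine hz.isHamiltonian (by simp [boxProd_adj, ha]) hn ?_ hall
  have h1 : Fintype.card (V × Fin 2) ≤ (zigzag mate 0 l).length := by
    rw [← List.toFinset_card_of_nodup hn, ← Finset.card_univ]
    exact Finset.card_le_card fun x _ => by simp [hall x]
  have h2 : 1 < Fintype.card V := Fintype.one_lt_card_iff.2 ⟨v, u, ha.ne⟩
  rw [Fintype.card_prod, Fintype.card_fin] at h1
  omega

/-- The Hamiltonian cycle uses the two copies of `w` separately: the odd list `l₁` leads from level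
0 to level 1, and `l₂` leads back. As `w` has no rung that could carry a detour, the matching has to
avoid `w`. -/
theorem DoubleSpine.isPrismHamiltonian (hε : 0 < ε) (h : G.IsTough (1 + ε))
    (hs : G.DoubleSpine) : G.IsPrismHamiltonian := by
  obtain ⟨w, u₁, v₁, l₁, u₂, v₂, l₂, hp₁, ha₁, hb₁, ho₁, hp₂, ha₂, hb₂, ho₂, hnd, hd⟩ := hs
  obtain ⟨mate, hm, hinj, hsurj⟩ := h.exists_mate hε hd (p := w) (q := u₁) (by simp)
    (by simp [hp₁.head_mem]) ha₁.ne w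
  have hG : ∀ v i, mate v = some i → G.Adj v i := fun v i hvi => (hm v i hvi).1
  have hz₁ := zigzag_path hG hp₁ 0
  have hz₂ := zigzag_path hG hp₂ 1
  rw [if_neg (Nat.not_even_iff_odd.2 ho₁)] at hz₁
  rw [if_neg (Nat.not_even_iff_odd.2 ho₂)] at hz₂
  have hz := (hz₁.concat (w := (w, (1 : Fin 2))) (by simp [boxProd_adj, hb₁])).append
    (by simp [boxProd_adj, ha₂]) hz₂
  have hz := ListPath.cons (u := (w, (0 : Fin 2))) (by simp [boxProd_adj, ha₁]) hz
  have hadj : (G □ completeGraph (Fin 2)).Adj (v₂, 1 + 1) (w, 0) := by simp [boxProd_adj, hb₂]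
  have hw : mate w = none := by
    rw [Option.eq_none_iff_forall_ne_some]
    intro i hi
    exact (hm w i hi).2.2.1 rfl
  have hall : ∀ x, x ∈ (w, (0 : Fin 2)) :: ((zigzag mate 0 l₁ ++ [(w, (1 : Fin 2))]) ++
      zigzag mate 1 l₂) := by
    rintro ⟨x, t⟩
    simp only [List.mem_cons, List.mem_append, mem_zigzag, Prod.mk.injEq, List.not_mem_nil,
      or_false]
    by_cases hx : x ∈ w :: (l₁ ++ l₂)
    · simp only [List.mem_cons, List.mem_append] at hx
      rcases hx with rfl | hx | hx
      · have : t = 0 ∨ t = 1 := by fin_cases t <;> simp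
        tauto
      · exact Or.inr (Or.inl (Or.inl ⟨x, hx, Or.inl rfl⟩))
      · exact Or.inr (Or.inr ⟨x, hx, Or.inl rfl⟩)
    · obtain ⟨v, hv, e⟩ := hsurj x hx
      simp only [List.mem_cons, List.mem_append] at hv
      rcases hv with rfl | hv | hv
      · simp [hw] at e
      · exact Or.inr (Or.inl (Or.inl ⟨v, hv, Or.inr e⟩))
      · exact Or.inr (Or.inr ⟨v, hv, Or.inr e⟩)
  have hi : ∀ v i, mate v = some i → i ∉ w :: (l₁ ++ l₂) := fun v i hvi => (hm v i hvi).2.2.2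
  simp only [List.mem_cons, List.mem_append, not_or] at hi
  rw [List.nodup_cons, List.nodup_append, List.mem_append, not_or] at hnd
  have hn₁ := nodup_zigzag hnd.2.1 (fun v i hvi => (hi v i hvi).2.1) hinj 0
  have hn₂ := nodup_zigzag hnd.2.2.1 (fun v i hvi => (hi v i hvi).2.2) hinj 1
  have hw₁ : ∀ s t, (w, t) ∉ zigzag mate s l₁ := by
    intro s t ht
    obtain ⟨v, hv, rfl | e⟩ := mem_zigzag.1 ht
    · exact hnd.1.1 hv
    · exact (hi _ _ e).1 rfl
  have hw₂ : ∀ s t, (w, t) ∉ zigzag mate s l₂ := by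
    intro s t ht
    obtain ⟨v, hv, rfl | e⟩ := mem_zigzag.1 ht
    · exact hnd.1.2 hv
    · exact (hi _ _ e).1 rfl
  have hdis : ∀ s t, ∀ x ∈ zigzag mate s l₁, x ∉ zigzag mate t l₂ := by
    rintro s t ⟨x, r⟩ h₁ h₂
    obtain ⟨v, hv, e⟩ := mem_zigzag.1 h₁
    obtain ⟨v', hv', e'⟩ := mem_zigzag.1 h₂
    rcases e with rfl | e <;> rcases e' with rfl | e'
    · exact hnd.2.2.2 _ hv _ hv' rfl
    · exact (hi _ _ e').2.1 hv
    · exact (hi _ _ e).2.2 hv'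
    · exact hnd.2.2.2 _ hv _ hv' (hinj _ _ _ e e')
  have hn : ((w, (0 : Fin 2)) :: ((zigzag mate 0 l₁ ++ [(w, (1 : Fin 2))]) ++
      zigzag mate 1 l₂)).Nodup := by
    rw [List.nodup_cons, List.nodup_append, List.nodup_append]
    refine ⟨by simp [hw₁, hw₂], ⟨hn₁, by simp, ?_⟩, hn₂, ?_⟩
    · rintro x hx y hy rfl
      rw [List.mem_singleton] at hy
      exact hw₁ _ _ (hy ▸ hx)
    · rintro x hx y hy rfl
      rw [List.mem_append, List.mem_singleton] at hx
      rcases hx with hx | rfl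
      · exact hdis _ _ _ hx hy
      · exact hw₂ _ _ hy
  refine hz.isHamiltonian hadj hn ?_ hall
  have h1 := List.length_pos_of_mem hz₁.head_mem
  have h2 := List.length_pos_of_mem hz₂.head_mem
  simp only [List.length_cons, List.length_append]
  omega

end Spine

/-! ### Short connections in 5-chordal graphs -/

theorem Walk.mem_edges_of_support_eq {V : Type*} {G : SimpleGraph V} {u v : V} (p : G.Walk u v)
    {l₁ l₂ : List V} {x y : V} (h : p.support = l₁ ++ x :: y :: l₂) : s(x, y) ∈ p.edges := by
  induction p generalizing l₁ with
  | nil =>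
    have := congrArg List.length h
    simp at this
    omega
  | cons ha p ih =>
    rw [Walk.support_cons] at h
    cases l₁ with
    | nil =>
      rw [List.nil_append, List.cons.injEq] at h
      have h2 := h.2
      rw [← p.cons_tail_support, List.cons.injEq] at h2
      simp [← h.1, ← h2.1]
    | cons z l₁ =>
      rw [List.cons_append, List.cons.injEq] at h
      rw [Walk.edges_cons]
      exact List.mem_cons_of_mem _ (ih h.2)

theorem exists_append_of_not_nodup {V : Type*} {l : List V} (h : ¬ l.Nodup) :
    ∃ l₁ x l₂ l₃, l = l₁ ++ x :: (l₂ ++ x :: l₃) := by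
  induction l with
  | nil => simp at h
  | cons a l ih =>
    by_cases ha : a ∈ l
    · obtain ⟨s, t, rfl⟩ := List.append_of_mem ha
      exact ⟨[], a, s, t, rfl⟩
    · obtain ⟨l₁, x, l₂, l₃, rfl⟩ := ih fun hl => h (List.nodup_cons.2 ⟨ha, hl⟩)
      exact ⟨a :: l₁, x, l₂, l₃, rfl⟩

theorem exists_append_of_mem_of_ne {V : Type*} {l : List V} {x y : V} (hx : x ∈ l) (hy : y ∈ l)
    (hxy : x ≠ y) : (∃ l₁ l₂ l₃, l = l₁ ++ x :: (l₂ ++ y :: l₃)) ∨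
      ∃ l₁ l₂ l₃, l = l₁ ++ y :: (l₂ ++ x :: l₃) := by
  obtain ⟨s, t, rfl⟩ := List.append_of_mem hx
  rw [List.mem_append, List.mem_cons] at hy
  rcases hy with hy | rfl | hy
  · obtain ⟨p, q, rfl⟩ := List.append_of_mem hy
    exact Or.inr ⟨p, q, t, by simp⟩
  · exact absurd rfl hxy
  · obtain ⟨p, q, rfl⟩ := List.append_of_mem hy
    exact Or.inl ⟨s, p, q, rfl⟩

/-- In a 5-chordal graph, adjacent vertices that are connected within a set of further vertices
are connected through one or two vertices of that set. -/
theorem IsKChordal.exists_short {V : Type*} {G : SimpleGraph V} (hC : G.IsKChordal 5) {a c : V}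
    (hac : G.Adj a c) {m : List V} {x y : V} (hm : G.ListPath x y m) (ha : G.Adj a x)
    (hc : G.Adj y c) (ham : a ∉ m) (hcm : c ∉ m) :
    (∃ u ∈ m, G.Adj a u ∧ G.Adj u c) ∨
      ∃ u ∈ m, ∃ v ∈ m, G.Adj a u ∧ G.Adj u v ∧ G.Adj v c := by
  induction hn : m.length using Nat.strong_induction_on generalizing m x y with
  | _ n ih =>
  have step : ∀ m' x' y', m'.length < m.length → m' ⊆ m → G.ListPath x' y' m' → G.Adj a x' →
      G.Adj y' c → (∃ u ∈ m, G.Adj a u ∧ G.Adj u c) ∨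
        ∃ u ∈ m, ∃ v ∈ m, G.Adj a u ∧ G.Adj u v ∧ G.Adj v c := by
    intro m' x' y' hlt hsub h' ha' hc'
    rcases ih _ (hn ▸ hlt) h' ha' hc' (fun h => ham (hsub h)) (fun h => hcm (hsub h)) rfl with
      ⟨u, hu, h⟩ | ⟨u, hu, v, hv, h⟩
    · exact Or.inl ⟨u, hsub hu, h⟩
    · exact Or.inr ⟨u, hsub hu, v, hsub hv, h⟩
  by_cases hnd : m.Nodup
  swap
  · obtain ⟨l₁, z, l₂, l₃, rfl⟩ := exists_append_of_not_nodup hnd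
    refine step (l₁ ++ z :: l₃) x y ?_ (by intro w; simp; tauto) ?_ ha hc
    · simp only [List.length_append, List.length_cons]; omega
    · have h1 := hm.split_at
      rw [← List.cons_append] at h1
      have h2 := h1.2.split_at
      obtain rfl | ⟨w, l₃', rfl⟩ : l₃ = [] ∨ ∃ w l, l₃ = w :: l := by cases l₃ <;> simp
      · have := h2.2.of_concat (l := [])
        simpa [this] using h1.1
      · have h3 := h2.2.uncons
        have := h1.1.append h3.1 h3.2
        simpa using this
  match m, hm, hnd, ham, hcm, hn, step, ih with
  | [], hm, _, _, _, _, _, _ => exact absurd rfl hm.ne_nil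
  | [z], hm, _, _, _, _, _, _ =>
    have h1 := hm.of_cons
    have h2 := hm.of_concat (l := [])
    subst h1 h2
    exact Or.inl ⟨_, by simp, ha, hc⟩
  | [z, w], hm, _, _, _, _, _, _ =>
    have h1 := hm.of_cons
    have h2 := hm.of_concat (l := [z])
    subst h1 h2
    exact Or.inr ⟨_, by simp, _, by simp, ha, hm.uncons.1, hc⟩
  | z :: w :: r :: k, hm, hnd, ham, hcm, _, step, _ =>
    set m := z :: w :: r :: k with hmdef
    have hlen : 3 ≤ m.length := by simp [hmdef]
    clear_value m
    have hp : G.ListPath a c (a :: (m ++ [c])) := (hm.concat hc).cons ha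
    have hnd' : (a :: (m ++ [c])).Nodup := by
      rw [List.nodup_cons, List.nodup_append]
      refine ⟨by simp [ham, hac.ne], hnd, by simp, ?_⟩
      rintro s hs t ht rfl
      simp at ht
      exact hcm (ht ▸ hs)
    obtain ⟨p, hps, hpc⟩ := hp.exists_isCycle hac.symm hnd' (by simp; omega)
    obtain ⟨s, hs, t, ht, hst, hne⟩ := hC _ _ hpc (by
      have := p.length_support
      rw [hps] at this
      rw [Walk.length_cons]
      simp at this
      omega)
    rw [Walk.support_cons, hps] at hs ht
    have hs : s ∈ a :: (m ++ [c]) := by simp at hs ⊢; tauto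
    have ht : t ∈ a :: (m ++ [c]) := by simp at ht ⊢; tauto
    rw [Walk.edges_cons, List.mem_cons, not_or] at hne
    -- A chord shortcuts `m`. According to whether `s` is `a` and whether `t` is `c`, the start, the
    -- end or an inner part of `m` is skipped; the chord is not `ac`, which is an edge of the cycle.
    have key : ∀ s t, G.Adj s t → s(s, t) ≠ s(c, a) → s(s, t) ∉ p.edges →
        (∃ l₁ l₂ l₃, a :: (m ++ [c]) = l₁ ++ s :: (l₂ ++ t :: l₃)) →
        (∃ u ∈ m, G.Adj a u ∧ G.Adj u c) ∨
        ∃ u ∈ m, ∃ v ∈ m, G.Adj a u ∧ G.Adj u v ∧ G.Adj v c := by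
      rintro s t hst hne hedge ⟨l₁, l₂, l₃, e⟩
      have hl₂ : l₂ ≠ [] := by
        rintro rfl
        exact hedge (p.mem_edges_of_support_eq (hps.trans e))
      have hl₂' := List.length_pos_of_ne_nil hl₂
      cases l₁ with
      | nil =>
        rw [List.nil_append, List.cons.injEq] at e
        obtain ⟨rfl, e⟩ := e
        rcases List.eq_nil_or_concat l₃ with rfl | ⟨l₃, d, rfl⟩
        · have := List.append_inj_right' e rfl
          simp at this
          subst this
          exact absurd Sym2.eq_swap hne
        · rw [List.concat_eq_append] at e
          have e' : m ++ [c] = (l₂ ++ t :: l₃) ++ [d] := by simpa using e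
          obtain ⟨rfl, e''⟩ := List.append_inj' e' rfl
          refine step (t :: l₃) t y ?_ (by intro w; simp; tauto) hm.split_at.2 hst hc
          simp only [List.length_append, List.length_cons]; omega
      | cons b l₁ =>
        rw [List.cons_append, List.cons.injEq] at e
        obtain ⟨rfl, e⟩ := e
        rcases List.eq_nil_or_concat l₃ with rfl | ⟨l₃, d, rfl⟩
        · have e' : m ++ [c] = (l₁ ++ s :: l₂) ++ [t] := by simpa using e
          obtain ⟨rfl, e''⟩ := List.append_inj' e' rfl
          simp at e''
          subst e''
          refine step (l₁ ++ [s]) x s ?_ (by intro w; simp; tauto) hm.split_at.1 ha hst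
          simp only [List.length_append, List.length_cons, List.length_nil]; omega
        · rw [List.concat_eq_append] at e
          have e' : m ++ [c] = (l₁ ++ s :: (l₂ ++ t :: l₃)) ++ [d] := by simpa using e
          obtain ⟨rfl, e''⟩ := List.append_inj' e' rfl
          have h1 := hm.split_at
          rw [← List.cons_append] at h1
          refine step ((l₁ ++ [s]) ++ t :: l₃) x y ?_ (by intro w; simp; tauto)
            (h1.1.append hst h1.2.split_at.2) ha hc
          simp only [List.length_append, List.length_cons, List.length_nil]; omega
    rcases exists_append_of_mem_of_ne hs ht hst.ne with h | h
    · exact key s t hst hne.1 hne.2 h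
    · exact key t s hst.symm (by rw [Sym2.eq_swap]; exact hne.1)
        (by rw [Sym2.eq_swap]; exact hne.2) h

/-! ### Modifying a dominating cycle near its ends -/

theorem ListPath.join {V : Type*} {G : SimpleGraph V} {u v w : V} {l k : List V}
    (h₁ : G.ListPath u v (l ++ [v])) (h₂ : G.ListPath v w (v :: k)) :
    G.ListPath u w (l ++ v :: k) := by
  cases k with
  | nil =>
    have : w = v := h₂.of_concat (l := [])
    subst this
    exact h₁
  | cons y k =>
    have h := h₂.uncons
    simpa using h₁.append h.1 h.2

/-- `C` lists the elements of `S` without repetition. -/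
def IsListing {V : Type*} (S : Set V) (C : List V) : Prop :=
  C.Nodup ∧ ∀ v, v ∈ S ↔ v ∈ C

theorem IsListing.perm {V : Type*} {S : Set V} {C C' : List V} (h : IsListing S C)
    (hp : C.Perm C') : IsListing S C' :=
  ⟨hp.nodup_iff.1 h.1, fun v => (h.2 v).trans hp.mem_iff⟩

section Swap

variable {V : Type*} {G : SimpleGraph V} {S : Set V}

/-- The set `S` dominates all edges, and there is no spine. -/
structure Spineless (G : SimpleGraph V) (S : Set V) : Prop where
  even : ¬ G.EvenSpine
  double : ¬ G.DoubleSpine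
  dom : ∀ u v, u ∉ S → v ∉ S → ¬ G.Adj u v

/-- Adding the vertices `I` to `S` and removing the vertices `R` keeps all edges dominated. -/
structure Swap (G : SimpleGraph V) (S : Set V) (I R : List V) : Prop where
  nodup : I.Nodup
  out : ∀ i ∈ I, i ∉ S
  rem : ∀ r ∈ R, ∀ v, G.Adj r v → v ∈ S ∧ v ∉ R

theorem Swap.nil : Swap G S [] [] := ⟨by simp, by simp, by simp⟩

theorem Swap.single {w : V} (hw : w ∉ S) : Swap G S [w] [] :=
  ⟨by simp, by simpa using hw, by simp⟩

/-- The permutation says that `l` lists S with `I` added and `R` removed. A removed vertex has all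
its neighbours in S outside `R`, hence in `l`, so no edge loses its last end. -/
theorem Swap.nodup_dominates {I R C l : List V} (h : Swap G S I R)
    (hdom : ∀ u v, u ∉ S → v ∉ S → ¬ G.Adj u v) (hC : IsListing S C)
    (hp : (R ++ l).Perm (I ++ C)) : l.Nodup ∧ G.Dominates l := by
  have hn : (I ++ C).Nodup := by
    rw [List.nodup_append]
    refine ⟨h.nodup, hC.1, ?_⟩
    rintro x hx y hy rfl
    exact h.out _ hx ((hC.2 _).2 hy)
  refine ⟨(List.nodup_append.1 (hp.nodup_iff.2 hn)).2.1, ?_⟩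
  have hmem : ∀ x ∈ S, x ∈ R ∨ x ∈ l := fun x hx =>
    List.mem_append.1 (hp.mem_iff.2 (List.mem_append_right _ ((hC.2 x).1 hx)))
  have key : ∀ u v, u ∉ l → v ∉ l → u ∈ S → ¬ G.Adj u v := by
    intro u v hu hv huS huv
    have h1 := h.rem u ((hmem u huS).resolve_right hu) v huv
    exact ((hmem v h1.1).resolve_right hv |> h1.2)
  intro u v hu hv huv
  by_cases hS : u ∈ S
  · exact key u v hu hv hS huv
  · by_cases hS' : v ∈ S
    · exact key v u hv hu hS' huv.symm
    · exact hdom u v hS hS' huv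

theorem Spineless.no_even (h : Spineless G S) {I R C l : List V} {u v : V} (hs : Swap G S I R)
    (hC : IsListing S C) (hp : G.ListPath u v l) (ha : G.Adj v u) (he : l.length % 2 = 0)
    (hperm : (R ++ l).Perm (I ++ C)) : False := by
  have := hs.nodup_dominates h.dom hC hperm
  exact h.even ⟨u, v, l, hp, ha, Nat.even_iff.2 he, this.1, this.2⟩

theorem Spineless.no_double (h : Spineless G S) {I R C l₁ l₂ : List V} {u₁ v₁ u₂ v₂ w : V}
    (hs : Swap G S I R) (hC : IsListing S C) (hp₁ : G.ListPath u₁ v₁ l₁) (hu₁ : G.Adj w u₁)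
    (hv₁ : G.Adj v₁ w) (hp₂ : G.ListPath u₂ v₂ l₂) (hu₂ : G.Adj w u₂)
    (hv₂ : G.Adj v₂ w) (ho₁ : l₁.length % 2 = 1) (ho₂ : l₂.length % 2 = 1)
    (hperm : (R ++ w :: (l₁ ++ l₂)).Perm (I ++ C)) : False := by
  have := hs.nodup_dominates h.dom hC hperm
  exact h.double ⟨w, u₁, v₁, l₁, u₂, v₂, l₂, hp₁, hu₁, hv₁, Nat.odd_iff.2 ho₁, hp₂, hu₂, hv₂,
    Nat.odd_iff.2 ho₂, this.1, this.2⟩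

/-- A path starting with the edge `xy` of `S` can be changed at its start: `E` replaces `x` and
starts at `u`, at the cost of adding the vertices `I` and removing the vertices `R`.
The label `ℓ` keeps track of the parity. -/
structure IsPrefix (G : SimpleGraph V) (S : Set V) (x y : V) (ℓ : ℕ) (u : V)
    (E I R : List V) : Prop where
  path : ∀ v l, G.ListPath y v l → G.ListPath u v (E ++ l)
  perm : (R ++ E).Perm (I ++ [x])
  parity : (E.length + ℓ) % 2 = 1
  length : E.length ≤ 2
  nodup : I.Nodup
  out : ∀ i ∈ I, i ∉ S
  mem : ∀ i ∈ I, i = u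
  two : E.length = 2 → u ∉ S
  rem : ∀ r ∈ R, r = x ∧ ∀ v, G.Adj r v → v ∈ S

theorem isPrefix_zero {x y : V} (h : G.Adj x y) : IsPrefix G S x y 0 x [x] [] [] where
  path _ _ hl := hl.cons h
  perm := by simp
  parity := by simp
  length := by simp
  nodup := by simp
  out := by simp
  mem := by simp
  two := by simp
  rem := by simp

/-- The edge `xu` chosen at the start of a path with first edge `xy`: if possible, `u` is outside
`S`. -/
def IsEnd (G : SimpleGraph V) (S : Set V) (x y u : V) : Prop :=
  G.Adj x u ∧ (u ∉ S ∨ u = y ∧ ∀ v, G.Adj x v → v ∈ S)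

theorem exists_isEnd {x y : V} (h : G.Adj x y) : ∃ u, IsEnd G S x y u := by
  by_cases hS : ∀ v, G.Adj x v → v ∈ S
  · exact ⟨y, h, Or.inr ⟨rfl, hS⟩⟩
  · push Not at hS
    obtain ⟨u, hu, huS⟩ := hS
    exact ⟨u, hu, Or.inl huS⟩

/-- If `u` is outside S, it is put in front of `x`. Otherwise `u = y` and `x` is dropped, which is
harmless because all neighbours of `x` lie in S. Both change the length by one, whence the label 1.
-/
theorem IsEnd.isPrefix {x y u : V} (h : IsEnd G S x y u) (hxy : G.Adj x y) :
    ∃ E I R, IsPrefix G S x y 1 u E I R := by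
  rcases h with ⟨hxu, hu | ⟨rfl, hS⟩⟩
  · exact ⟨[u, x], [u], [], fun _ _ hl => (hl.cons hxy).cons hxu.symm, by simp, by simp, by simp,
      by simp, by simpa using hu, by simp, fun _ => hu, by simp⟩
  · exact ⟨[], [], [x], fun _ _ hl => hl, by simp, by simp, by simp, by simp, by simp, by simp,
      by simp, by simpa using hS⟩

/-- The edge `xu` sends an edge to the vertex `v` outside it. -/
def Hits (G : SimpleGraph V) (x u v : V) : Prop :=
  v ≠ x ∧ v ≠ u ∧ (G.Adj x v ∨ G.Adj u v)

theorem IsEnd.exists_of_hits {x y u v : V} (h : IsEnd G S x y u) (hxy : G.Adj x y)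
    (hv : Hits G x u v) : ∃ ℓ w E I R, IsPrefix G S x y ℓ w E I R ∧
      (w = x ∨ w = u) ∧ (∀ i ∈ I, i = u) ∧ G.Adj w v := by
  rcases hv.2.2 with h1 | h1
  · exact ⟨0, x, [x], [], [], isPrefix_zero hxy, Or.inl rfl, by simp, h1⟩
  · obtain ⟨E, I, R, hp⟩ := h.isPrefix hxy
    exact ⟨1, u, E, I, R, hp, Or.inr rfl, hp.mem, h1⟩

theorem IsPrefix.swap {x y u : V} {ℓ : ℕ} {E I R : List V} (h : IsPrefix G S x y ℓ u E I R) :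
    Swap G S I R := by
  refine ⟨h.nodup, h.out, fun r hr v hv => ⟨(h.rem r hr).2 v hv, fun hvR => ?_⟩⟩
  rw [(h.rem r hr).1, (h.rem v hvR).1] at hv
  exact G.irrefl hv

/-- Only `x` and `x'` can be removed, and removing both leaves an undominated edge only if they are
adjacent. -/
theorem IsPrefix.swap_two {x y u x' y' u' : V} {ℓ ℓ' : ℕ} {E I R E' I' R' : List V}
    (h : IsPrefix G S x y ℓ u E I R) (h' : IsPrefix G S x' y' ℓ' u' E' I' R')
    (hI : ∀ i ∈ I, i ∉ I') (hx : ¬ G.Adj x x') : Swap G S (I ++ I') (R ++ R') := by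
  refine ⟨?_, ?_, ?_⟩
  · rw [List.nodup_append]
    refine ⟨h.nodup, h'.nodup, ?_⟩
    rintro i hi j hj rfl
    exact hI _ hi hj
  · intro i hi
    rcases List.mem_append.1 hi with hi | hi
    exacts [h.out _ hi, h'.out _ hi]
  · intro r hr v hv
    simp only [List.mem_append, not_or] at hr ⊢
    have h1 := h.swap.rem
    have h2 := h'.swap.rem
    rcases hr with hr | hr
    · refine ⟨(h1 r hr v hv).1, (h1 r hr v hv).2, fun hvR => ?_⟩
      rw [(h.rem r hr).1, (h'.rem v hvR).1] at hv
      exact hx hv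
    · refine ⟨(h2 r hr v hv).1, fun hvR => ?_, (h2 r hr v hv).2⟩
      rw [(h'.rem r hr).1, (h.rem v hvR).1] at hv
      exact hx hv.symm

theorem Swap.insert {I R : List V} (h : Swap G S I R) {w : V} (hw : w ∉ S) (hwI : w ∉ I) :
    Swap G S (w :: I) R := by
  refine ⟨by simp [h.nodup, hwI], ?_, h.rem⟩
  intro i hi
  rcases List.mem_cons.1 hi with rfl | hi
  exacts [hw, h.out _ hi]

end Swap

/-! ### A triangle and three even paths joining its vertices -/

section Triangle

variable {V : Type*} {G : SimpleGraph V} {S : Set V} {a b c : V} {A D Z : List V}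

/-- `abc` is a triangle, and the even paths `A`, `D`, `Z` join `a` to `b`, `b` to `c` and
`c` to `a`, to form a cycle through the set `S`. -/
structure IsTri (G : SimpleGraph V) (S : Set V) (a b c : V) (A D Z : List V) : Prop where
  ab : G.Adj a b
  bc : G.Adj b c
  ca : G.Adj c a
  pathA : G.ListPath a b (a :: (A ++ [b]))
  pathD : G.ListPath b c (b :: (D ++ [c]))
  pathZ : G.ListPath c a (c :: (Z ++ [a]))
  evenA : A.length % 2 = 0
  evenD : D.length % 2 = 0
  evenZ : Z.length % 2 = 0
  listing : IsListing S (a :: (A ++ b :: (D ++ c :: Z)))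

namespace IsTri

theorem rotate (h : IsTri G S a b c A D Z) : IsTri G S b c a D Z A where
  ab := h.bc
  bc := h.ca
  ca := h.ab
  pathA := h.pathD
  pathD := h.pathZ
  pathZ := h.pathA
  evenA := h.evenD
  evenD := h.evenZ
  evenZ := h.evenA
  listing := h.listing.perm <| by
    classical
    refine List.perm_iff_count.2 fun z => ?_
    simp only [List.count_append, List.count_cons]
    ring

theorem reflect (h : IsTri G S a b c A D Z) :
    IsTri G S c b a D.reverse A.reverse Z.reverse where
  ab := h.bc.symm
  bc := h.ab.symm
  ca := h.ca.symm
  pathA := by simpa using h.pathD.reverse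
  pathD := by simpa using h.pathA.reverse
  pathZ := by simpa using h.pathZ.reverse
  evenA := by simpa using h.evenD
  evenD := by simpa using h.evenA
  evenZ := by simpa using h.evenZ
  listing := h.listing.perm <| by
    classical
    refine List.perm_iff_count.2 fun z => ?_
    simp only [List.count_append, List.count_cons, List.count_reverse]
    ring

/-- If `A` is empty, then c, b, D and c, Z, a are two even cycles sharing c. -/
theorem ne_nil (h : IsTri G S a b c A D Z) (hS : Spineless G S) : A ≠ [] := by
  rintro rfl
  have h1 := h.pathD.reverse
  have hD : ∃ y, G.ListPath b y (b :: D) ∧ G.Adj y c := by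
    obtain ⟨x, y, h1, h2, h3⟩ := ListPath.split_append (l₁ := b :: D) (l₂ := [c])
      (by simpa using h.pathD) (by simp) (by simp)
    rw [h3.of_cons] at h2
    exact ⟨x, h1, h2⟩
  have hZ : ∃ z, G.Adj c z ∧ G.ListPath z a (Z ++ [a]) := by
    obtain ⟨x, y, h1, h2, h3⟩ := ListPath.split_append (l₁ := [c]) (l₂ := Z ++ [a])
      (by simpa using h.pathZ) (by simp) (by simp)
    rw [h1.of_concat (l := [])] at h2
    exact ⟨y, h2, h3⟩
  obtain ⟨y, hy, hyc⟩ := hD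
  obtain ⟨z, hcz, hz⟩ := hZ
  refine hS.no_double Swap.nil h.listing hy h.bc.symm hyc hz hcz h.ca.symm ?_ ?_ ?_
  · have := h.evenD; simp only [List.length_cons]; omega
  · have := h.evenZ; simp only [List.length_append, List.length_cons, List.length_nil]; omega
  · classical
    refine List.perm_iff_count.2 fun z => ?_
    simp only [List.count_append, List.count_cons, List.nil_append, List.count_nil]
    ring

/-- The path `A` starts with two vertices. -/
theorem exists_cons_cons (h : IsTri G S a b c A D Z) (hS : Spineless G S) :
    ∃ x x' A', A = x :: x' :: A' := by
  have h1 := h.ne_nil hS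
  have h2 := h.evenA
  match A, h1, h2 with
  | x :: x' :: A', _, _ => exact ⟨x, x', A', rfl⟩

/-- The ends after `b` and after `c` cannot be linked by a path outside `S`. -/
theorem no_link {d d' z z' : V} {D' Z' : List V} (hS : Spineless G S)
    (h : IsTri G S a b c A (d :: d' :: D') (z :: z' :: Z')) {ℓ ℓ' : ℕ} {u u' : V}
    {E I R E' I' R' J : List V}
    (hP : IsPrefix G S d d' ℓ u E I R) (hP' : IsPrefix G S z z' ℓ' u' E' I' R')
    (hsw : Swap G S (J ++ (I ++ I')) (R ++ R'))
    (hJ : ∀ s t l l', G.ListPath s u l → G.ListPath u' t l' → G.ListPath s t (l ++ (J ++ l'))) :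
    False := by
  have hD := hP.path _ _ (ListPath.split (l₁ := [b]) (by simpa using h.pathD)).2.2
  have hZ := hP'.path _ _ (ListPath.split (l₁ := [c]) (by simpa using h.pathZ)).2.2
  have hl := hP.parity
  have hl' := hP'.parity
  have e1 := h.evenA
  have e2 := h.evenD
  have e3 := h.evenZ
  simp only [List.length_cons] at e2 e3
  have hDr := hD.reverse
  have hlink := hJ _ _ _ _ hDr hZ
  have hp : ∀ w : V, ∀ [DecidableEq V], R.count w + E.count w = I.count w + [d].count w := by
    intro w _
    simpa using hP.perm.count_eq w
  have hp' : ∀ w : V, ∀ [DecidableEq V], R'.count w + E'.count w = I'.count w + [z].count w := by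
    intro w _
    simpa using hP'.perm.count_eq w
  -- The link joins `c`, back along `D`, to `Z` and on to `a`. If this path has evenly many
  -- vertices, the edge `ca` closes it to an even cycle that shares `a` with the even cycle a, A, b.
  -- If not, continuing along `A` and closing with `bc` gives one even cycle.
  rcases Nat.mod_two_eq_zero_or_one (ℓ + ℓ' + J.length) with hpar | hpar
  · obtain ⟨x, hax, hx⟩ : ∃ x, G.Adj a x ∧ G.ListPath x b (A ++ [b]) := by
      obtain ⟨x, y, h1, h2, h3⟩ := ListPath.split_append (l₁ := [a]) (l₂ := A ++ [b])
        (by simpa using h.pathA) (by simp) (by simp)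
      rw [h1.of_concat (l := [])] at h2
      exact ⟨y, h2, h3⟩
    obtain ⟨q, y, hq, hqa, hya⟩ := ListPath.split_append
      (l₁ := (E ++ (d' :: (D' ++ [c]))).reverse ++ (J ++ (E' ++ (z' :: Z')))) (l₂ := [a])
      (by simpa using hlink) (by simp) (by simp)
    rw [hya.of_cons] at hqa
    refine hS.no_double hsw h.listing hx hax h.ab.symm hq h.ca.symm hqa ?_ ?_ ?_
    · simp only [List.length_append, List.length_cons, List.length_nil]; omega
    · simp only [List.length_append, List.length_cons, List.length_nil, List.length_reverse]; omega
    · classical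
      refine List.perm_iff_count.2 fun w => ?_
      have h1 := hp w
      have h2 := hp' w
      simp only [List.count_append, List.count_cons, List.count_reverse, List.count_nil] at h1 h2 ⊢
      linarith
  · have hcyc := ListPath.join (l := (E ++ (d' :: (D' ++ [c]))).reverse ++ (J ++ (E' ++ (z' :: Z'))))
      (by simpa using hlink) h.pathA
    refine hS.no_even hsw h.listing hcyc h.bc ?_ ?_
    · simp only [List.length_append, List.length_cons, List.length_nil, List.length_reverse]; omega
    · classical
      refine List.perm_iff_count.2 fun w => ?_
      have h1 := hp w
      have h2 := hp' w
      simp only [List.count_append, List.count_cons, List.count_reverse, List.count_nil] at h1 h2 ⊢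
      linarith

end IsTri

end Triangle

/-! ### Ends after different corners of the triangle are remote -/

section Remoteness

variable {V : Type*} {G : SimpleGraph V} {S : Set V} {a b c d d' z z' ud uz : V}
  {A D Z D' Z' : List V}

theorem remote_mk {x u y v : V} (h₁ : x ≠ y ∧ ¬ G.Adj x y) (h₂ : x ≠ v ∧ ¬ G.Adj x v)
    (h₃ : u ≠ y ∧ ¬ G.Adj u y) (h₄ : u ≠ v ∧ ¬ G.Adj u v) : G.Remote s(x, u) s(y, v) := by
  intro p hp q hq
  rw [Sym2.mem_iff] at hp hq
  rcases hp with rfl | rfl <;> rcases hq with rfl | rfl <;> assumption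

theorem Remote.symm {e f : Sym2 V} (h : G.Remote e f) : G.Remote f e :=
  fun u hu v hv => ⟨(h v hv u hu).1.symm, fun ha => (h v hv u hu).2 ha.symm⟩

namespace IsTri

theorem adj_ends (h : IsTri G S a b c A (d :: d' :: D') Z) : G.Adj b d ∧ G.Adj d d' := by
  have := (ListPath.uncons (x := b) (y := d) (by simpa using h.pathD))
  exact ⟨this.1, (this.2).uncons.1⟩

variable (hS : Spineless G S) (h : IsTri G S a b c A (d :: d' :: D') (z :: z' :: Z'))
  (hd : IsEnd G S d d' ud) (hz : IsEnd G S z z' uz)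
include hS h

theorem not_adj {ℓ ℓ' : ℕ} {u u' : V} {E I R E' I' R' : List V}
    (hP : IsPrefix G S d d' ℓ u E I R) (hP' : IsPrefix G S z z' ℓ' u' E' I' R')
    (hsw : Swap G S (I ++ I') (R ++ R')) : ¬ G.Adj u u' := fun ha =>
  h.no_link (J := []) hS hP hP' hsw fun _ _ _ _ h₁ h₂ => h₁.append ha h₂

theorem no_common {ℓ ℓ' : ℕ} {u u' w : V} {E I R E' I' R' : List V}
    (hP : IsPrefix G S d d' ℓ u E I R) (hP' : IsPrefix G S z z' ℓ' u' E' I' R')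
    (hsw : Swap G S (I ++ I') (R ++ R')) (hw : w ∉ S) (hwI : w ∉ I ++ I') (hu : G.Adj u w) :
    ¬ G.Adj u' w := fun hu' =>
  h.no_link (J := [w]) hS hP hP' (hsw.insert hw hwI) fun _ _ _ _ h₁ h₂ => by
    simpa using (h₁.concat hu).append hu'.symm h₂

theorem not_adj_zero : ¬ G.Adj d z :=
  h.not_adj hS (isPrefix_zero h.adj_ends.2) (isPrefix_zero h.rotate.adj_ends.2) Swap.nil

include hd hz

theorem end_ne_end : ud ≠ uz := by
  rintro rfl
  by_cases hu : ud ∈ S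
  · have h1 := hd.2.resolve_left (fun h' => h' hu)
    have h2 := hz.2.resolve_left (fun h' => h' hu)
    have hn := h.listing.1
    rw [← h1.1, ← h2.1] at hn
    simp [List.nodup_append] at hn
  · exact h.no_common hS (isPrefix_zero h.adj_ends.2) (isPrefix_zero h.rotate.adj_ends.2)
      Swap.nil hu (by simp) hd.1 hz.1

theorem swap_ends {ℓ ℓ' : ℕ} {u u' : V} {E I R E' I' R' : List V}
    (hP : IsPrefix G S d d' ℓ u E I R) (hP' : IsPrefix G S z z' ℓ' u' E' I' R')
    (hI : ∀ i ∈ I, i = ud) (hI' : ∀ i ∈ I', i = uz) : Swap G S (I ++ I') (R ++ R') :=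
  hP.swap_two hP' (fun i hi hi' => h.end_ne_end hS hd hz ((hI i hi).symm.trans (hI' i hi')))
    (h.not_adj_zero hS)

/-- Each vertex of an end edge can be made the start of its path by a prefix of label 0 or 1, so an
edge between the two ends would be a link as excluded by `no_link`. -/
theorem remote_ends : G.Remote s(d, ud) s(z, uz) := by
  have hm := h.listing.2
  have hn := h.listing.1
  have hdd := h.adj_ends.2
  have hzz := h.rotate.adj_ends.2
  obtain ⟨E, I, R, hP⟩ := hd.isPrefix hdd
  obtain ⟨E', I', R', hP'⟩ := hz.isPrefix hzz
  refine remote_mk ⟨?_, h.not_adj_zero hS⟩ ⟨?_, ?_⟩ ⟨?_, ?_⟩ ⟨h.end_ne_end hS hd hz, ?_⟩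
  · rintro rfl
    simp [List.nodup_append] at hn
  · rintro rfl
    have h1 := hz.2.resolve_left (fun h' => h' ((hm _).2 (by simp)))
    rw [← h1.1] at hn
    simp [List.nodup_append] at hn
  · exact h.not_adj hS (isPrefix_zero hdd) hP'
      (h.swap_ends hS hd hz (isPrefix_zero hdd) hP' (by simp) hP'.mem)
  · rintro rfl
    have h1 := hd.2.resolve_left (fun h' => h' ((hm _).2 (by simp)))
    rw [← h1.1] at hn
    simp [List.nodup_append] at hn
  · exact h.not_adj hS hP (isPrefix_zero hzz)
      (h.swap_ends hS hd hz hP (isPrefix_zero hzz) hP.mem (by simp))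
  · exact h.not_adj hS hP hP' (h.swap_ends hS hd hz hP hP' hP.mem hP'.mem)

theorem not_hits_of_notMem {w : V} (hw : w ∉ S) (h₁ : Hits G d ud w) : ¬ Hits G z uz w := by
  intro h₂
  obtain ⟨ℓ, u, E, I, R, hP, -, hI, hu⟩ := hd.exists_of_hits h.adj_ends.2 h₁
  obtain ⟨ℓ', u', E', I', R', hP', -, hI', hu'⟩ := hz.exists_of_hits h.rotate.adj_ends.2 h₂
  refine h.no_common hS hP hP' (h.swap_ends hS hd hz hP hP' hI hI') hw ?_ hu hu'
  rw [List.mem_append]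
  rintro (hi | hi)
  · exact h₁.2.1 (hI _ hi)
  · exact h₂.2.1 (hI' _ hi)

end IsTri

end Remoteness

/-! ### Counting the vertices hit by two edges -/

section PairSum

variable {V : Type*}

/-- The sum of `g p + f q` over the pairs `p, q` of consecutive elements of a list. -/
def pairSum (g f : V → ℕ) : List V → ℕ
  | p :: q :: l => g p + f q + pairSum g f (q :: l)
  | _ => 0

variable {g f : V → ℕ}

theorem pairSum_append (l₁ l₂ : List V) (p : V) :
    pairSum g f (l₁ ++ p :: l₂) = pairSum g f (l₁ ++ [p]) + pairSum g f (p :: l₂) := by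
  induction l₁ with
  | nil => simp [pairSum]
  | cons x l ih =>
    cases l with
    | nil => simp [pairSum]
    | cons y l =>
      simp only [List.cons_append, pairSum] at ih ⊢
      rw [ih]
      ring

theorem pairSum_cons_cons (p q : V) (l : List V) :
    pairSum g f (p :: q :: l) = g p + f q + pairSum g f (q :: l) := rfl

theorem pairSum_cons_append (r : V) (l₁ l₂ : List V) (p : V) :
    pairSum g f (r :: (l₁ ++ p :: l₂)) =
      pairSum g f (r :: (l₁ ++ [p])) + pairSum g f (p :: l₂) :=
  pairSum_append (r :: l₁) l₂ p

theorem pairSum_le {l : List V} (h : ∀ l₁ p q l₂, l = l₁ ++ p :: q :: l₂ → g p + f q ≤ 1) :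
    pairSum g f l ≤ l.length - 1 := by
  induction l with
  | nil => simp [pairSum]
  | cons x l ih =>
    cases l with
    | nil => simp [pairSum]
    | cons y l =>
      have h1 := h [] x y l rfl
      have h2 := ih fun l₁ p q l₂ e => h (x :: l₁) p q l₂ (by rw [e]; rfl)
      simp only [pairSum, List.length_cons] at h2 ⊢
      omega

/-- Shifts `f` by one place against `g`. A pair with `g p + f q = 2` will correspond to two crossing
edges, which the constructions below exclude. -/
theorem ListPath.sum_eq {G : SimpleGraph V} {u v : V} {l : List V} (h : G.ListPath u v l) :
    (l.map f).sum + (l.map g).sum = f u + pairSum g f l + g v := by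
  induction l generalizing u with
  | nil => exact absurd rfl h.ne_nil
  | cons x l ih =>
    obtain rfl := h.of_cons
    cases l with
    | nil =>
      obtain rfl : v = u := h.of_concat (l := [])
      simp [pairSum]
    | cons y l =>
      have := ih h.uncons.2
      simp only [List.map_cons, List.sum_cons, pairSum] at this ⊢
      omega

variable [Fintype V] {S : Set V}

open Classical in
theorem IsListing.sum_eq {C : List V} (h : IsListing S C) (f : V → ℕ) :
    ∑ v, f v = (C.map f).sum + ∑ v with v ∉ S, f v := by
  rw [← Finset.sum_filter_add_sum_filter_not Finset.univ (· ∈ S), ← List.sum_toFinset _ h.1]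
  congr 1
  refine Finset.sum_congr ?_ fun _ _ => rfl
  ext v
  simp [h.2]

open Classical in
theorem IsListing.card_eq {C : List V} (h : IsListing S C) :
    Fintype.card V = C.length + (Finset.univ.filter fun v => v ∉ S).card := by
  have := h.sum_eq fun _ => 1
  simpa using this

open Classical in
-- The vertices of `P` outside S contribute nothing, so each of them saves one unit.
theorem sum_outside_le {h : V → ℕ} (hle : ∀ w ∉ S, h w ≤ 1) {P : List V} (hP : P.Nodup)
    (h0 : ∀ w ∈ P, w ∉ S → h w = 0) :
    ∑ v with v ∉ S, h v + (P.map fun p => if p ∈ S then 0 else 1).sum ≤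
      (Finset.univ.filter fun v => v ∉ S).card := by
  have h1 : (P.map fun p => if p ∈ S then 0 else 1).sum =
      ∑ v with v ∉ S, if v ∈ P then 1 else 0 := by
    rw [← List.sum_toFinset _ hP]
    simp only [Finset.sum_ite, Finset.sum_const_zero, zero_add, add_zero]
    refine Finset.sum_congr ?_ fun _ _ => rfl
    ext v
    simp
    tauto
  rw [h1, ← Finset.sum_add_distrib, Finset.card_eq_sum_ones]
  refine Finset.sum_le_sum fun v hv => ?_
  rw [Finset.mem_filter] at hv
  split_ifs with hvP
  · rw [h0 v hvP hv.2]
  · have := hle v hv.2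
    omega

open Classical in
theorem edgeDegree_eq_sum (G : SimpleGraph V) (x u : V) :
    G.edgeDegree s(x, u) = ∑ v, if Hits G x u v then 1 else 0 := by
  rw [Finset.sum_boole, Nat.cast_id, edgeDegree, ← Set.ncard_coe_finset]
  congr 1
  ext v
  rw [Finset.mem_coe, Finset.mem_filter]
  simp [Hits, and_assoc]

end PairSum

/-! ### Odd dominating cycles with a chord -/

section Config

variable {V : Type*} {G : SimpleGraph V} {S : Set V} {a b c : V} {A D W Z : List V}

/-- An odd dominating cycle `a, W, c, Z` with a chord `ac`, where `W` is odd. -/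
structure IsOddConfig (G : SimpleGraph V) (a c : V) (W Z : List V) : Prop where
  arc : G.ListPath a c (a :: (W ++ [c]))
  back : G.ListPath c a (c :: (Z ++ [a]))
  chord : G.Adj a c
  odd : W.length % 2 = 1
  even : Z.length % 2 = 0
  nodup : (a :: (W ++ c :: Z)).Nodup
  dom : G.Dominates (a :: (W ++ c :: Z))

theorem Swap.isOddConfig {I R C : List V} (hs : Swap G S I R)
    (hdom : ∀ u v, u ∉ S → v ∉ S → ¬ G.Adj u v) (hC : IsListing S C)
    (arc : G.ListPath a c (a :: (W ++ [c]))) (back : G.ListPath c a (c :: (Z ++ [a])))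
    (chord : G.Adj a c) (odd : W.length % 2 = 1) (even : Z.length % 2 = 0)
    (hp : (R ++ (a :: (W ++ c :: Z))).Perm (I ++ C)) : IsOddConfig G a c W Z :=
  ⟨arc, back, chord, odd, even, (hs.nodup_dominates hdom hC hp).1,
    (hs.nodup_dominates hdom hC hp).2⟩

theorem ListPath.exists_tail {u x y : V} {l : List V} (h : G.ListPath u x (u :: (l ++ [y]))) :
    ∃ v, G.Adj u v ∧ G.ListPath v x (l ++ [y]) := by
  obtain ⟨x', v, h1, h2, h3⟩ := ListPath.split_append (l₁ := [u]) (l₂ := l ++ [y])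
    (by simpa using h) (by simp) (by simp)
  rw [h1.of_concat (l := [])] at h2
  exact ⟨v, h2, h3⟩

theorem ListPath.exists_init {u x y : V} {l : List V} (h : G.ListPath u x (y :: l ++ [x])) :
    ∃ v, G.Adj v x ∧ G.ListPath u v (y :: l) := by
  obtain ⟨v, x', h1, h2, h3⟩ := ListPath.split_append (l₁ := y :: l) (l₂ := [x])
    h (by simp) (by simp)
  rw [h3.of_cons] at h2
  exact ⟨v, h2, h1⟩

theorem IsPrefix.count {x y u : V} {ℓ : ℕ} {E I R : List V} (h : IsPrefix G S x y ℓ u E I R)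
    [DecidableEq V] (w : V) : R.count w + E.count w = I.count w + [x].count w := by
  simpa using h.perm.count_eq w

namespace IsTri

variable {d d' z z' ud uz : V} {D' Z' : List V} {ℓ ℓ' : ℕ} {u u' : V} {E I R E' I' R' : List V}
  {p q : V} {k₁ k₂ : List V}

section Cross

variable (hS : Spineless G S) (h : IsTri G S a b c A (d :: d' :: D') (z :: z' :: Z'))
  (hP : IsPrefix G S d d' ℓ u E I R) (hP' : IsPrefix G S z z' ℓ' u' E' I' R')
  (hsw : Swap G S (I ++ I') (R ++ R')) (hp : G.Adj p u') (hq : G.Adj q u)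
include hS h hP hP' hsw hp hq

/-- Crossing edges with different labels give an even cycle. -/
theorem no_cross_of_odd (hl : (ℓ + ℓ') % 2 = 1)
    (e : (d' :: (D' ++ [c])) ++ b :: (A.reverse ++ a :: (Z'.reverse ++ [z'])) =
      k₁ ++ p :: q :: k₂) : False := by
  have h1 := (ListPath.split (l₁ := [b]) (by simpa using h.pathD)).2.2
  have h2 := h.pathA.reverse
  have h3 := (ListPath.split (l₁ := [c]) (by simpa using h.pathZ)).2.2.reverse
  have h4 : G.ListPath d' z' (k₁ ++ p :: q :: k₂) := by
    rw [← e]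
    have h6 : G.ListPath b z' (b :: (A.reverse ++ a :: (Z'.reverse ++ [z']))) := by
      have := ListPath.join (l := b :: A.reverse) (k := Z'.reverse ++ [z']) (by simpa using h2)
        (by simpa using h3)
      simpa using this
    have := h1.append h.bc.symm h6
    simpa using this
  have h5 := hP.path _ _ h4.split.1
  have h6 := hP'.path _ _ (by simpa using h4.split.2.2.reverse)
  have h7 := h5.append hp h6
  refine hS.no_even hsw h.listing h7 hq ?_ ?_
  · have e1 := congrArg List.length e
    have e2 := h.evenA
    have e3 := h.evenD
    have e4 := h.evenZ
    have e5 := hP.parity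
    have e6 := hP'.parity
    simp only [List.length_append, List.length_cons, List.length_nil, List.length_reverse]
      at e1 e2 e3 e4 e5 e6 ⊢
    omega
  · classical
    refine List.perm_iff_count.2 fun w => ?_
    have e1 := congrArg (List.count w) e
    have e2 := hP.count w
    have e3 := hP'.count w
    simp only [List.count_append, List.count_cons, List.count_reverse, List.count_nil]
      at e1 e2 e3 ⊢
    linarith

/-- The crossing edges reorder the vertices into c, ..., q, u, ..., p, u', ..., a. With equal labels
this closes by `ca` to an even cycle, which shares `a` with the even cycle a, A, b. -/
theorem no_cross_left (hl : (ℓ + ℓ') % 2 = 0)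
    (e : d' :: (D' ++ [c]) = k₁ ++ p :: q :: k₂) : False := by
  obtain ⟨x, hax, hx⟩ := h.pathA.exists_tail
  have h1 := (ListPath.split (l₁ := [b]) (by simpa using h.pathD)).2.2
  have h3 := (ListPath.split (l₁ := [c]) (by simpa using h.pathZ)).2.2
  have h1' : G.ListPath d' c (k₁ ++ p :: q :: k₂) := e ▸ (by simpa using h1)
  have h4 := hP.path _ _ h1'.split.1
  have h5 := hP'.path _ _ h3
  have h6 := (h1'.split.2.2.reverse.append hq h4).append hp h5
  obtain ⟨v, y, h7, hva, h8⟩ := ListPath.split_append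
    (l₁ := (q :: k₂).reverse ++ (E ++ (k₁ ++ [p])) ++ (E' ++ (z' :: Z'))) (l₂ := [a])
    (by simpa using h6) (by simp) (by simp)
  rw [h8.of_cons] at hva
  refine hS.no_double hsw h.listing hx hax h.ab.symm h7 h.ca.symm hva ?_ ?_ ?_
  · have e2 := h.evenA
    simp only [List.length_append, List.length_cons, List.length_nil]
    omega
  · have e1 := congrArg List.length e
    have e3 := h.evenD
    have e4 := h.evenZ
    have e5 := hP.parity
    have e6 := hP'.parity
    simp only [List.length_append, List.length_cons, List.length_nil, List.length_reverse]
      at e1 e3 e4 e5 e6 ⊢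
    omega
  · classical
    refine List.perm_iff_count.2 fun w => ?_
    have e1 := congrArg (List.count w) e
    have e2 := hP.count w
    have e3 := hP'.count w
    simp only [List.count_append, List.count_cons, List.count_reverse, List.count_nil]
      at e1 e2 e3 ⊢
    linarith

theorem no_cross_right (hl : (ℓ + ℓ') % 2 = 0)
    (e : a :: (Z'.reverse ++ [z']) = k₁ ++ p :: q :: k₂) : False := by
  obtain ⟨x, hax, hx⟩ := h.pathA.exists_tail
  have h1 := hP.path _ _ (ListPath.split (l₁ := [b]) (by simpa using h.pathD)).2.2
  have h3 := (ListPath.split (l₁ := [c]) (by simpa using h.pathZ)).2.2.reverse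
  have h3' : G.ListPath a z' (k₁ ++ p :: q :: k₂) := e ▸ (by simpa using h3)
  have h4 := hP'.path _ _ (by simpa using h3'.split.2.2.reverse)
  have h5 := h3'.split.1.reverse
  have h6 := (h1.reverse.append hq.symm h4.reverse).append hp.symm h5
  obtain ⟨k₃, hk₃⟩ : ∃ k₃, k₁ ++ [p] = a :: k₃ := by
    cases k₁ with
    | nil => exact ⟨[], by simp at e; simp [e.1]⟩
    | cons y k => exact ⟨k ++ [p], by simp at e; simp [e.1]⟩
  have e' : a :: (Z'.reverse ++ [z']) = a :: (k₃ ++ q :: k₂) := by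
    rw [e, ← List.cons_append, ← hk₃]; simp
  rw [hk₃] at h6
  obtain ⟨v, y, h7, hva, h8⟩ := ListPath.split_append
    (l₁ := (E ++ (d' :: (D' ++ [c]))).reverse ++ (E' ++ (q :: k₂).reverse).reverse ++ k₃.reverse)
    (l₂ := [a]) (by simpa using h6) (by simp) (by simp)
  rw [h8.of_cons] at hva
  refine hS.no_double hsw h.listing hx hax h.ab.symm h7 h.ca.symm hva ?_ ?_ ?_
  · have e2 := h.evenA
    simp only [List.length_append, List.length_cons, List.length_nil]
    omega
  · have e1 := congrArg List.length e'
    have e3 := h.evenD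
    have e4 := h.evenZ
    have e5 := hP.parity
    have e6 := hP'.parity
    simp only [List.length_append, List.length_cons, List.length_nil, List.length_reverse]
      at e1 e3 e4 e5 e6 ⊢
    omega
  · classical
    refine List.perm_iff_count.2 fun w => ?_
    have e1 := congrArg (List.count w) e'
    have e2 := hP.count w
    have e3 := hP'.count w
    simp only [List.count_append, List.count_cons, List.count_reverse, List.count_nil]
      at e1 e2 e3 ⊢
    linarith

/-- Crossing edges at the path `A` give a shorter odd configuration, up to one exception. -/
theorem eq_nil_of_cross_mid (hl : (ℓ + ℓ') % 2 = 0)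
    (hmin : ∀ W' Z', IsOddConfig G a c W' Z' → A.length + 1 + (d :: d' :: D').length ≤ W'.length)
    (e : a :: (A ++ [b]) = k₁ ++ q :: p :: k₂) : k₂ = [] ∧ E.length = 2 := by
  have h1 := hP.path _ _ (ListPath.split (l₁ := [b]) (by simpa using h.pathD)).2.2
  have h3 := hP'.path _ _ (ListPath.split (l₁ := [c]) (by simpa using h.pathZ)).2.2
  have h2 : G.ListPath a b (k₁ ++ q :: p :: k₂) := e ▸ h.pathA
  have h4 := h2.split.1.append hq h1
  have h5 := h2.split.2.2.reverse.append hp h3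
  obtain ⟨k₃, hk₃⟩ : ∃ k₃, k₁ ++ [q] = a :: k₃ := by
    cases k₁ with
    | nil => exact ⟨[], by simp at e; simp [e.1]⟩
    | cons y k => exact ⟨k ++ [q], by simp at e; simp [e.1]⟩
  have e' : a :: (A ++ [b]) = a :: (k₃ ++ p :: k₂) := by
    rw [e, ← List.cons_append, ← hk₃]; simp
  rw [hk₃] at h4
  have e1 := congrArg List.length e'
  have e3 := h.evenD
  have e4 := h.evenZ
  have e5 := hP.parity
  have e6 := hP'.parity
  have e7 := h.evenA
  have e8 := hP.length
  simp only [List.length_append, List.length_cons, List.length_nil] at e1 e3 e4 e5 e6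
  have hcnt : ∀ w : V, ∀ [DecidableEq V],
      (R ++ R').count w + (E ++ E').count w = (I ++ I').count w + [d].count w + [z].count w := by
    intro w _
    have e2 := hP.count w
    have e3 := hP'.count w
    simp only [List.count_append]
    linarith
  have hcnt' : ∀ w : V, ∀ [DecidableEq V], (a :: (A ++ [b])).count w =
      (a :: (k₃ ++ p :: k₂)).count w := by
    intro w _
    rw [e']
  -- The path from `a` over `q`, `u` and `D` to `c` and the path from `b` back over `p`, `u'` and
  -- `Z` to `a` form a cycle with the edge `bc` and chord `ac`. In one parity it is an odd
  -- configuration, and minimality gives `k₂.length + 2 ≤ E.length ≤ 2`. In the other parity, the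
  -- edges `ca` and `ab` close the two paths to even cycles sharing `a`.
  rcases Nat.mod_two_eq_zero_or_one (k₃.length + E.length) with hpar | hpar
  · have hc := hsw.isOddConfig (a := a) (c := c) (W := k₃ ++ (E ++ (d' :: D')))
      (Z := (p :: k₂).reverse ++ (E' ++ z' :: Z')) hS.dom h.listing (by simpa using h4)
      (by simpa using ListPath.cons h.bc.symm h5) h.ca.symm ?_ ?_ ?_
    · have := hmin _ _ hc
      simp only [List.length_append, List.length_cons] at this
      refine ⟨List.eq_nil_of_length_eq_zero (by omega), by omega⟩
    · simp only [List.length_append, List.length_cons]; omega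
    · simp only [List.length_append, List.length_cons, List.length_reverse]; omega
    · classical
      refine List.perm_iff_count.2 fun w => ?_
      have e1 := hcnt w
      have e2 := hcnt' w
      simp only [List.count_append, List.count_cons, List.count_reverse, List.count_nil]
        at e1 e2 ⊢
      linarith
  · obtain ⟨s, has, hs⟩ := ListPath.exists_tail (u := a) (x := c) (y := c)
      (l := k₃ ++ (E ++ (d' :: D'))) (by simpa using h4)
    obtain ⟨v, y, h7, hva, h8⟩ := ListPath.split_append
      (l₁ := (p :: k₂).reverse ++ (E' ++ z' :: Z')) (l₂ := [a]) (by simpa using h5) (by simp)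
      (by simp)
    rw [h8.of_cons] at hva
    refine (hS.no_double hsw h.listing hs has h.ca h7 h.ab hva ?_ ?_ ?_).elim
    · simp only [List.length_append, List.length_cons, List.length_nil]; omega
    · simp only [List.length_append, List.length_cons, List.length_reverse]; omega
    · classical
      refine List.perm_iff_count.2 fun w => ?_
      have e1 := hcnt w
      have e2 := hcnt' w
      simp only [List.count_append, List.count_cons, List.count_reverse, List.count_nil]
        at e1 e2 ⊢
      linarith

end Cross

/-- The exceptional crossing at `b` excludes a further edge to `a`. -/
theorem no_cross_exception (hS : Spineless G S)
    (h : IsTri G S a b c A (d :: d' :: D') (z :: z' :: Z'))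
    (hP' : IsPrefix G S z z' ℓ' u' E' I' R') (hl' : ℓ' % 2 = 1) (hu : u ∉ S) (huI : u ∉ I')
    (hp : G.Adj b u') (hq : G.Adj q u) (hA : a :: A = k₁ ++ [q]) (ha : G.Adj a u) : False := by
  have h3 := hP'.path _ _ (ListPath.split (l₁ := [c]) (by simpa using h.pathZ)).2.2
  obtain ⟨v, hva, hv⟩ : ∃ v, G.Adj v a ∧ G.ListPath u' v (E' ++ z' :: Z') := by
    obtain ⟨v, y, h7, hva, h8⟩ := ListPath.split_append
      (l₁ := E' ++ z' :: Z') (l₂ := [a]) (by simpa using h3) (by simp) (by simp)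
    rw [h8.of_cons] at hva
    exact ⟨v, hva, h7⟩
  have h1 := hv.reverse.append hp.symm h.pathD
  have h2 : G.ListPath a q (a :: A) := by
    have h2 := h.pathA
    rw [← List.cons_append, hA] at h2
    rw [hA]
    exact (ListPath.split (l₁ := k₁) (x := q) (y := b) (l₂ := []) (by simpa using h2)).1
  have hne := h.ne_nil hS
  obtain ⟨s, has, hs⟩ := ListPath.exists_tail (y := u) (h2.concat hq)
  -- The two even cycles through `a` are a, A, u and a, c, D, b, u' followed by `Z`.
  refine hS.no_double (hP'.swap.insert hu huI) h.listing hs has ha.symm h1 hva.symm h.ca ?_ ?_ ?_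
  · have := h.evenA
    simp only [List.length_append, List.length_cons, List.length_nil]; omega
  · have e3 := h.evenD
    have e4 := h.evenZ
    have e6 := hP'.parity
    simp only [List.length_append, List.length_cons, List.length_nil, List.length_reverse]
      at e3 e4 e6 ⊢
    omega
  · classical
    refine List.perm_iff_count.2 fun w => ?_
    have e2 := hP'.count w
    simp only [List.count_append, List.count_cons, List.count_reverse, List.count_nil] at e2 ⊢
    linarith

/-- `a` is not adjacent to the successor of `b`. -/
theorem not_adj_succ (hS : Spineless G S) (h : IsTri G S a b c A (d :: D') Z) :
    ¬ G.Adj a d := by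
  intro ha
  obtain ⟨x, hax, hx⟩ := h.pathA.exists_tail
  obtain ⟨z, hz, hzp⟩ := h.pathZ.exists_init (x := a) (y := c) (l := Z)
  have h1 := (ListPath.uncons (x := b) (y := d) (l := D' ++ [c]) (by simpa using h.pathD)).2
  have h2 := ListPath.join (l := d :: D') (by simpa using h1) hzp
  refine hS.no_double Swap.nil h.listing hx hax h.ab.symm h2 ha hz ?_ ?_ ?_
  · have := h.evenA
    simp only [List.length_append, List.length_cons, List.length_nil]; omega
  · have e3 := h.evenD
    have e4 := h.evenZ
    simp only [List.length_append, List.length_cons] at e3 ⊢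
    omega
  · classical
    refine List.perm_iff_count.2 fun w => ?_
    simp only [List.count_append, List.count_cons, List.count_nil]
    ring

end IsTri

end Config

/-! ### Degree sum of the ends after two corners of the triangle -/

section Degree

variable {V : Type*} {G : SimpleGraph V} {S : Set V} {a b c d d' z z' ud uz : V}
  {A D Z D' Z' : List V} {p q : V} {k₁ k₂ : List V}

theorem Remote.not_hits {x u y v : V} (h : G.Remote s(x, u) s(y, v)) :
    ¬ Hits G x u y ∧ ¬ Hits G x u v := by
  have hx := fun w hw => (h x (by simp) w hw).2
  have hu := fun w hw => (h u (by simp) w hw).2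
  exact ⟨fun hh => hh.2.2.elim (hx _ (by simp)) (hu _ (by simp)),
    fun hh => hh.2.2.elim (hx _ (by simp)) (hu _ (by simp))⟩

theorem not_hits_left {x u : V} : ¬ Hits G x u x := fun h => h.1 rfl

theorem not_hits_right {x u : V} : ¬ Hits G x u u := fun h => h.2.1 rfl

namespace IsTri

section Hits

variable (hS : Spineless G S) (h : IsTri G S a b c A (d :: d' :: D') (z :: z' :: Z'))
  (hd : IsEnd G S d d' ud) (hz : IsEnd G S z z' uz)
  (hp : Hits G z uz p) (hq : Hits G d ud q)
include hS h hd hz hp hq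

theorem no_hits_left (e : d' :: (D' ++ [c]) = k₁ ++ p :: q :: k₂) : False := by
  obtain ⟨ℓ, u, E, I, R, hP, -, hI, hu⟩ := hd.exists_of_hits h.adj_ends.2 hq
  obtain ⟨ℓ', u', E', I', R', hP', -, hI', hu'⟩ := hz.exists_of_hits h.rotate.adj_ends.2 hp
  have hsw := h.swap_ends hS hd hz hP hP' hI hI'
  rcases Nat.mod_two_eq_zero_or_one (ℓ + ℓ') with hl | hl
  · exact h.no_cross_left hS hP hP' hsw hu'.symm hu.symm hl e
  · refine h.no_cross_of_odd hS hP hP' hsw hu'.symm hu.symm hl (k₁ := k₁)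
      (k₂ := k₂ ++ b :: (A.reverse ++ a :: (Z'.reverse ++ [z']))) ?_
    rw [e]
    simp

theorem no_hits_right (e : a :: (Z'.reverse ++ [z']) = k₁ ++ p :: q :: k₂) : False := by
  obtain ⟨ℓ, u, E, I, R, hP, -, hI, hu⟩ := hd.exists_of_hits h.adj_ends.2 hq
  obtain ⟨ℓ', u', E', I', R', hP', -, hI', hu'⟩ := hz.exists_of_hits h.rotate.adj_ends.2 hp
  have hsw := h.swap_ends hS hd hz hP hP' hI hI'
  rcases Nat.mod_two_eq_zero_or_one (ℓ + ℓ') with hl | hl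
  · exact h.no_cross_right hS hP hP' hsw hu'.symm hu.symm hl e
  · refine h.no_cross_of_odd hS hP hP' hsw hu'.symm hu.symm hl
      (k₁ := d' :: (D' ++ [c]) ++ b :: (A.reverse ++ k₁)) (k₂ := k₂) ?_
    rw [e]
    simp

/-- A crossing on the path `A` can survive only at `b`, and then `a` is not hit. This loss makes up
for the exceptional pair in the degree count. -/
theorem eq_nil_of_hits_mid
    (hmin : ∀ W' Z', IsOddConfig G a c W' Z' → A.length + 1 + (d :: d' :: D').length ≤ W'.length)
    (e : a :: (A ++ [b]) = k₁ ++ q :: p :: k₂) : k₂ = [] ∧ ¬ Hits G d ud a := by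
  obtain ⟨ℓ, u, E, I, R, hP, hud, hI, hu⟩ := hd.exists_of_hits h.adj_ends.2 hq
  obtain ⟨ℓ', u', E', I', R', hP', -, hI', hu'⟩ := hz.exists_of_hits h.rotate.adj_ends.2 hp
  have hsw := h.swap_ends hS hd hz hP hP' hI hI'
  rcases Nat.mod_two_eq_zero_or_one (ℓ + ℓ') with hl | hl
  · obtain ⟨rfl, hE⟩ := h.eq_nil_of_cross_mid hS hP hP' hsw hu'.symm hu.symm hl hmin e
    refine ⟨rfl, fun ha => ?_⟩
    have e' : (a :: A) ++ [b] = (k₁ ++ [q]) ++ [p] := by simpa using e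
    obtain ⟨e1, e2⟩ := List.append_inj' e' rfl
    obtain rfl : b = p := by simpa using e2
    have huS := hP.two hE
    obtain rfl : u = ud := hud.resolve_left (by
      rintro rfl
      exact huS ((h.listing.2 _).2 (by simp)))
    rcases ha.2.2 with h1 | h1
    · exact h.not_adj_succ hS h1.symm
    · have := hP.parity
      exact h.no_cross_exception hS hP' (by omega) huS
        (fun hi => h.end_ne_end hS hd hz (hI' _ hi)) hu'.symm hu.symm e1 h1.symm
  · refine (h.no_cross_of_odd hS hP hP' hsw hu'.symm hu.symm hl
      (k₁ := d' :: (D' ++ [c]) ++ k₂.reverse)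
      (k₂ := k₁.reverse ++ (Z'.reverse ++ [z'])) ?_).elim
    have := congrArg List.reverse e
    simp only [List.reverse_cons, List.reverse_append, List.reverse_nil, List.nil_append,
      List.append_assoc, List.cons_append] at this
    have h2 := congrArg (fun l => d' :: (D' ++ [c]) ++ (l ++ (Z'.reverse ++ [z']))) this
    simpa using h2

end Hits

open Classical in
/-- The ends after `b` and `c` have few neighbours, given the end after `a`. -/
theorem edgeDegree_add_le [Fintype V] {x x' ux : V} {A' : List V} (hS : Spineless G S)
    (h : IsTri G S a b c (x :: x' :: A') (d :: d' :: D') (z :: z' :: Z'))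
    (hx : IsEnd G S x x' ux) (hd : IsEnd G S d d' ud) (hz : IsEnd G S z z' uz)
    (hmin : ∀ W' Z', IsOddConfig G a c W' Z' →
      (x :: x' :: A').length + 1 + (d :: d' :: D').length ≤ W'.length) :
    G.edgeDegree s(d, ud) + G.edgeDegree s(z, uz) + 3 ≤ Fintype.card V := by
  have rdz := h.remote_ends hS hd hz
  have rzx := h.rotate.remote_ends hS hz hx
  have rxd := h.rotate.rotate.remote_ends hS hx hd
  rw [edgeDegree_eq_sum, edgeDegree_eq_sum]
  set f : V → ℕ := fun v => if Hits G d ud v then 1 else 0 with hf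
  set g : V → ℕ := fun v => if Hits G z uz v then 1 else 0 with hg
  have f1 : ∀ v, f v ≤ 1 := fun v => by simp only [hf]; split_ifs <;> omega
  have g1 : ∀ v, g v ≤ 1 := fun v => by simp only [hg]; split_ifs <;> omega
  have f0 : ∀ v, ¬ Hits G d ud v → f v = 0 := fun v hv => if_neg hv
  have g0 : ∀ v, ¬ Hits G z uz v → g v = 0 := fun v hv => if_neg hv
  have pair : ∀ p q, ¬ (Hits G z uz p ∧ Hits G d ud q) → g p + f q ≤ 1 := by
    intro p q hpq
    simp only [hf, hg]
    split_ifs <;> simp_all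
  have fd := f0 d not_hits_left
  have fud := f0 ud not_hits_right
  have fz := f0 z rdz.not_hits.1
  have fuz := f0 uz rdz.not_hits.2
  have fx := f0 x rxd.symm.not_hits.1
  have fux := f0 ux rxd.symm.not_hits.2
  have gz := g0 z not_hits_left
  have guz := g0 uz not_hits_right
  have gd := g0 d rdz.symm.not_hits.1
  have gud := g0 ud rdz.symm.not_hits.2
  have gx := g0 x rzx.not_hits.1
  have gux := g0 ux rzx.not_hits.2
  -- The edge `cb` turns the cycle into a path from `d` to `z` through S; along it the two degrees
  -- are compared pair by pair.
  set C := (d :: d' :: (D' ++ [c])) ++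
    b :: ((x :: x' :: A').reverse ++ a :: (z :: z' :: Z').reverse) with hC
  have hlist : IsListing S C := h.listing.perm <| by
    refine List.perm_iff_count.2 fun w => ?_
    simp only [hC, List.count_append, List.count_cons, List.count_reverse, List.count_nil]
    ring
  have hpath : G.ListPath d z C := by
    have h1 := (ListPath.split (l₁ := []) (x := b) (by simpa using h.pathD)).2.2
    have h2 := h.pathA.reverse
    have h3 := (ListPath.split (l₁ := []) (x := c) (by simpa using h.pathZ)).2.2.reverse
    have h4 := ListPath.join (l := b :: (x :: x' :: A').reverse) (k := (z :: z' :: Z').reverse)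
      (by simpa using h2) (by simpa using h3)
    simpa [hC] using h1.append h.bc.symm h4
  have hsum := hpath.sum_eq (f := f) (g := g)
  have hsplit : pairSum g f C = g d + f d' + pairSum g f (d' :: (D' ++ [c])) + (g c + f b) +
      pairSum g f (b :: (A'.reverse ++ [x'])) + (g x' + f x) + (g x + f a) +
      pairSum g f (a :: (Z'.reverse ++ [z'])) + (g z' + f z) := by
    have e1 : C = d :: d' :: (D' ++ c :: b :: (A'.reverse ++ x' :: x :: a ::
      (Z'.reverse ++ z' :: [z]))) := by simp [hC]
    have e2 : ∀ v, pairSum g f [v] = 0 := fun v => by simp [pairSum]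
    rw [e1, pairSum_cons_cons d, pairSum_cons_append d', pairSum_cons_cons c,
      pairSum_cons_append b, pairSum_cons_cons x', pairSum_cons_cons x, pairSum_cons_append a,
      pairSum_cons_cons z', e2]
    ring
  have b1 : pairSum g f (d' :: (D' ++ [c])) ≤ _ := pairSum_le fun k₁ p q k₂ e =>
    pair p q fun hpq => h.no_hits_left hS hd hz hpq.1 hpq.2 e
  have b3 : pairSum g f (a :: (Z'.reverse ++ [z'])) ≤ _ := pairSum_le fun k₁ p q k₂ e =>
    pair p q fun hpq => h.no_hits_right hS hd hz hpq.1 hpq.2 e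
  -- Only the pair at `b` can contribute 2, and in that case `f a = 0`.
  have b2 : pairSum g f (b :: (A'.reverse ++ [x'])) + f a ≤ A'.length + 1 + 1 := by
    obtain ⟨y, B, hB⟩ : ∃ y B, A'.reverse ++ [x'] = y :: B :=
      List.exists_cons_of_ne_nil (by simp)
    have hBl : A'.length = B.length := by simpa using congrArg List.length hB
    have hA : a :: ((x :: x' :: A') ++ [b]) = a :: x :: (B.reverse ++ [y, b]) := by
      have := congrArg List.reverse hB
      simp only [List.reverse_append, List.reverse_cons, List.reverse_nil, List.nil_append,
        List.reverse_reverse, List.cons_append] at this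
      rw [List.cons_append, List.cons_append, ← List.cons_append (a := x'), this]
      simp
    have hr : pairSum g f (y :: B) ≤ B.length := by
      refine pairSum_le fun k₁ p q k₂ e => pair p q fun hpq => ?_
      have e' := congrArg List.reverse e
      simp only [List.reverse_append, List.reverse_cons, List.append_assoc, List.cons_append,
        List.nil_append] at e'
      have := (h.eq_nil_of_hits_mid hS hd hz hpq.1 hpq.2 hmin (k₁ := a :: x :: k₂.reverse)
        (k₂ := k₁.reverse ++ [b]) (by
          rw [hA, show B.reverse ++ [y, b] = (B.reverse ++ [y]) ++ [b] by simp, e']; simp)).1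
      simp at this
    rw [hB, pairSum]
    by_cases hh : Hits G z uz b ∧ Hits G d ud y
    · have := (h.eq_nil_of_hits_mid hS hd hz hh.1 hh.2 hmin (k₁ := a :: x :: B.reverse)
        (k₂ := []) (by rw [hA]; simp)).2
      have := f0 a this
      have := g1 b
      have := f1 y
      omega
    · have := pair b y hh
      have := f1 a
      omega
  have hout := sum_outside_le (S := S) (h := fun v => f v + g v) (P := [ud, uz, ux]) ?_ ?_ ?_
  rotate_left
  · intro w hw
    rw [add_comm]
    exact pair w w fun hpq => h.not_hits_of_notMem hS hd hz hw hpq.2 hpq.1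
  · have h1 := (rdz ud (by simp) uz (by simp)).1
    have h2 := (rxd ux (by simp) ud (by simp)).1.symm
    have h3 := (rzx uz (by simp) ux (by simp)).1
    simp [h1, h2, h3]
  · intro w hw _
    simp only [List.mem_cons, List.not_mem_nil, or_false] at hw
    show f w + g w = 0
    rcases hw with rfl | rfl | rfl <;> omega
  -- Each of the three end edges saves one unit. If its second vertex is in S, that vertex is the
  -- next one on the cycle and the corresponding term vanishes; if not, it is one of the vertices
  -- counted in `hout`.
  have sd : g d + f d' + (if ud ∈ S then 1 else 0) ≤ 1 := by
    have := f1 d'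
    split_ifs with hu
    · have h1 := hd.2.resolve_left (fun h' => h' hu)
      rw [← h1.1]
      omega
    · omega
  have sz : g z' + f z + (if uz ∈ S then 1 else 0) ≤ 1 := by
    have := g1 z'
    split_ifs with hu
    · have h1 := hz.2.resolve_left (fun h' => h' hu)
      rw [← h1.1]
      omega
    · omega
  have sx : g x' + f x + (if ux ∈ S then 1 else 0) ≤ 1 := by
    have := g1 x'
    split_ifs with hu
    · have h1 := hx.2.resolve_left (fun h' => h' hu)
      rw [← h1.1]
      omega
    · omega
  have hind : ∀ u : V, (if u ∈ S then 0 else 1) + (if u ∈ S then 1 else 0) = 1 := by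
    intro u; split_ifs <;> rfl
  have i1 := hind ud
  have i2 := hind uz
  have i3 := hind ux
  have gc := g1 c
  have fb := f1 b
  rw [hlist.sum_eq f, hlist.sum_eq g, hlist.card_eq]
  rw [Finset.sum_add_distrib] at hout
  have hlen : C.length = D'.length + A'.length + Z'.length + 9 := by
    simp [hC]; omega
  simp only [List.map_cons, List.map_nil, List.sum_cons, List.sum_nil, List.length_cons,
    List.length_append, List.length_reverse, List.length_nil] at hout b1 b3
  omega

end IsTri

end Degree

/-! ### Minimal odd configurations and common neighbours of `a` and `c` -/

section Extremal

variable {V : Type*} {G : SimpleGraph V} {S : Set V} {a c : V} {W Z : List V}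

/-- An odd configuration with `W` as short as possible and then `Z` as long as possible. -/
structure IsMinConfig (G : SimpleGraph V) (S : Set V) (a c : V) (W Z : List V) : Prop where
  config : IsOddConfig G a c W Z
  listing : IsListing S (a :: (W ++ c :: Z))
  spineless : Spineless G S
  min : ∀ a' c' W' Z', IsOddConfig G a' c' W' Z' → W.length ≤ W'.length
  max : ∀ a' c' W' Z', IsOddConfig G a' c' W' Z' → W'.length = W.length → Z'.length ≤ Z.length

namespace IsMinConfig

theorem mirror (h : IsMinConfig G S a c W Z) : IsMinConfig G S c a W.reverse Z.reverse := by
  have hl : IsListing S (c :: (W.reverse ++ a :: Z.reverse)) := h.listing.perm <| by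
    classical
    refine List.perm_iff_count.2 fun z => ?_
    simp only [List.count_append, List.count_cons, List.count_reverse]
    ring
  refine ⟨⟨by simpa using h.config.arc.reverse, by simpa using h.config.back.reverse,
    h.config.chord.symm, by simpa using h.config.odd, by simpa using h.config.even, hl.1, ?_⟩,
    hl, h.spineless, by simpa using h.min, by simpa using h.max⟩
  intro u v hu hv
  rw [← hl.2] at hu hv
  exact h.spineless.dom u v hu hv

/-- The only chord of the arc `a, W, c` that joins vertices at even distance is `ac`. -/
theorem no_even_chord (h : IsMinConfig G S a c W Z) {l₁ l₂ l₃ : List V} {u v : V}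
    (e : a :: (W ++ [c]) = l₁ ++ u :: (l₂ ++ v :: l₃)) (hl : l₂.length % 2 = 1)
    (huv : G.Adj u v) : l₁ = [] ∧ l₃ = [] := by
  have h1 : G.ListPath a c (l₁ ++ u :: (l₂ ++ v :: l₃)) := e ▸ h.config.arc
  have h2 := h1.split_at
  rw [← List.cons_append] at h2
  have h3 := h2.2.split_at
  obtain ⟨l₁', h5⟩ : ∃ l₁', l₁ ++ [u] = a :: l₁' := by
    cases l₁ with
    | nil => exact ⟨[], by simp at e; simp [e.1]⟩
    | cons y k => exact ⟨k ++ [u], by simp at e; simp [e.1]⟩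
  have h4 := ListPath.join (l := c :: Z) (by simpa using h.config.back) (h5 ▸ h2.1)
  rw [← h5] at h4
  have h5' : ∃ l₃', v :: l₃ = l₃' ++ [c] := by
    rcases List.eq_nil_or_concat l₃ with rfl | ⟨k, w, rfl⟩
    · have := congrArg List.getLast? e
      simp [List.getLast?_append, List.getLast?_cons] at this
      exact ⟨[], by simp [this]⟩
    · have := congrArg List.getLast? e
      simp [List.getLast?_append, List.getLast?_cons] at this
      exact ⟨v :: k, by simp [this]⟩
  obtain ⟨l₃', h5'⟩ := h5'
  have h6 : G.ListPath v u (l₃' ++ c :: (Z ++ (l₁ ++ [u]))) :=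
    ListPath.join (h5' ▸ h3.2) (by simpa using h4)
  have h7 : ListPath G v u (v :: (l₃ ++ Z ++ l₁ ++ [u])) := by
    have e2 : l₃' ++ c :: (Z ++ (l₁ ++ [u])) = v :: (l₃ ++ Z ++ l₁ ++ [u]) := by
      have := congrArg (· ++ (Z ++ (l₁ ++ [u]))) h5'.symm
      simpa using this
    rwa [e2] at h6
  have e3 := congrArg List.length e
  have h8 := h.config.odd
  have h9 := h.config.even
  simp only [List.length_append, List.length_cons, List.length_nil] at e3
  -- The same cycle with chord `uv` is an odd configuration with short arc `l₂`, so minimality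
  -- leaves no room for `l₁` and `l₃`.
  have hc := (Swap.nil (G := G) (S := S)).isOddConfig (W := l₂) (Z := l₃ ++ Z ++ l₁)
    h.spineless.dom h.listing (by simpa using h3.1) h7 huv hl ?_ ?_
  · have := h.min _ _ _ _ hc
    exact ⟨List.eq_nil_of_length_eq_zero (by omega), List.eq_nil_of_length_eq_zero (by omega)⟩
  · simp only [List.length_append]; omega
  · classical
    refine List.perm_iff_count.2 fun z => ?_
    have e4 := congrArg (List.count z) e
    simp only [List.count_append, List.count_cons, List.nil_append, List.count_nil] at e4 ⊢
    linarith

/-- The colour is the parity of the position on the arc. An edge inside a colour class would be an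
even chord other than `ac`; the positions of `a` and `c` are both even because `W` is odd. -/
theorem exists_color (h : IsMinConfig G S a c W Z) : ∃ κ : V → Bool,
    (∀ u ∈ W, ∀ v ∈ W, G.Adj u v → κ u ≠ κ v) ∧ (∀ u ∈ W, G.Adj a u → κ u = true) ∧
      ∀ u ∈ W, G.Adj u c → κ u = true := by
  classical
  set B := a :: (W ++ [c]) with hB
  have hn : B.Nodup := (List.nodup_append (l₂ := Z).1 (by simpa [hB] using h.config.nodup)).1
  have hidx : ∀ l₁ x l₂, B = l₁ ++ x :: l₂ → B.idxOf x = l₁.length := by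
    intro l₁ x l₂ e
    rw [e] at hn ⊢
    rw [List.idxOf_append_of_notMem, List.idxOf_cons_self, Nat.add_zero]
    intro hx
    exact (List.nodup_append.1 hn).2.2 x hx x (by simp) rfl
  have key : ∀ u v, (∃ l₁ l₂ l₃, B = l₁ ++ u :: (l₂ ++ v :: l₃)) → G.Adj u v →
      (B.idxOf u) % 2 = (B.idxOf v) % 2 → u = a ∧ v = c := by
    rintro u v ⟨l₁, l₂, l₃, e⟩ huv hpar
    rw [hidx _ _ _ e, hidx (l₁ ++ u :: l₂) v l₃ (by rw [e]; simp)] at hpar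
    simp only [List.length_append, List.length_cons] at hpar
    obtain ⟨rfl, rfl⟩ := h.no_even_chord e (by omega) huv
    have e' : a :: W ++ [c] = (u :: l₂) ++ [v] := by simpa [hB] using e
    obtain ⟨e1, e2⟩ := List.append_inj' e' rfl
    simp at e1 e2
    exact ⟨e1.1.symm, e2.symm⟩
  have key' : ∀ u ∈ B, ∀ v ∈ B, G.Adj u v → (B.idxOf u) % 2 = (B.idxOf v) % 2 →
      u = a ∧ v = c ∨ v = a ∧ u = c := by
    intro u hu v hv huv hpar
    rcases exists_append_of_mem_of_ne hu hv huv.ne with hs | hs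
    · exact Or.inl (key u v hs huv hpar)
    · exact Or.inr (key v u hs huv.symm hpar.symm)
  have ha : B.idxOf a = 0 := hidx [] a (W ++ [c]) hB
  have hc : B.idxOf c = W.length + 1 := by
    rw [hidx (a :: W) c [] (by simp [hB])]; rfl
  have haW : ∀ u ∈ W, u ≠ a ∧ u ≠ c := by
    intro u hu
    have := hn
    rw [hB, List.nodup_cons, List.nodup_append] at this
    refine ⟨?_, ?_⟩ <;> rintro rfl
    · exact this.1 (by simp [hu])
    · exact this.2.2.2 u hu u (by simp) rfl
  have hWB : ∀ u ∈ W, u ∈ B := fun u hu => by simp [hB, hu]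
  have hodd := h.config.odd
  refine ⟨fun v => decide (B.idxOf v % 2 = 1), ?_, ?_, ?_⟩
  · intro u hu v hv huv he
    rw [decide_eq_decide] at he
    have := key' u (hWB u hu) v (hWB v hv) huv (by omega)
    have := haW u hu
    tauto
  · intro u hu huv
    rw [decide_eq_true_iff]
    by_contra hcon
    have := key' a (by simp [hB]) u (hWB u hu) huv (by omega)
    have := haW u hu
    tauto
  · intro u hu huv
    rw [decide_eq_true_iff]
    by_contra hcon
    have := key' u (hWB u hu) c (by simp [hB]) huv (by omega)
    have := haW u hu
    tauto

theorem notMem (h : IsMinConfig G S a c W Z) : a ∉ W ∧ c ∉ W := by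
  have := h.config.nodup
  simp only [List.nodup_cons, List.nodup_append, List.mem_append, not_or] at this
  exact ⟨this.1.1, fun hc => this.2.2.2 c hc c (by simp) rfl⟩

/-- The edge `at` must not be an even chord, so `A` is even; then `D` is even because `W` is odd. -/
theorem isTri (h : IsMinConfig G S a c W Z) {A D : List V} {t : V} (e : W = A ++ t :: D)
    (ha : G.Adj a t) (hc : G.Adj t c) : IsTri G S a t c A D Z := by
  subst e
  have hodd := h.config.odd
  have hp : G.ListPath a c ((a :: A) ++ t :: (D ++ [c])) := by simpa using h.config.arc
  have hA : A.length % 2 = 0 := by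
    by_contra hcon
    have := (h.no_even_chord (l₁ := []) (u := a) (l₂ := A) (v := t) (l₃ := D ++ [c]) (by simp)
      (by omega) ha).2
    simp at this
  simp only [List.length_append, List.length_cons] at hodd
  exact ⟨ha, hc, h.config.chord.symm, by simpa using hp.split_at.1, hp.split_at.2, h.config.back,
    hA, by omega, h.config.even, by simpa using h.listing⟩

/-- Paths from `a` to `c` whose inner vertices are not adjacent to both do not exist. -/
theorem no_conn (hG : G.IsKChordal 5) (h : IsMinConfig G S a c W Z) {m : List V} {x y : V}
    (hm : G.ListPath x y m) (ha : G.Adj a x) (hc : G.Adj y c)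
    (hgood : ∀ u ∈ m, u ∈ W ∧ (G.Adj a u → ¬ G.Adj u c) ∨
      u ∉ S ∧ ¬ G.Adj a u ∧ ¬ G.Adj u c) : False := by
  obtain ⟨κ, h1, h2, h3⟩ := h.exists_color
  have hmS : ∀ u ∉ W, u ∈ S → u ∉ m := by
    intro u hu huS hum
    rcases hgood u hum with h' | h'
    · exact hu h'.1
    · exact h'.1 huS
  -- A connection through one vertex needs a common neighbour of `a` and `c`. In a connection
  -- through two vertices both would lie in `W` with the same colour and be adjacent.
  rcases hG.exists_short h.config.chord hm ha hc
    (hmS _ h.notMem.1 ((h.listing.2 _).2 (by simp)))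
    (hmS _ h.notMem.2 ((h.listing.2 _).2 (by simp))) with
    ⟨u, hu, hau, huc⟩ | ⟨u, hu, v, hv, hau, huv, hvc⟩
  · rcases hgood u hu with h' | h'
    · exact h'.2 hau huc
    · exact h'.2.1 hau
  · rcases hgood u hu with h' | h'
    · rcases hgood v hv with h'' | h''
      · exact h1 u h'.1 v h''.1 huv ((h2 u h'.1 hau).trans (h3 v h''.1 hvc).symm)
      · exact h''.2.2 hvc
    · exact h'.2.1 hau

/-- Otherwise `W` itself is a path as excluded by `no_conn`. -/
theorem exists_common (hG : G.IsKChordal 5) (h : IsMinConfig G S a c W Z) :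
    ∃ t ∈ W, G.Adj a t ∧ G.Adj t c := by
  by_contra! hcon
  obtain ⟨x, hax, hx⟩ := h.config.arc.exists_tail
  have hne : W ≠ [] := by
    rintro rfl
    have := h.config.odd
    simp at this
  obtain ⟨x', W', rfl⟩ := List.exists_cons_of_ne_nil hne
  obtain ⟨y, hyc, hy⟩ := ListPath.exists_init hx
  exact h.no_conn hG hy hax hyc fun u hu => Or.inl ⟨hu, hcon u hu⟩

/-- A vertex outside the cycle is not adjacent to both `a` and its successor. -/
theorem not_adj_of_adj (h : IsMinConfig G S a c W Z) {x w : V} {W' : List V} (e : W = x :: W')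
    (hw : w ∉ S) (hx : G.Adj x w) : ¬ G.Adj a w := by
  subst e
  intro ha
  have h1 := (ListPath.uncons (x := a) (y := x) (by simpa using h.config.arc)).2
  have h2 := (ListPath.join (l := x :: W') (by simpa using h1) h.config.back).cons hx.symm
  have e1 := h.config.odd
  have e2 := h.config.even
  refine h.spineless.no_even (Swap.single hw) h.listing h2 ha ?_ ?_
  · simp only [List.length_append, List.length_cons, List.length_nil] at e1 e2 ⊢; omega
  · classical
    refine List.perm_iff_count.2 fun z => ?_
    simp only [List.count_append, List.count_cons, List.nil_append, List.count_nil]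
    ring

end IsMinConfig

end Extremal

/-! ### The ends of the short arc and the vertices they hit in `W` or outside the cycle -/

section Arc

variable {V : Type*} {G : SimpleGraph V} {S : Set V} {a c x x' ux y y' uy : V} {W Z : List V}

/-- A minimal configuration together with edges chosen at the two ends of `W`. -/
structure IsArc (G : SimpleGraph V) (S : Set V) (a c : V) (W Z : List V) (x x' ux y y' uy : V) :
    Prop where
  min : IsMinConfig G S a c W Z
  left : ∃ W₁, W = x :: x' :: W₁
  right : ∃ W₂, W.reverse = y :: y' :: W₂
  endx : IsEnd G S x x' ux
  endy : IsEnd G S y y' uy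
  chordal : G.IsKChordal 5

namespace IsArc

theorem mirror (h : IsArc G S a c W Z x x' ux y y' uy) :
    IsArc G S c a W.reverse Z.reverse y y' uy x x' ux :=
  ⟨h.min.mirror, h.right, by simpa using h.left, h.endy, h.endx, h.chordal⟩

theorem left_adj (h : IsArc G S a c W Z x x' ux y y' uy) : G.Adj a x ∧ G.Adj x x' := by
  obtain ⟨W₁, rfl⟩ := h.left
  have := (ListPath.uncons (x := a) (y := x) (by simpa using h.min.config.arc))
  exact ⟨this.1, this.2.uncons.1⟩

theorem right_adj (h : IsArc G S a c W Z x x' ux y y' uy) : G.Adj y c ∧ G.Adj y y' :=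
  ⟨h.mirror.left_adj.1.symm, h.mirror.left_adj.2⟩

theorem mem_left (h : IsArc G S a c W Z x x' ux y y' uy) : x ∈ W ∧ x' ∈ W := by
  obtain ⟨W₁, rfl⟩ := h.left
  simp

theorem mem_right (h : IsArc G S a c W Z x x' ux y y' uy) : y ∈ W ∧ y' ∈ W := by
  simpa using h.mirror.mem_left

theorem left_mem_set (h : IsArc G S a c W Z x x' ux y y' uy) : a ∈ S :=
  (h.min.listing.2 a).2 (by simp)

/-- Otherwise a, x, c would be a triangle of the kind in `IsTri` with an empty first path. -/
theorem not_adj_c (h : IsArc G S a c W Z x x' ux y y' uy) : ¬ G.Adj x c := by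
  intro hc
  obtain ⟨W₁, e⟩ := h.left
  exact (h.min.isTri (A := []) e h.left_adj.1 hc).ne_nil h.min.spineless rfl

theorem exists_color (h : IsArc G S a c W Z x x' ux y y' uy) : ∃ κ : V → Bool,
    (∀ u ∈ W, ∀ v ∈ W, G.Adj u v → κ u ≠ κ v) ∧ (∀ u ∈ W, G.Adj a u → κ u = true) ∧
      (∀ u ∈ W, G.Adj u c → κ u = true) ∧ κ x = true ∧ κ x' = false ∧ κ y = true ∧
      κ y' = false := by
  obtain ⟨κ, h1, h2, h3⟩ := h.min.exists_color
  have hx := h2 x h.mem_left.1 h.left_adj.1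
  have hy := h3 y h.mem_right.1 h.right_adj.1
  refine ⟨κ, h1, h2, h3, hx, ?_, hy, ?_⟩
  · have := h1 _ h.mem_left.1 _ h.mem_left.2 h.left_adj.2
    rw [hx] at this
    simpa using this.symm
  · have := h1 _ h.mem_right.1 _ h.mem_right.2 h.right_adj.2
    rw [hy] at this
    simpa using this.symm

theorem not_adj_x' (h : IsArc G S a c W Z x x' ux y y' uy) : ¬ G.Adj a x' ∧ ¬ G.Adj x' c := by
  obtain ⟨κ, h1, h2, h3, h4, h5, h6, h7⟩ := h.exists_color
  refine ⟨fun h' => ?_, fun h' => ?_⟩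
  · rw [h2 _ h.mem_left.2 h'] at h5; simp at h5
  · rw [h3 _ h.mem_left.2 h'] at h5; simp at h5

theorem not_adj_ends (h : IsArc G S a c W Z x x' ux y y' uy) : ¬ G.Adj x y := by
  obtain ⟨κ, h1, h2, h3, h4, h5, h6, h7⟩ := h.exists_color
  intro h'
  exact h1 _ h.mem_left.1 _ h.mem_right.1 h' (h4.trans h6.symm)

theorem good_left (h : IsArc G S a c W Z x x' ux y y' uy) : (x ∈ W ∧ (G.Adj a x → ¬ G.Adj x c)) ∧
    (x' ∈ W ∧ (G.Adj a x' → ¬ G.Adj x' c)) :=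
  ⟨⟨h.mem_left.1, fun _ => h.not_adj_c⟩, h.mem_left.2, fun _ => h.not_adj_x'.2⟩

theorem good_right (h : IsArc G S a c W Z x x' ux y y' uy) : (y ∈ W ∧ (G.Adj a y → ¬ G.Adj y c)) ∧
    (y' ∈ W ∧ (G.Adj a y' → ¬ G.Adj y' c)) := by
  have h1 := h.mirror.not_adj_c
  have h2 := h.mirror.not_adj_x'
  exact ⟨⟨h.mem_right.1, fun h' => (h1 h'.symm).elim⟩, h.mem_right.2, fun h' => (h2.2 h'.symm).elim⟩

/-! #### Vertices outside the cycle -/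

theorem not_adj_of_adj_x (h : IsArc G S a c W Z x x' ux y y' uy) {w : V} (hw : w ∉ S)
    (hx : G.Adj x w) : ¬ G.Adj a w := by
  obtain ⟨W₁, e⟩ := h.left
  exact h.min.not_adj_of_adj e hw hx

theorem not_adj_of_adj_y (h : IsArc G S a c W Z x x' ux y y' uy) {w : V} (hw : w ∉ S)
    (hy : G.Adj y w) : ¬ G.Adj w c := fun h' => h.mirror.not_adj_of_adj_x hw hy h'.symm

/-- A vertex outside S adjacent to `a` or `c` as well could be inserted into the cycle to make it
even. Thus x, w, y avoids common neighbours of `a` and `c`, contrary to `no_conn`. -/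
theorem not_common_xy (h : IsArc G S a c W Z x x' ux y y' uy) {w : V} (hw : w ∉ S)
    (hx : G.Adj x w) : ¬ G.Adj y w := by
  intro hy
  refine h.min.no_conn h.chordal (m := [x, w, y])
    (((ListPath.single y).cons hy.symm).cons hx) h.left_adj.1 h.right_adj.1 ?_
  intro u hu
  simp only [List.mem_cons, List.not_mem_nil, or_false] at hu
  rcases hu with rfl | rfl | rfl
  · exact Or.inl h.good_left.1
  · exact Or.inr ⟨hw, h.not_adj_of_adj_x hw hx, h.not_adj_of_adj_y hw hy⟩
  · exact Or.inl h.good_right.1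

theorem subset_of_end (h : IsArc G S a c W Z x x' ux y y' uy) (hu : uy ∈ S) :
    uy = y' ∧ ∀ v, G.Adj y v → v ∈ S :=
  h.endy.2.resolve_left fun h' => h' hu

theorem eq_append (h : IsArc G S a c W Z x x' ux y y' uy) : ∃ W₂, W = W₂ ++ [y', y] := by
  obtain ⟨W₂, e⟩ := h.right
  refine ⟨W₂.reverse, ?_⟩
  have := congrArg List.reverse e
  simpa using this

theorem swap_right (h : IsArc G S a c W Z x x' ux y y' uy) (hu : uy ∈ S) :
    Swap G S [] [y] := by
  refine ⟨by simp, by simp, ?_⟩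
  intro r hr v hv
  rw [List.mem_singleton] at hr
  subst hr
  exact ⟨(h.subset_of_end hu).2 v hv, by simpa using hv.ne'⟩

theorem eq_cons_append (h : IsArc G S a c W Z x x' ux y y' uy) :
    ∃ W₃, W = x :: (W₃ ++ [y', y]) := by
  obtain ⟨W₁, e⟩ := h.left
  obtain ⟨W₂, e'⟩ := h.eq_append
  cases W₂ with
  | nil =>
    obtain ⟨κ, h1, h2, h3, h4, h5, h6, h7⟩ := h.exists_color
    rw [e] at e'
    simp at e'
    rw [e'.2.1, h6] at h5
    simp at h5
  | cons v W₂ =>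
    rw [e] at e'
    simp at e'
    exact ⟨W₂, by rw [e, e'.2, e'.1]⟩

theorem path (h : IsArc G S a c W Z x x' ux y y' uy) : G.ListPath x y W := by
  obtain ⟨W₁, e⟩ := h.left
  obtain ⟨W₂, e'⟩ := h.eq_append
  obtain ⟨v, hv, hp⟩ := h.min.config.arc.exists_tail
  have hx : v = x := by
    rw [e] at hp
    exact hp.of_cons
  subst hx
  rw [e] at hp
  obtain ⟨w, hw, hq⟩ := hp.exists_init
  rw [← e, e'] at hq
  have hy : w = y := ListPath.of_concat (l := W₂ ++ [y']) (by simpa using hq)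
  subst hy
  rwa [← e'] at hq

theorem outer_path (h : IsArc G S a c W Z x x' ux y y' uy) :
    (∃ z, G.Adj c z ∧ G.ListPath z a (Z ++ [a])) ∧ ∃ z, G.Adj z a ∧ G.ListPath c z (c :: Z) :=
  ⟨h.min.config.back.exists_tail, h.min.config.back.exists_init (l := Z)⟩

/-- Here `y` may be dropped. If `w` is adjacent to `c`, the cycle with `w` in place of `y` and chord
`xw` has a short arc with two vertices fewer. If it is not, `no_conn` excludes the path x, w, y', y.
-/
theorem not_common_xy' (h : IsArc G S a c W Z x x' ux y y' uy) {w : V} (hw : w ∉ S)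
    (hx : G.Adj x w) (hu : uy ∈ S) : ¬ G.Adj y' w := by
  intro hy
  have hwc : ¬ G.Adj w c := by
    intro hwc
    obtain ⟨W₃, e⟩ := h.eq_cons_append
    have h1 := h.path
    rw [e] at h1
    have h2 := (ListPath.split (l₁ := x :: W₃) h1).1.concat hy
    have h3 := (h.min.config.back.concat h.left_adj.1).cons hwc
    have e1 := h.min.config.odd
    have e2 := h.min.config.even
    have e3 := congrArg List.length e
    simp only [List.length_append, List.length_cons, List.length_nil] at e3
    have hc := ((h.swap_right hu).insert hw (by simp)).isOddConfig (a := x) (c := w)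
      (W := W₃ ++ [y']) (Z := c :: (Z ++ [a])) h.min.spineless.dom h.min.listing
      (by simpa using h2) (by simpa using h3) hx ?_ ?_ ?_
    · have := h.min.min _ _ _ _ hc
      simp only [List.length_append, List.length_cons, List.length_nil] at this
      omega
    · simp only [List.length_append, List.length_cons, List.length_nil]; omega
    · simp only [List.length_append, List.length_cons, List.length_nil]; omega
    · classical
      rw [e]
      refine List.perm_iff_count.2 fun z => ?_
      simp only [List.count_append, List.count_cons, List.count_nil]
      ring
  refine h.min.no_conn h.chordal (m := [x, w, y', y])
    ((((ListPath.single y).cons h.right_adj.2.symm).cons hy.symm).cons hx) h.left_adj.1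
    h.right_adj.1 ?_
  intro u hu
  simp only [List.mem_cons, List.not_mem_nil, or_false] at hu
  rcases hu with rfl | rfl | rfl | rfl
  · exact Or.inl h.good_left.1
  · exact Or.inr ⟨hw, h.not_adj_of_adj_x hw hx, hwc⟩
  · exact Or.inl h.good_right.2
  · exact Or.inl h.good_right.1

theorem not_common_x'y' (h : IsArc G S a c W Z x x' ux y y' uy) {w : V} (hw : w ∉ S)
    (hu : ux ∈ S) (hu' : uy ∈ S) (hx : G.Adj x' w) : ¬ G.Adj y' w := by
  intro hy
  have hxw : ¬ G.Adj x w := fun h' => h.not_common_xy' hw h' hu' hy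
  have hyw : ¬ G.Adj y w := fun h' => h.mirror.not_common_xy' hw h' hu hx
  have key : ∀ {a c : V} {W Z : List V} {x x' ux y y' uy : V},
      IsArc G S a c W Z x x' ux y y' uy → ¬ G.Adj y w → uy ∈ S → G.Adj y' w → G.Adj a w →
      ¬ G.Adj w c → False := by
    intro a c W Z x x' ux y y' uy h hyw hu' hy ha hc
    have ham : a ∉ [w, y', y] := by
      simp only [List.mem_cons, List.not_mem_nil, or_false]
      rintro (rfl | rfl | rfl)
      · exact hw h.left_mem_set
      · exact h.min.notMem.1 h.mem_right.2
      · exact h.min.notMem.1 h.mem_right.1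
    have hcm : c ∉ [w, y', y] := by
      simp only [List.mem_cons, List.not_mem_nil, or_false]
      rintro (rfl | rfl | rfl)
      · exact hw h.mirror.left_mem_set
      · exact h.min.notMem.2 h.mem_right.2
      · exact h.min.notMem.2 h.mem_right.1
    rcases h.chordal.exists_short (m := [w, y', y]) h.min.config.chord
      (((ListPath.single y).cons h.right_adj.2.symm).cons hy.symm) ha h.right_adj.1 ham hcm with
      ⟨u, hu, hau, huc⟩ | ⟨u, hu, v, hv, hau, huv, hvc⟩
    · simp only [List.mem_cons, List.not_mem_nil, or_false] at hu
      rcases hu with rfl | rfl | rfl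
      · exact hc huc
      · exact h.good_right.2.2 hau huc
      · exact h.good_right.1.2 hau huc
    · simp only [List.mem_cons, List.not_mem_nil, or_false] at hu hv
      have h1 := h.mirror.not_adj_x'
      have h2 := h.mirror.not_adj_c
      rcases hu with rfl | rfl | rfl
      · rcases hv with rfl | rfl | rfl
        · exact hc hvc
        · exact h1.1 hvc.symm
        · exact hyw huv.symm
      · exact h1.2 hau.symm
      · exact h2 hau.symm
  -- If `w` is adjacent to both `a` and `c`, dropping `x` leaves even cycles c, w, x', ..., y and c,
  -- Z, a. If it is adjacent to just one, `key` applies, possibly mirrored. If it is adjacent to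
  -- neither, x, x', w, y', y contradicts `no_conn`.
  by_cases ha : G.Adj a w <;> by_cases hc : G.Adj w c
  · obtain ⟨W₁, e⟩ := h.left
    obtain ⟨z, hcz, hz⟩ := h.outer_path.1
    have h1 := h.path
    rw [e] at h1
    have e1 := h.min.config.odd
    have e2 := h.min.config.even
    rw [e] at e1
    refine h.min.spineless.no_double ((h.mirror.swap_right hu).insert hw (by simp)) h.min.listing
      (h1.uncons.2.cons hx.symm) hc.symm h.right_adj.1 hz hcz h.min.config.chord ?_ ?_ ?_
    · simpa using e1
    · simp only [List.length_append, List.length_cons, List.length_nil]; omega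
    · classical
      rw [e]
      refine List.perm_iff_count.2 fun z => ?_
      simp only [List.count_append, List.count_cons, List.count_nil]
      ring
  · exact key h hyw hu' hy ha hc
  · exact key h.mirror hxw hu hx hc.symm fun h' => ha h'.symm
  · refine h.min.no_conn h.chordal (m := [x, x', w, y', y])
      (((((ListPath.single y).cons h.right_adj.2.symm).cons hy.symm).cons hx).cons h.left_adj.2)
      h.left_adj.1 h.right_adj.1 ?_
    intro u hu
    simp only [List.mem_cons, List.not_mem_nil, or_false] at hu
    rcases hu with rfl | rfl | rfl | rfl | rfl
    · exact Or.inl h.good_left.1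
    · exact Or.inl h.good_left.2
    · exact Or.inr ⟨hw, ha, hc⟩
    · exact Or.inl h.good_right.2
    · exact Or.inl h.good_right.1

/-- Since S dominates, an end vertex outside S has no neighbour outside S. So only `x`, `x'`, `y`,
`y'` can be adjacent to `w`. -/
theorem not_common (h : IsArc G S a c W Z x x' ux y y' uy) {w : V} (hw : w ∉ S)
    (hX : G.Adj x w ∨ G.Adj ux w) (hY : G.Adj y w ∨ G.Adj uy w) : False := by
  have hX' : G.Adj x w ∨ ux ∈ S ∧ G.Adj x' w := by
    by_cases hu : ux ∈ S
    · rw [(h.mirror.subset_of_end hu).1] at hX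
      tauto
    · exact Or.inl (hX.resolve_right (h.min.spineless.dom _ _ hu hw))
  have hY' : G.Adj y w ∨ uy ∈ S ∧ G.Adj y' w := by
    by_cases hu : uy ∈ S
    · rw [(h.subset_of_end hu).1] at hY
      tauto
    · exact Or.inl (hY.resolve_right (h.min.spineless.dom _ _ hu hw))
  rcases hX' with hx | ⟨hu, hx⟩ <;> rcases hY' with hy | ⟨hu', hy⟩
  · exact h.not_common_xy hw hx hy
  · exact h.not_common_xy' hw hx hu' hy
  · exact h.mirror.not_common_xy' hw hy hu hx
  · exact h.not_common_x'y' hw hu hu' hx hy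

theorem end_ne_end (h : IsArc G S a c W Z x x' ux y y' uy) (hu : ux ∉ S) : ux ≠ uy := by
  rintro rfl
  exact h.not_common hu (Or.inl h.endx.1) (Or.inl h.endy.1)

theorem not_hits_end (h : IsArc G S a c W Z x x' ux y y' uy) : ¬ Hits G x ux y := by
  intro hh
  rcases hh.2.2 with h1 | h1
  · exact h.not_adj_ends h1
  · by_cases hu : ux ∈ S
    · rw [(h.mirror.subset_of_end hu).1] at h1
      refine h.min.no_conn h.chordal (m := [x, x', y])
        (((ListPath.single y).cons h1).cons h.left_adj.2) h.left_adj.1 h.right_adj.1 ?_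
      intro u hu
      simp only [List.mem_cons, List.not_mem_nil, or_false] at hu
      rcases hu with rfl | rfl | rfl
      · exact Or.inl h.good_left.1
      · exact Or.inl h.good_left.2
      · exact Or.inl h.good_right.1
    · exact h.not_common hu (Or.inl h.endx.1) (Or.inl h1.symm)

/-! #### Consecutive vertices of the arc `W` -/

variable {p q t : V} {k₁ k₂ : List V}

/-- For the triangle a, t, c, the vertices `x` and `q` follow the corners `a` and `t`, so the ends
chosen there are remote. -/
theorem not_hits_succ (h : IsArc G S a c W Z x x' ux y y' uy) (e : W = k₁ ++ t :: q :: k₂)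
    (ha : G.Adj a t) (hc : G.Adj t c) : ¬ Hits G x ux q := by
  have hT := h.min.isTri e ha hc
  obtain ⟨v, v', A', rfl⟩ := hT.exists_cons_cons h.min.spineless
  obtain ⟨r, r', D', hD⟩ := hT.rotate.exists_cons_cons h.min.spineless
  obtain ⟨W₁, e'⟩ := h.left
  rw [e] at e'
  simp at e'
  obtain ⟨rfl, rfl, -⟩ := e'
  rw [hD] at hT
  simp at hD
  obtain ⟨rfl, rfl⟩ := hD
  obtain ⟨ur, hr⟩ := exists_isEnd (S := S) hT.adj_ends.2
  exact (hT.rotate.rotate.remote_ends h.min.spineless h.endx hr).not_hits.1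

theorem not_hits_pred (h : IsArc G S a c W Z x x' ux y y' uy) (e : W = k₁ ++ p :: t :: k₂)
    (ha : G.Adj a t) (hc : G.Adj t c) : ¬ Hits G y uy p :=
  h.mirror.not_hits_succ (k₁ := k₂.reverse) (k₂ := k₁.reverse) (by rw [e]; simp) hc.symm ha.symm

theorem exists_init_eq (h : IsArc G S a c W Z x x' ux y y' uy) (e : W = k₁ ++ p :: q :: k₂) :
    ∃ k₃, k₁ ++ [p] = x :: k₃ ∧ W = x :: (k₃ ++ q :: k₂) := by
  obtain ⟨W₁, e'⟩ := h.left
  rw [e] at e' ⊢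
  cases k₁ with
  | nil => exact ⟨[], by simp at e'; simp [e'.1]⟩
  | cons v k => exact ⟨k ++ [p], by simp at e'; simp [e'.1]⟩

theorem outer_path_reverse (h : IsArc G S a c W Z x x' ux y y' uy) (hc : G.Adj ux c) :
    G.ListPath x ux (x :: (a :: (Z.reverse ++ [c]) ++ [ux])) := by
  have := ((h.min.config.back.reverse).cons h.left_adj.1.symm).concat hc.symm
  simpa using this

/-! ### An end vertex outside the cycle that is adjacent to `c` -/

section Wild

variable (h : IsArc G S a c W Z x x' ux y y' uy) (e : W = k₁ ++ p :: q :: k₂) (hu : ux ∉ S)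
  (hc : G.Adj ux c) (hq : G.Adj ux q)
include h e hu hc hq

/-- The even cycle is c, ux, q, ..., y, p, ..., x, a and back along `Z`. -/
theorem wild_zero : ¬ G.Adj y p := by
  intro hp
  obtain ⟨z, hz, hcz⟩ := h.outer_path.1
  have h1 := h.path
  rw [e] at h1
  have h3 := ((((h1.split.2.2.cons hq).cons hc.symm).append hp h1.split.1.reverse).append
    h.left_adj.1.symm hcz.reverse)
  have e1 := h.min.config.odd
  have e2 := h.min.config.even
  rw [e] at e1
  refine h.min.spineless.no_even (Swap.single hu) h.min.listing h3 hz.symm ?_ ?_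
  · simp only [List.length_append, List.length_cons, List.length_nil, List.length_reverse]
      at e1 e2 ⊢
    omega
  · classical
    rw [e]
    refine List.perm_iff_count.2 fun z => ?_
    simp only [List.count_append, List.count_cons, List.nil_append, List.count_nil,
      List.count_reverse]
    ring

/-- Dropping `y` gives an odd configuration with chord from `ux` to `x` and a short arc with two
vertices fewer. -/
theorem wild_short (hu' : uy ∈ S) (hpy : p ≠ y') : ¬ G.Adj y' p := by
  intro hp
  obtain ⟨k₃, e3, e4⟩ := h.exists_init_eq e
  obtain ⟨W₂, e'⟩ := h.eq_append
  have hk : ∃ k₄, q :: k₂ = k₄ ++ [y', y] := by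
    rw [e] at e'
    rcases List.eq_nil_or_concat k₂ with rfl | ⟨k, v, rfl⟩
    · have e'' : k₁ ++ [p, q] = W₂ ++ [y', y] := e'
      have := (List.append_inj' e'' rfl).2
      simp at this
      exact absurd this.1 hpy
    · rw [List.concat_eq_append] at e'
      have e'' : (k₁ ++ p :: q :: k) ++ [v] = (W₂ ++ [y']) ++ [y] := by simpa using e'
      obtain ⟨e5, e6⟩ := List.append_inj' e'' rfl
      simp at e6
      subst e6
      rcases List.eq_nil_or_concat k with rfl | ⟨k, v', rfl⟩
      · have e7 : (k₁ ++ [p]) ++ [q] = W₂ ++ [y'] := by simpa using e5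
        have := (List.append_inj' e7 rfl).2
        simp at this
        exact ⟨[], by simp [this]⟩
      · rw [List.concat_eq_append] at e5
        have e7 : (k₁ ++ p :: q :: k) ++ [v'] = W₂ ++ [y'] := by simpa using e5
        have := (List.append_inj' e7 rfl).2
        simp at this
        exact ⟨q :: k, by simp [this]⟩
  obtain ⟨k₄, e5⟩ := hk
  have h1 := h.path
  rw [e] at h1
  have h2 : G.ListPath q y (k₄ ++ [y', y]) := e5 ▸ h1.split.2.2
  have h3 := (((ListPath.split h2).1.cons hq).append hp h1.split.1.reverse)
  rw [e3] at h3
  have e1 := h.min.config.odd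
  have e2 := h.min.config.even
  have e6 : W = x :: (k₃ ++ (k₄ ++ [y', y])) := e5 ▸ e4
  have e7 := congrArg List.length e6
  simp only [List.length_append, List.length_cons, List.length_nil] at e7
  have hcf := ((h.swap_right hu').insert hu (by simp)).isOddConfig (a := ux) (c := x)
    (W := k₄ ++ [y'] ++ k₃.reverse) (Z := a :: (Z.reverse ++ [c])) h.min.spineless.dom
    h.min.listing (by simpa using h3) (h.outer_path_reverse hc) h.endx.1.symm ?_ ?_ ?_
  · have := h.min.min _ _ _ _ hcf
    simp only [List.length_append, List.length_cons, List.length_nil, List.length_reverse] at this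
    omega
  · simp only [List.length_append, List.length_cons, List.length_nil, List.length_reverse]; omega
  · simp only [List.length_append, List.length_cons, List.length_nil, List.length_reverse]; omega
  · classical
    rw [e6]
    refine List.perm_iff_count.2 fun z => ?_
    simp only [List.count_append, List.count_cons, List.count_nil,
      List.count_reverse]
    ring

/-- Inserting both end vertices gives an odd configuration with an equally long short arc, but with
two more vertices in the long one. This is where the maximality of `Z` is needed. -/
theorem wild_long (hu' : uy ∉ S) : ¬ G.Adj uy p := by
  intro hp
  obtain ⟨k₃, e3, e4⟩ := h.exists_init_eq e
  have h1 := h.path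
  rw [e] at h1
  have h3 := (((h1.split.2.2.cons hq).concat h.endy.1).append hp h1.split.1.reverse)
  rw [e3] at h3
  have e1 := h.min.config.odd
  have e2 := h.min.config.even
  have e7 := congrArg List.length e4
  simp only [List.length_append, List.length_cons] at e7
  have hcf := ((Swap.single hu').insert hu (by simpa using h.end_ne_end hu)).isOddConfig
    (a := ux) (c := x) (W := q :: k₂ ++ [uy] ++ k₃.reverse) (Z := a :: (Z.reverse ++ [c]))
    h.min.spineless.dom h.min.listing (by simpa using h3) (h.outer_path_reverse hc)
    h.endx.1.symm ?_ ?_ ?_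
  · have := h.min.max _ _ _ _ hcf
    simp only [List.length_append, List.length_cons, List.length_nil, List.length_reverse] at this
    omega
  · simp only [List.length_append, List.length_cons, List.length_nil, List.length_reverse]; omega
  · simp only [List.length_append, List.length_cons, List.length_nil, List.length_reverse]; omega
  · classical
    rw [e4]
    refine List.perm_iff_count.2 fun z => ?_
    simp only [List.count_append, List.count_cons, List.nil_append, List.count_nil,
      List.count_reverse]
    ring

theorem wild : ¬ Hits G y uy p := by
  intro hh
  rcases hh.2.2 with h1 | h1
  · exact h.wild_zero e hu hc hq h1
  · by_cases hu' : uy ∈ S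
    · have := (h.subset_of_end hu').1
      subst this
      exact h.wild_short e hu hc hq hu' hh.2.1 h1
    · exact h.wild_long e hu hc hq hu' h1

end Wild

/-- The vertices through which `x` can reach a vertex hit by the end at `x`. -/
theorem exists_good_path (h : IsArc G S a c W Z x x' ux y y' uy)
    (hw : ux ∉ S → G.Adj ux q → ¬ G.Adj ux c) (hh : Hits G x ux q) : ∃ m w, G.ListPath x w m ∧
      G.Adj w q ∧ ∀ u ∈ m, u ∈ W ∧ (G.Adj a u → ¬ G.Adj u c) ∨
        u ∉ S ∧ ¬ G.Adj a u ∧ ¬ G.Adj u c := by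
  rcases hh.2.2 with h1 | h1
  · refine ⟨[x], x, ListPath.single x, h1, fun u hu => ?_⟩
    rw [List.mem_singleton] at hu
    subst hu
    exact Or.inl h.good_left.1
  · refine ⟨[x, ux], ux, (ListPath.single ux).cons h.endx.1, h1, fun u hu => ?_⟩
    simp only [List.mem_cons, List.not_mem_nil, or_false] at hu
    rcases hu with rfl | rfl
    · exact Or.inl h.good_left.1
    · by_cases hu : u ∈ S
      · have := (h.mirror.subset_of_end hu).1
        subst this
        exact Or.inl h.good_left.2
      · exact Or.inr ⟨hu, h.not_adj_of_adj_x hu h.endx.1, hw hu h1⟩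

/-- The hits join `x`, possibly over `ux`, to `q` and `p` and on to `y`. By `wild`, `not_hits_pred`
and `not_hits_succ` all vertices of this connection are admissible for `no_conn`. -/
theorem not_hits_pair (h : IsArc G S a c W Z x x' ux y y' uy) (e : W = k₁ ++ p :: q :: k₂)
    (hp : Hits G y uy p) : ¬ Hits G x ux q := by
  intro hq
  have e' : W.reverse = k₂.reverse ++ q :: p :: k₁.reverse := by rw [e]; simp
  obtain ⟨m, w, hm, hwq, hgood⟩ := h.exists_good_path
    (fun hu h1 hc => h.wild e hu hc h1 hp) hq
  obtain ⟨m', w', hm', hwp, hgood'⟩ := h.mirror.exists_good_path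
    (fun hu h1 hc => h.mirror.wild e' hu hc h1 hq) hp
  have hpq : G.Adj p q := by
    have := h.path
    rw [e] at this
    exact this.split.2.1
  have hpath := (hm.concat hwq).append hpq.symm (hm'.concat hwp).reverse
  refine h.min.no_conn h.chordal hpath h.left_adj.1 h.right_adj.1 ?_
  intro u hu
  simp only [List.mem_append, List.mem_reverse, List.mem_singleton] at hu
  rcases hu with (hu | rfl) | (hu | rfl)
  · exact hgood u hu
  · exact Or.inl ⟨by rw [e]; simp, fun ha hc => h.not_hits_pred e ha hc hp⟩
  · rcases hgood' u hu with ⟨h1, h2⟩ | ⟨h1, h2, h3⟩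
    · exact Or.inl ⟨by simpa using h1, fun ha hc => h2 hc.symm ha.symm⟩
    · exact Or.inr ⟨h1, fun h' => h3 h'.symm, fun h' => h2 h'.symm⟩
  · exact Or.inl ⟨by rw [e]; simp, fun ha hc => h.not_hits_succ e ha hc hq⟩

end IsArc

end Arc

/-! ### Vertices of the long arc `Z` hit from the ends of `W` -/

section Outer

variable {V : Type*} {G : SimpleGraph V} {S : Set V} {a c x x' ux y y' uy : V} {W Z : List V}

/-- The vertex `v` is adjacent to `x` (label 0) or to `u` (label 1). -/
def LabelHit (G : SimpleGraph V) (x u : V) (ℓ : ℕ) (v : V) : Prop :=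
  ℓ = 0 ∧ G.Adj x v ∨ ℓ = 1 ∧ G.Adj u v

theorem Hits.exists_label {u v : V} (h : Hits G x u v) : ∃ ℓ, LabelHit G x u ℓ v :=
  h.2.2.elim (fun h => ⟨0, Or.inl ⟨rfl, h⟩⟩) fun h => ⟨1, Or.inr ⟨rfl, h⟩⟩

theorem LabelHit.le_one {u v : V} {ℓ : ℕ} (h : LabelHit G x u ℓ v) : ℓ ≤ 1 := by
  rcases h with h | h <;> omega

theorem IsEnd.exists_of_labelHit {y u v : V} {ℓ : ℕ} (h : IsEnd G S x y u) (hxy : G.Adj x y)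
    (hv : LabelHit G x u ℓ v) : ∃ w E I R, IsPrefix G S x y ℓ w E I R ∧
      (∀ i ∈ I, i = u) ∧ G.Adj w v := by
  rcases hv with ⟨rfl, h1⟩ | ⟨rfl, h1⟩
  · exact ⟨x, [x], [], [], isPrefix_zero hxy, by simp, h1⟩
  · obtain ⟨E, I, R, hp⟩ := h.isPrefix hxy
    exact ⟨u, E, I, R, hp, hp.mem, h1⟩

theorem IsPrefix.link {ℓ ℓ' : ℕ} {u u' : V} {E I R E' I' R' Wm : List V}
    (hm : G.ListPath x' y' Wm) (hP : IsPrefix G S x x' ℓ u E I R)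
    (hP' : IsPrefix G S y y' ℓ' u' E' I' R') : G.ListPath u u' (E ++ Wm ++ E'.reverse) := by
  have := (hP'.path _ _ (hP.path _ _ hm).reverse).reverse
  simpa using this

namespace IsArc

variable (h : IsArc G S a c W Z x x' ux y y' uy)
  {ℓ ℓ' : ℕ} {u u' p q : V} {E I R E' I' R' : List V} {l₁ l₂ : List V}
include h

theorem swap_ends (hP : IsPrefix G S x x' ℓ u E I R) (hP' : IsPrefix G S y y' ℓ' u' E' I' R')
    (hI : ∀ i ∈ I, i = ux) (hI' : ∀ i ∈ I', i = uy) : Swap G S (I ++ I') (R ++ R') :=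
  hP.swap_two hP' (fun i hi hi' => h.end_ne_end (hI i hi ▸ hP.out i hi)
    ((hI i hi).symm.trans (hI' i hi'))) h.not_adj_ends

theorem exists_mid : ∃ Wm, W = x :: (Wm ++ [y]) ∧ G.ListPath x' y' Wm := by
  obtain ⟨W₃, e⟩ := h.eq_cons_append
  have h1 := h.path
  rw [e] at h1
  obtain ⟨v, hv, hp⟩ := ListPath.exists_tail (ListPath.split (l₁ := x :: W₃) h1).1
  refine ⟨W₃ ++ [y'], by rw [e]; simp, ?_⟩
  obtain ⟨W₁, e'⟩ := h.left
  have : v = x' := by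
    rw [e, List.cons.injEq] at e'
    cases W₃ with
    | nil => simp at e' hp; rw [← e'.1]; exact hp.of_cons
    | cons r k => simp at e' hp; rw [← e'.1]; exact hp.of_cons
  exact this ▸ hp

theorem outer_split (e : Z = l₁ ++ p :: l₂) :
    (∃ v, G.Adj v p ∧ G.ListPath c v (c :: l₁)) ∧ (∃ s, G.Adj p s ∧ G.ListPath s a (l₂ ++ [a])) ∧
      G.ListPath c p (c :: l₁ ++ [p]) := by
  have h1 := h.min.config.back
  rw [e] at h1
  have h2 := ListPath.split_at (l₁ := c :: l₁) (x := p) (l₂ := l₂ ++ [a]) (by simpa using h1)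
  exact ⟨ListPath.exists_init h2.1, ListPath.exists_tail h2.2, h2.1⟩

theorem outer_split_two (e : Z = l₁ ++ p :: q :: l₂) : G.ListPath c p (c :: l₁ ++ [p]) ∧
    G.Adj p q ∧ G.ListPath q a (q :: l₂ ++ [a]) := by
  have h1 := h.min.config.back
  rw [e] at h1
  exact ListPath.split (l₁ := c :: l₁) (x := p) (y := q) (l₂ := l₂ ++ [a]) (by simpa using h1)

/-- Two even cycles share `p`: one through the modified arc `W`, the other through `Z` and the chord
`ac`. -/
theorem not_labelHit_same (e : Z = l₁ ++ p :: l₂) (hx : LabelHit G x ux ℓ p) :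
    ¬ LabelHit G y uy ℓ p := by
  intro hy
  obtain ⟨u, E, I, R, hP, hI, hu⟩ := h.endx.exists_of_labelHit h.left_adj.2 hx
  obtain ⟨u', E', I', R', hP', hI', hu'⟩ := h.endy.exists_of_labelHit h.right_adj.2 hy
  obtain ⟨Wm, eW, hm⟩ := h.exists_mid
  obtain ⟨⟨v, hv, h1⟩, ⟨s, hs, h2⟩, -⟩ := h.outer_split e
  have e1 := h.min.config.odd
  have e2 := h.min.config.even
  have e3 := hP.parity
  have e4 := hP'.parity
  rw [e] at e2
  rw [eW] at e1
  simp only [List.length_append, List.length_cons, List.length_nil] at e1 e2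
  refine h.min.spineless.no_double (h.swap_ends hP hP' hI hI') h.min.listing
    (IsPrefix.link hm hP hP') hu.symm hu' (h2.append h.min.config.chord h1) hs hv ?_ ?_ ?_
  · simp only [List.length_append, List.length_reverse]; omega
  · simp only [List.length_append, List.length_cons, List.length_nil]; omega
  · classical
    rw [e, eW]
    refine List.perm_iff_count.2 fun z => ?_
    have e2 := hP.count z
    have e3 := hP'.count z
    simp only [List.count_append, List.count_cons, List.count_reverse, List.count_nil] at e2 e3 ⊢
    linarith

/-- The modified arc `W` replaces the edge `pq`, and the chord `ac` replaces the passage through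
`W`. Different labels make the resulting cycle even. -/
theorem not_labelHit_diff (e : Z = l₁ ++ p :: q :: l₂) (hl : ℓ ≠ ℓ')
    (hx : LabelHit G x ux ℓ p) : ¬ LabelHit G y uy ℓ' q := by
  intro hy
  obtain ⟨u, E, I, R, hP, hI, hu⟩ := h.endx.exists_of_labelHit h.left_adj.2 hx
  obtain ⟨u', E', I', R', hP', hI', hu'⟩ := h.endy.exists_of_labelHit h.right_adj.2 hy
  obtain ⟨Wm, eW, hm⟩ := h.exists_mid
  obtain ⟨h1, -, h2⟩ := h.outer_split_two e
  have e1 := h.min.config.odd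
  have e2 := h.min.config.even
  have e3 := hP.parity
  have e4 := hP'.parity
  have := hx.le_one
  have := hy.le_one
  rw [e] at e2
  rw [eW] at e1
  simp only [List.length_append, List.length_cons, List.length_nil] at e1 e2
  refine h.min.spineless.no_even (h.swap_ends hP hP' hI hI') h.min.listing
    (((IsPrefix.link hm hP hP').append hu' h2).append h.min.config.chord h1) hu.symm ?_ ?_
  · simp only [List.length_append, List.length_cons, List.length_nil, List.length_reverse]; omega
  · classical
    rw [e, eW]
    refine List.perm_iff_count.2 fun z => ?_
    have e2 := hP.count z
    have e3 := hP'.count z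
    simp only [List.count_append, List.count_cons, List.count_reverse, List.count_nil] at e2 e3 ⊢
    linarith

theorem not_labelHit_diff_symm (e : Z = l₁ ++ p :: q :: l₂) (hl : ℓ ≠ ℓ')
    (hx : LabelHit G x ux ℓ q) : ¬ LabelHit G y uy ℓ' p := by
  intro hy
  obtain ⟨u, E, I, R, hP, hI, hu⟩ := h.endx.exists_of_labelHit h.left_adj.2 hx
  obtain ⟨u', E', I', R', hP', hI', hu'⟩ := h.endy.exists_of_labelHit h.right_adj.2 hy
  obtain ⟨Wm, eW, hm⟩ := h.exists_mid
  obtain ⟨h1, -, h2⟩ := h.outer_split_two e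
  have e1 := h.min.config.odd
  have e2 := h.min.config.even
  have e3 := hP.parity
  have e4 := hP'.parity
  have := hx.le_one
  have := hy.le_one
  rw [e] at e2
  rw [eW] at e1
  simp only [List.length_append, List.length_cons, List.length_nil] at e1 e2
  refine h.min.spineless.no_even (h.swap_ends hP hP' hI hI') h.min.listing
    (((IsPrefix.link hm hP hP').append hu' h1.reverse).append h.min.config.chord.symm h2.reverse)
    hu.symm ?_ ?_
  · simp only [List.length_append, List.length_cons, List.length_nil, List.length_reverse]; omega
  · classical
    rw [e, eW]
    refine List.perm_iff_count.2 fun z => ?_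
    have e2 := hP.count z
    have e3 := hP'.count z
    simp only [List.count_append, List.count_cons, List.count_reverse, List.count_nil] at e2 e3 ⊢
    linarith

theorem exists_lobe {A D : List V} {t : V} (e : W = A ++ t :: D) (ha : G.Adj a t)
    (hc : G.Adj t c) (hP : IsPrefix G S x x' ℓ u E I R) :
    ∃ A₁ v, A = x :: A₁ ∧ G.ListPath u v (E ++ A₁) ∧ G.Adj v t := by
  have hT := h.min.isTri e ha hc
  obtain ⟨v, v', A', rfl⟩ := hT.exists_cons_cons h.min.spineless
  obtain ⟨W₁, e'⟩ := h.left
  rw [e] at e'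
  simp at e'
  obtain ⟨rfl, rfl, -⟩ := e'
  have h1 := hP.path _ _ (ListPath.split (l₁ := [a]) (by simpa using hT.pathA)).2.2
  obtain ⟨w, t', h2, hwt, h3⟩ := ListPath.split_append (l₁ := E ++ v' :: A') (l₂ := [t])
    (by simpa using h1) (by simp) (by simp)
  rw [h3.of_cons] at hwt
  exact ⟨v' :: A', w, rfl, h2, hwt⟩

/-- The common neighbour `t` of `a` and `c` splits `W`. One half with `p` and the part of `Z`
towards `c`, and the other half with `q` and the part towards `a`, form cycles sharing `t`; the
parity condition makes them even. -/
theorem not_labelHit_cross (e : Z = l₁ ++ p :: q :: l₂) (hl : (l₁.length + 1 + ℓ) % 2 = 0)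
    (hx : LabelHit G x ux ℓ p) : ¬ LabelHit G y uy ℓ q := by
  intro hy
  obtain ⟨u, E, I, R, hP, hI, hu⟩ := h.endx.exists_of_labelHit h.left_adj.2 hx
  obtain ⟨u', E', I', R', hP', hI', hu'⟩ := h.endy.exists_of_labelHit h.right_adj.2 hy
  obtain ⟨t, ht, hat, htc⟩ := h.min.exists_common h.chordal
  obtain ⟨A, D, eW⟩ := List.append_of_mem ht
  obtain ⟨h1, -, h2⟩ := h.outer_split_two e
  have hT := h.min.isTri eW hat htc
  obtain ⟨A₁, v, eA, h3, hv⟩ := h.exists_lobe eW hat htc hP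
  obtain ⟨D₁, v', eD, h4, hv'⟩ := h.mirror.exists_lobe (A := D.reverse) (D := A.reverse) (t := t)
    (by rw [eW]; simp) htc.symm hat.symm hP'
  have eD' : D = D₁.reverse ++ [y] := by
    have := congrArg List.reverse eD
    simpa using this
  have e0 := h.min.config.even
  have e1 := hT.evenA
  have e2 := hT.evenD
  have e3 := hP.parity
  have e4 := hP'.parity
  rw [e] at e0
  rw [eA] at e1
  rw [eD'] at e2
  simp only [List.length_append, List.length_cons, List.length_nil, List.length_reverse] at e0 e1 e2
  refine h.min.spineless.no_double (h.swap_ends hP hP' hI hI') h.min.listing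
    (h3.reverse.append hu h1.reverse) hv.symm htc.symm (h4.reverse.append hu' h2)
    hv'.symm hat ?_ ?_ ?_
  · simp only [List.length_append, List.length_cons, List.length_nil, List.length_reverse]; omega
  · simp only [List.length_append, List.length_cons, List.length_nil, List.length_reverse]; omega
  · classical
    rw [e, eW, eA, eD']
    refine List.perm_iff_count.2 fun z => ?_
    have e2 := hP.count z
    have e3 := hP'.count z
    simp only [List.count_append, List.count_cons, List.count_reverse, List.count_nil] at e2 e3 ⊢
    linarith

theorem not_labelHit_cross_symm (e : Z = l₁ ++ p :: q :: l₂) (hl : (l₁.length + 1 + ℓ) % 2 = 0)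
    (hx : LabelHit G x ux ℓ q) : ¬ LabelHit G y uy ℓ p := by
  intro hy
  obtain ⟨u, E, I, R, hP, hI, hu⟩ := h.endx.exists_of_labelHit h.left_adj.2 hx
  obtain ⟨u', E', I', R', hP', hI', hu'⟩ := h.endy.exists_of_labelHit h.right_adj.2 hy
  obtain ⟨t, ht, hat, htc⟩ := h.min.exists_common h.chordal
  obtain ⟨A, D, eW⟩ := List.append_of_mem ht
  obtain ⟨h1, -, h2⟩ := h.outer_split_two e
  have hT := h.min.isTri eW hat htc
  obtain ⟨A₁, v, eA, h3, hv⟩ := h.exists_lobe eW hat htc hP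
  obtain ⟨D₁, v', eD, h4, hv'⟩ := h.mirror.exists_lobe (A := D.reverse) (D := A.reverse) (t := t)
    (by rw [eW]; simp) htc.symm hat.symm hP'
  have eD' : D = D₁.reverse ++ [y] := by
    have := congrArg List.reverse eD
    simpa using this
  have e0 := h.min.config.even
  have e1 := hT.evenA
  have e2 := hT.evenD
  have e3 := hP.parity
  have e4 := hP'.parity
  rw [e] at e0
  rw [eA] at e1
  rw [eD'] at e2
  simp only [List.length_append, List.length_cons, List.length_nil, List.length_reverse] at e0 e1 e2
  refine h.min.spineless.no_double (h.swap_ends hP hP' hI hI') h.min.listing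
    (h3.reverse.append hu h2) hv.symm hat (h4.reverse.append hu' h1.reverse)
    hv'.symm htc.symm ?_ ?_ ?_
  · simp only [List.length_append, List.length_cons, List.length_nil, List.length_reverse]; omega
  · simp only [List.length_append, List.length_cons, List.length_nil, List.length_reverse]; omega
  · classical
    rw [e, eW, eA, eD']
    refine List.perm_iff_count.2 fun z => ?_
    have e2 := hP.count z
    have e3 := hP'.count z
    simp only [List.count_append, List.count_cons, List.count_reverse, List.count_nil] at e2 e3 ⊢
    linarith

/-- With label 0 there are even cycles sharing `x`; with label 1 and `ux = x'` they share `x'`. If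
`ux` is outside S, it can be inserted between `p` and `q`, making the cycle even. -/
theorem not_labelHit_self (e : Z = l₁ ++ p :: q :: l₂) (hl : (l₁.length + 1 + ℓ) % 2 = 0)
    (hx : LabelHit G x ux ℓ p) : ¬ LabelHit G x ux ℓ q := by
  intro hy
  obtain ⟨h1, -, h2⟩ := h.outer_split_two e
  obtain ⟨W₁, eW⟩ := h.left
  have hp := h.path
  rw [eW] at hp
  have e0 := h.min.config.even
  have e1 := h.min.config.odd
  rw [e] at e0
  rw [eW] at e1
  simp only [List.length_append, List.length_cons] at e0 e1
  rcases hx with ⟨rfl, hx⟩ | ⟨rfl, hx⟩ <;> rcases hy with ⟨h', hy⟩ | ⟨h', hy⟩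
  · refine h.min.spineless.no_double Swap.nil h.min.listing (hp.uncons.2.append h.right_adj.1 h1)
      hp.uncons.1 hx.symm h2 hy h.left_adj.1 ?_ ?_ ?_
    · simp only [List.length_append, List.length_cons, List.length_nil]; omega
    · simp only [List.length_append, List.length_cons, List.length_nil]; omega
    · classical
      rw [e, eW]
      refine List.perm_iff_count.2 fun z => ?_
      simp only [List.count_append, List.count_cons, List.count_nil]
      ring
  · omega
  · omega
  · by_cases hu : ux ∈ S
    · have := (h.mirror.subset_of_end hu).1
      subst this
      have hne : W₁ ≠ [] := by
        rintro rfl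
        simp at e1
      obtain ⟨r, k, rfl⟩ := List.exists_cons_of_ne_nil hne
      have hr := hp.uncons.2.uncons
      refine h.min.spineless.no_double Swap.nil h.min.listing
        (hr.2.append h.right_adj.1 h1) hr.1 hx.symm
        (h2.concat h.left_adj.1) hy hp.uncons.1 ?_ ?_ ?_
      · simp only [List.length_append, List.length_cons, List.length_nil] at e1 ⊢; omega
      · simp only [List.length_append, List.length_cons, List.length_nil]; omega
      · classical
        rw [e, eW]
        refine List.perm_iff_count.2 fun z => ?_
        simp only [List.count_append, List.count_cons, List.count_nil]
        ring
    · refine h.min.spineless.no_even (Swap.single hu) h.min.listing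
        (((h1.concat hx.symm).append hy h2).append h.left_adj.1 hp) h.right_adj.1 ?_ ?_
      · simp only [List.length_append, List.length_cons, List.length_nil]; omega
      · classical
        rw [e, eW]
        refine List.perm_iff_count.2 fun z => ?_
        simp only [List.count_append, List.count_cons, List.count_nil]
        ring

/-- The single edge `xa` would be one of two even cycles sharing `x`. -/
theorem not_adj_last (e : Z = l₁ ++ [p]) : ¬ G.Adj x p := by
  intro hx
  obtain ⟨-, -, h1⟩ := h.outer_split e
  obtain ⟨W₁, eW⟩ := h.left
  have hp := h.path
  rw [eW] at hp
  have e0 := h.min.config.even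
  have e1 := h.min.config.odd
  rw [e] at e0
  rw [eW] at e1
  simp only [List.length_append, List.length_cons, List.length_nil] at e0 e1
  refine h.min.spineless.no_double Swap.nil h.min.listing (hp.uncons.2.append h.right_adj.1 h1)
    hp.uncons.1 hx.symm (ListPath.single a) h.left_adj.1.symm h.left_adj.1 ?_ (by simp) ?_
  · simp only [List.length_append, List.length_cons, List.length_nil]; omega
  · classical
    rw [e, eW]
    refine List.perm_iff_count.2 fun z => ?_
    simp only [List.count_append, List.count_cons, List.count_nil, List.nil_append]
    ring

theorem exists_cons_cons : ∃ z z' Z', Z = z :: z' :: Z' := by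
  obtain ⟨t, ht, hat, htc⟩ := h.min.exists_common h.chordal
  obtain ⟨A, D, eW⟩ := List.append_of_mem ht
  exact (h.min.isTri eW hat htc).rotate.rotate.exists_cons_cons h.min.spineless

theorem not_hits_first {Z₁ : List V} (e : Z = p :: Z₁) : ¬ Hits G x ux p ∧ ¬ G.Adj x p := by
  obtain ⟨z, z', Z', rfl⟩ := h.exists_cons_cons
  simp at e
  obtain ⟨rfl, -⟩ := e
  obtain ⟨t, ht, hat, htc⟩ := h.min.exists_common h.chordal
  obtain ⟨A, D, eW⟩ := List.append_of_mem ht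
  have hT := h.min.isTri eW hat htc
  obtain ⟨v, v', A', rfl⟩ := hT.exists_cons_cons h.min.spineless
  obtain ⟨W₁, e'⟩ := h.left
  rw [eW] at e'
  simp at e'
  obtain ⟨rfl, rfl, -⟩ := e'
  obtain ⟨ur, hr⟩ := exists_isEnd (S := S) hT.rotate.adj_ends.2
  have := (hT.rotate.remote_ends h.min.spineless hr h.endx).symm
  exact ⟨this.not_hits.1, (this _ (Sym2.mem_mk_left _ _) _ (Sym2.mem_mk_left _ _)).2⟩

end IsArc

/-- A counting argument for two families of hits along a list. -/
theorem sum_lt_length_of_labels {Z : List V} {X Y : ℕ → V → Prop} {f g : V → ℕ}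
    (hf : ∀ v, f v ≤ 1) (hg : ∀ v, g v ≤ 1)
    (hfX : ∀ v ∈ Z, f v ≠ 0 → ∃ ℓ ≤ 1, X ℓ v) (hgY : ∀ v ∈ Z, g v ≠ 0 → ∃ ℓ ≤ 1, Y ℓ v)
    (same : ∀ l₁ p l₂ ℓ, Z = l₁ ++ p :: l₂ → X ℓ p → ¬ Y ℓ p)
    (diff : ∀ l₁ p q l₂ ℓ ℓ', Z = l₁ ++ p :: q :: l₂ → ℓ ≠ ℓ' →
      (X ℓ p → ¬ Y ℓ' q) ∧ (Y ℓ p → ¬ X ℓ' q))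
    (cross : ∀ l₁ p q l₂ ℓ, Z = l₁ ++ p :: q :: l₂ → (l₁.length + 1 + ℓ) % 2 = 0 →
      (X ℓ p → ¬ Y ℓ q ∧ ¬ X ℓ q) ∧ (Y ℓ p → ¬ X ℓ q ∧ ¬ Y ℓ q))
    (first : ∀ p l, Z = p :: l → f p = 0 ∧ ¬ Y 0 p)
    (last : ∀ l p, Z = l ++ [p] → ¬ X 0 p ∧ ¬ Y 0 p)
    (hZ : Z.length % 2 = 0) (hne : Z ≠ []) :
    (Z.map f).sum + (Z.map g).sum + 1 ≤ Z.length := by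
  -- A prefix attains its length only if its last vertex is hit with the label for which `cross`
  -- applies. Then the next vertex is hit at most once and, if so, again with the critical label of
  -- its own position. As `Z` is even, the critical label at its last vertex is 0, against `last`.
  have key : ∀ l₁ l₂, Z = l₁ ++ l₂ → l₁ ≠ [] →
      (l₁.map f).sum + (l₁.map g).sum ≤ l₁.length ∧
      ((l₁.map f).sum + (l₁.map g).sum = l₁.length →
        ∃ l p ℓ, l₁ = l ++ [p] ∧ ℓ ≤ 1 ∧ (l.length + 1 + ℓ) % 2 = 0 ∧ (X ℓ p ∨ Y ℓ p)) := by
    intro l₁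
    induction l₁ using List.reverseRecOn with
    | nil => simp
    | append_singleton l q ih =>
      intro l₂ e _
      have hfq := hf q
      have hgq := hg q
      have hqZ : q ∈ Z := by rw [e]; simp
      have hqX := hfX q hqZ
      have hqY := hgY q hqZ
      have hsame : ∀ ℓ, X ℓ q → ¬ Y ℓ q := fun ℓ => same l q l₂ ℓ (by rw [e]; simp)
      rcases List.eq_nil_or_concat l with rfl | ⟨l, p, rfl⟩
      · have hfst := first q l₂ (by rw [e]; simp)
        simp only [List.nil_append, List.map_cons, List.map_nil, List.sum_cons, List.sum_nil,
          List.length_cons, List.length_nil]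
        refine ⟨by omega, fun hs => ?_⟩
        obtain ⟨ℓ, hl, hY⟩ := hqY (by omega)
        refine ⟨[], q, ℓ, rfl, hl, ?_, Or.inr hY⟩
        have : ℓ ≠ 0 := by rintro rfl; exact hfst.2 hY
        simp only [List.length_nil]
        omega
      · rw [List.concat_eq_append] at e ih ⊢
        obtain ⟨i1, i2⟩ := ih (q :: l₂) (by rw [e]; simp) (by simp)
        have e' : Z = l ++ p :: q :: l₂ := by rw [e]; simp
        simp only [List.map_append, List.sum_append, List.map_cons, List.map_nil, List.sum_cons,
          List.sum_nil, List.length_append, List.length_cons, List.length_nil] at i1 i2 ⊢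
        by_cases hs : (l.map f).sum + (f p + 0) + ((l.map g).sum + (g p + 0)) =
            l.length + (0 + 1)
        · obtain ⟨k, r, ℓ, ek, hl, hpar, hXY⟩ := i2 hs
          obtain ⟨rfl, er⟩ := List.append_inj' ek rfl
          obtain rfl : p = r := by simpa using er
          have h1 := fun ℓ' => diff l p q l₂ ℓ ℓ' e'
          have h2 := cross l p q l₂ ℓ e' hpar
          rcases hXY with hX | hY
          · have hY0 : ∀ ℓ', ¬ Y ℓ' q := by
              intro ℓ'
              by_cases hll : ℓ = ℓ'
              · exact hll ▸ (h2.1 hX).1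
              · exact (h1 ℓ' hll).1 hX
            have hg0 : g q = 0 := by
              by_contra h0
              obtain ⟨ℓ', -, h'⟩ := hqY h0
              exact hY0 ℓ' h'
            refine ⟨by omega, fun hs' => ?_⟩
            obtain ⟨ℓ', hl', h'⟩ := hqX (by omega)
            have : ℓ ≠ ℓ' := by rintro rfl; exact (h2.1 hX).2 h'
            refine ⟨l ++ [p], q, ℓ', rfl, hl', ?_, Or.inl h'⟩
            simp only [List.length_append, List.length_cons, List.length_nil]
            omega
          · have hX0 : ∀ ℓ', ¬ X ℓ' q := by
              intro ℓ'
              by_cases hll : ℓ = ℓ'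
              · exact hll ▸ (h2.2 hY).1
              · exact (h1 ℓ' hll).2 hY
            have hf0 : f q = 0 := by
              by_contra h0
              obtain ⟨ℓ', -, h'⟩ := hqX h0
              exact hX0 ℓ' h'
            refine ⟨by omega, fun hs' => ?_⟩
            obtain ⟨ℓ', hl', h'⟩ := hqY (by omega)
            have : ℓ ≠ ℓ' := by rintro rfl; exact (h2.2 hY).2 h'
            refine ⟨l ++ [p], q, ℓ', rfl, hl', ?_, Or.inr h'⟩
            simp only [List.length_append, List.length_cons, List.length_nil]
            omega
        · refine ⟨by omega, fun hs' => ?_⟩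
          obtain ⟨ℓ, hl, hX⟩ := hqX (by omega)
          obtain ⟨ℓ', hl', hY⟩ := hqY (by omega)
          have hll : ℓ ≠ ℓ' := by rintro rfl; exact hsame ℓ hX hY
          rcases Nat.mod_two_eq_zero_or_one (l.length + 1 + 1 + ℓ) with hpar | hpar
          · refine ⟨l ++ [p], q, ℓ, rfl, hl, ?_, Or.inl hX⟩
            simp only [List.length_append, List.length_cons, List.length_nil]
            omega
          · refine ⟨l ++ [p], q, ℓ', rfl, hl', ?_, Or.inr hY⟩
            simp only [List.length_append, List.length_cons, List.length_nil]
            omega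
  obtain ⟨h1, h2⟩ := key Z [] (by simp) hne
  by_contra hcon
  obtain ⟨l, p, ℓ, e, hl, hpar, hXY⟩ := h2 (by omega)
  have e3 := congrArg List.length e
  simp only [List.length_append, List.length_cons, List.length_nil] at e3
  obtain rfl : ℓ = 0 := by omega
  have := last l p e
  tauto

end Outer

/-! ### Degree sum of the two ends of the short arc -/

section ArcDegree

variable {V : Type*} {G : SimpleGraph V} {S : Set V} {a c x x' ux y y' uy : V} {W Z : List V}

namespace IsArc

theorem exists_split (h : IsArc G S a c W Z x x' ux y y' uy) : ∃ A₁ t D₁,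
    W = (x :: x' :: A₁) ++ t :: (D₁ ++ [y', y]) ∧ G.Adj a t ∧ G.Adj t c := by
  obtain ⟨t, ht, hat, htc⟩ := h.min.exists_common h.chordal
  obtain ⟨A, D, eW⟩ := List.append_of_mem ht
  have hT := h.min.isTri eW hat htc
  obtain ⟨v, v', A', rfl⟩ := hT.exists_cons_cons h.min.spineless
  obtain ⟨r, r', D', hD⟩ := hT.reflect.exists_cons_cons h.min.spineless
  obtain ⟨W₁, e'⟩ := h.left
  obtain ⟨W₂, e''⟩ := h.right
  rw [eW] at e' e''
  rw [List.reverse_append, List.reverse_cons, hD] at e''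
  simp at e' e''
  obtain ⟨rfl, rfl, -⟩ := e'
  obtain ⟨rfl, rfl, -⟩ := e''
  have hD' := congrArg List.reverse hD
  simp at hD'
  exact ⟨A', t, D'.reverse, by rw [eW, hD'], hat, htc⟩

/-- Otherwise `t` is shared by the even cycles t, ux, c, Z, a, A and t, D, uy. -/
theorem not_hits_common (h : IsArc G S a c W Z x x' ux y y' uy) {A D : List V} {t : V}
    (e : W = A ++ t :: D) (hat : G.Adj a t) (htc : G.Adj t c) (hux : ux ∉ S) (huy : uy ∉ S)
    (hc : G.Adj ux c) (hx : Hits G x ux t) : ¬ Hits G y uy t := by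
  intro hy
  obtain ⟨κ, h1, h2, h3, h4, h5, h6, h7⟩ := h.exists_color
  have htW : t ∈ W := by rw [e]; simp
  have hκt := h2 t htW hat
  have hx' : G.Adj ux t := hx.2.2.resolve_left fun h' => h1 _ h.mem_left.1 _ htW h' (h4.trans hκt.symm)
  have hy' : G.Adj uy t := hy.2.2.resolve_left fun h' => h1 _ h.mem_right.1 _ htW h' (h6.trans hκt.symm)
  have hT := h.min.isTri e hat htc
  obtain ⟨r, hrt, hr⟩ := ListPath.exists_init (y := a) (l := A) hT.pathA
  obtain ⟨s, hts, hs⟩ := ListPath.exists_tail hT.pathD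
  have hDne : D ≠ [] := hT.rotate.ne_nil h.min.spineless
  obtain ⟨s', D', rfl⟩ := List.exists_cons_of_ne_nil hDne
  obtain ⟨w, hw, hs2⟩ := ListPath.exists_init (y := s') (l := D') hs
  have hwy : w = y := by
    obtain ⟨W₂, e'⟩ := h.eq_append
    rw [e] at e'
    have h8 := (ListPath.split_at (l₁ := A) (x := t) (l₂ := s' :: D') (e ▸ h.path)).2
    have h9 := h8.uncons.2
    have := h9.2.2
    rw [hs2.2.2] at this
    simpa using this
  subst hwy
  have e1 := hT.evenA
  have e2 := hT.evenD
  have e3 := hT.evenZ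
  simp only [List.length_cons] at e2
  refine h.min.spineless.no_double ((Swap.single huy).insert hux (by simpa using h.end_ne_end hux))
    h.min.listing ((ListPath.join (l := c :: Z) hT.pathZ hr).cons hc) hx'.symm hrt
    (hs2.concat h.endy.1) hts hy' ?_ ?_ ?_
  · simp only [List.length_append, List.length_cons]; omega
  · simp only [List.length_append, List.length_cons, List.length_nil]; omega
  · classical
    rw [e]
    refine List.perm_iff_count.2 fun z => ?_
    simp only [List.count_append, List.count_cons, List.count_nil]
    ring

theorem of_hits_c (h : IsArc G S a c W Z x x' ux y y' uy) (hc : Hits G x ux c) :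
    ux ∉ S ∧ G.Adj ux c := by
  have h1 := hc.2.2.resolve_left h.not_adj_c
  refine ⟨fun hu => ?_, h1⟩
  rw [(h.mirror.subset_of_end hu).1] at h1
  exact h.not_adj_x'.2 h1

open Classical in
theorem sum_outer_le (h : IsArc G S a c W Z x x' ux y y' uy) :
    (Z.map fun v => if Hits G x ux v then 1 else 0).sum +
      (Z.map fun v => if Hits G y uy v then 1 else 0).sum + 1 ≤ Z.length := by
  have hrev : ∀ {l₁ p q l₂}, Z = l₁ ++ p :: q :: l₂ → Z.reverse = l₂.reverse ++ q :: p :: l₁.reverse := by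
    rintro l₁ p q l₂ e
    rw [e]
    simp
  refine sum_lt_length_of_labels (X := LabelHit G x ux) (Y := LabelHit G y uy) ?_ ?_ ?_ ?_ ?_ ?_ ?_
    ?_ ?_ h.min.config.even ?_
  · intro v; split_ifs <;> omega
  · intro v; split_ifs <;> omega
  · intro v _ hv
    obtain ⟨ℓ, hl⟩ := Hits.exists_label (by simpa using hv)
    exact ⟨ℓ, hl.le_one, hl⟩
  · intro v _ hv
    obtain ⟨ℓ, hl⟩ := Hits.exists_label (by simpa using hv)
    exact ⟨ℓ, hl.le_one, hl⟩
  · intro l₁ p l₂ ℓ e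
    exact h.not_labelHit_same e
  · intro l₁ p q l₂ ℓ ℓ' e hl
    exact ⟨h.not_labelHit_diff e hl, fun hY hX => h.not_labelHit_diff_symm e hl.symm hX hY⟩
  · intro l₁ p q l₂ ℓ e hl
    have hl' : (l₂.reverse.length + 1 + ℓ) % 2 = 0 := by
      have e1 := congrArg List.length e
      have e2 := h.min.config.even
      simp only [List.length_append, List.length_cons, List.length_reverse] at e1 ⊢
      omega
    exact ⟨fun hX => ⟨h.not_labelHit_cross e hl hX, h.not_labelHit_self e hl hX⟩,
      fun hY => ⟨fun hX => h.not_labelHit_cross_symm e hl hX hY,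
        fun hY' => h.mirror.not_labelHit_self (hrev e) hl' hY' hY⟩⟩
  · intro p l e
    refine ⟨if_neg (h.not_hits_first e).1, ?_⟩
    rintro (h' | h')
    · exact h.mirror.not_adj_last (l₁ := l.reverse) (by rw [e]; simp) h'.2
    · omega
  · intro l p e
    constructor
    · rintro (h' | h')
      · exact h.not_adj_last e h'.2
      · omega
    · rintro (h' | h')
      · exact (h.mirror.not_hits_first (Z₁ := l.reverse) (by rw [e]; simp)).2 h'.2
      · omega
  · obtain ⟨z, z', Z', e⟩ := h.exists_cons_cons
    rw [e]
    simp

open Classical in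
-- The arc `W` together with `f c` and `g a` contributes at most its length, `f a + g c` at most 2,
-- and `Z` at most its length minus 1. The second vertex of each end edge saves another unit, inside
-- or outside S.
theorem edgeDegree_add_le [Fintype V] (h : IsArc G S a c W Z x x' ux y y' uy) :
    G.edgeDegree s(x, ux) + G.edgeDegree s(y, uy) + 3 ≤ Fintype.card V := by
  have hZ := h.sum_outer_le
  rw [edgeDegree_eq_sum, edgeDegree_eq_sum]
  set f : V → ℕ := fun v => if Hits G x ux v then 1 else 0 with hf
  set g : V → ℕ := fun v => if Hits G y uy v then 1 else 0 with hg
  have f1 : ∀ v, f v ≤ 1 := fun v => by simp only [hf]; split_ifs <;> omega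
  have g1 : ∀ v, g v ≤ 1 := fun v => by simp only [hg]; split_ifs <;> omega
  have f0 : ∀ v, ¬ Hits G x ux v → f v = 0 := fun v hv => if_neg hv
  have g0 : ∀ v, ¬ Hits G y uy v → g v = 0 := fun v hv => if_neg hv
  have pair : ∀ p q, ¬ (Hits G y uy p ∧ Hits G x ux q) → g p + f q ≤ 1 := by
    intro p q hpq
    simp only [hf, hg]
    split_ifs <;> simp_all
  have fx := f0 x not_hits_left
  have fux := f0 ux not_hits_right
  have gy := g0 y not_hits_left
  have guy := g0 uy not_hits_right
  have fy := f0 y h.not_hits_end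
  have gx := g0 x h.mirror.not_hits_end
  obtain ⟨A₁, t, D₁, eW, hat, htc⟩ := h.exists_split
  have hne : ux ≠ uy := by
    by_cases hu : ux ∈ S
    · by_cases hu' : uy ∈ S
      · rw [(h.mirror.subset_of_end hu).1, (h.subset_of_end hu').1]
        rintro rfl
        have := h.min.config.nodup
        rw [eW] at this
        simp [List.nodup_append] at this
      · exact (h.mirror.end_ne_end hu').symm
    · exact h.end_ne_end hu
  have hout := sum_outside_le (S := S) (h := fun v => f v + g v) (P := [ux, uy]) ?_ ?_ ?_
  rotate_left
  · intro w hw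
    rw [add_comm]
    exact pair w w fun hpq => h.not_common hw hpq.2.2.2 hpq.1.2.2
  · simp [hne]
  · intro w hw hwS
    show f w + g w = 0
    simp only [List.mem_cons, List.not_mem_nil, or_false] at hw
    rcases hw with rfl | rfl
    · have := g0 w fun hh => h.not_common hwS (Or.inl h.endx.1) hh.2.2
      omega
    · have := f0 w fun hh => h.not_common hwS hh.2.2 (Or.inl h.endy.1)
      omega
  have hsum := h.path.sum_eq (f := f) (g := g)
  have bpair : ∀ {k₁ p q k₂}, W = k₁ ++ p :: q :: k₂ → g p + f q ≤ 1 := fun e =>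
    pair _ _ fun hpq => h.not_hits_pair e hpq.1 hpq.2
  have b1 : pairSum g f W + (if ux ∈ S then 1 else 0) + (if uy ∈ S then 1 else 0) + 1 ≤
      W.length := by
    have sx : f x' + (if ux ∈ S then 1 else 0) ≤ 1 := by
      have := f1 x'
      split_ifs with hu
      · rw [← (h.mirror.subset_of_end hu).1]
        omega
      · omega
    have sy : g y' + (if uy ∈ S then 1 else 0) ≤ 1 := by
      have := g1 y'
      split_ifs with hu
      · rw [← (h.subset_of_end hu).1]
        omega
      · omega
    have e1 : W = x :: x' :: ((A₁ ++ t :: D₁) ++ y' :: [y]) := by rw [eW]; simp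
    have e2 : pairSum g f [y] = 0 := by simp [pairSum]
    have b3 : pairSum g f (x' :: ((A₁ ++ t :: D₁) ++ [y'])) ≤ _ := pairSum_le
      fun k₁ p q k₂ e => bpair (k₁ := x :: k₁) (p := p) (q := q) (k₂ := k₂ ++ [y]) (by
        rw [e1]
        have := congrArg (fun l => x :: (l ++ [y])) e
        simpa using this)
    rw [e1, pairSum_cons_cons x, pairSum_cons_append x', pairSum_cons_cons y', e2]
    simp only [List.length_append, List.length_cons, List.length_nil] at b3 ⊢
    omega
  -- If `c` and `a` are both hit from the opposite ends, the two pairs around `t` together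
  -- contribute at most 1: the vertex before `t` is not hit from `y`, the one after it not from `x`,
  -- and `t` itself at most once.
  have b2 : Hits G x ux c → Hits G y uy a → pairSum g f W + 2 ≤ W.length := by
    intro hc ha
    have h1 := h.of_hits_c hc
    have h2 := h.mirror.of_hits_c ha
    obtain ⟨A₀, r, eA⟩ := (List.eq_nil_or_concat (x :: x' :: A₁)).resolve_left (by simp)
    obtain ⟨s, D₀, eD⟩ := List.exists_cons_of_ne_nil (l := D₁ ++ [y', y]) (by simp)
    rw [List.concat_eq_append] at eA
    have e1 : W = A₀ ++ r :: t :: s :: D₀ := by rw [eW, eA, eD]; simp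
    have b3 : pairSum g f (A₀ ++ [r]) ≤ _ := pairSum_le fun k₁ p q k₂ e =>
      bpair (k₁ := k₁) (p := p) (q := q) (k₂ := k₂ ++ t :: s :: D₀) (by
        rw [e1]
        have := congrArg (fun l => l ++ t :: s :: D₀) e
        simpa using this)
    have b4 : pairSum g f (s :: D₀) ≤ _ := pairSum_le fun k₁ p q k₂ e =>
      bpair (k₁ := A₀ ++ r :: t :: k₁) (p := p) (q := q) (k₂ := k₂) (by
        rw [e1, e]
        simp)
    have e2 := g0 r (h.not_hits_pred e1 hat htc)
    have e3 := f0 s (h.not_hits_succ (k₁ := A₀ ++ [r]) (k₂ := D₀) (by rw [e1]; simp) hat htc)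
    have e4 := pair t t fun hh => h.not_hits_common (A := A₀ ++ [r]) (D := s :: D₀) (by rw [e1]; simp) hat htc
      h1.1 h2.1 h1.2 hh.2 hh.1
    rw [e1, pairSum_append, pairSum_cons_cons r, pairSum_cons_cons t]
    simp only [List.length_append, List.length_cons, List.length_nil] at b3 b4 ⊢
    omega
  have fa := f1 a
  have gc := g1 c
  have hfc : f c ≠ 0 → Hits G x ux c := fun h' => by_contra fun h'' => h' (f0 c h'')
  have hga : g a ≠ 0 → Hits G y uy a := fun h' => by_contra fun h'' => h' (g0 a h'')
  have fc := f1 c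
  have ga := g1 a
  have b3 : pairSum g f W + f c + g a + (if ux ∈ S then 1 else 0) + (if uy ∈ S then 1 else 0) ≤
      W.length := by
    by_cases h1 : f c = 0
    · omega
    · by_cases h2 : g a = 0
      · omega
      · have := b2 (hfc h1) (hga h2)
        rw [if_neg (h.of_hits_c (hfc h1)).1, if_neg (h.mirror.of_hits_c (hga h2)).1]
        omega
  have hind : ∀ u : V, (if u ∈ S then 0 else 1) + (if u ∈ S then 1 else 0) = 1 := by
    intro u; split_ifs <;> rfl
  have i1 := hind ux
  have i2 := hind uy
  rw [h.min.listing.sum_eq f, h.min.listing.sum_eq g, h.min.listing.card_eq]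
  rw [Finset.sum_add_distrib] at hout
  simp only [List.map_cons, List.map_append, List.sum_append, List.map_nil, List.sum_cons,
    List.sum_nil, List.length_cons, List.length_append] at hout ⊢
  omega

end IsArc

end ArcDegree

/-! ### From a dominating cycle to a spine -/

section OddCycle

variable {V : Type*} [Fintype V] {G : SimpleGraph V}

/-- Every three mutually remote edges have degree sum greater than `3 / 2 * (|V| - 3)`. -/
def LargeRemoteDegrees (G : SimpleGraph V) : Prop :=
  ∀ e₁ ∈ G.edgeSet, ∀ e₂ ∈ G.edgeSet, ∀ e₃ ∈ G.edgeSet,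
    G.Remote e₁ e₂ → G.Remote e₁ e₃ → G.Remote e₂ e₃ →
      (3 / 2 : ℝ) * ((Fintype.card V : ℝ) - 3) <
        (G.edgeDegree e₁ : ℝ) + (G.edgeDegree e₂ : ℝ) + (G.edgeDegree e₃ : ℝ)

theorem IsOddConfig.exists_isMinConfig {a c : V} {W Z : List V} (h : IsOddConfig G a c W Z)
    (hE : ¬ G.EvenSpine) (hD : ¬ G.DoubleSpine) : ∃ S a c W Z, IsMinConfig G S a c W Z := by
  classical
  have hlen : ∀ {a c : V} {W Z : List V}, IsOddConfig G a c W Z → Z.length ≤ Fintype.card V := by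
    intro a c W Z h
    have := h.nodup.length_le_card
    simp only [List.length_cons, List.length_append] at this
    omega
  have h1 : ∃ n, ∃ a c W Z, IsOddConfig G a c W Z ∧ W.length = n := ⟨_, a, c, W, Z, h, rfl⟩
  -- Maximality of `Z` is expressed by minimality of the complement `k` of its length.
  have h2 : ∃ k, ∃ a c W Z, IsOddConfig G a c W Z ∧ W.length = Nat.find h1 ∧
      Z.length + k = Fintype.card V := by
    obtain ⟨a, c, W, Z, hc, hW⟩ := Nat.find_spec h1
    exact ⟨Fintype.card V - Z.length, a, c, W, Z, hc, hW, by have := hlen hc; omega⟩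
  obtain ⟨a, c, W, Z, hc, hW, hZ⟩ := Nat.find_spec h2
  refine ⟨{v | v ∈ a :: (W ++ c :: Z)}, a, c, W, Z, hc, ⟨hc.nodup, fun v => Iff.rfl⟩,
    ⟨hE, hD, hc.dom⟩, ?_, ?_⟩
  · intro a' c' W' Z' h'
    rw [hW]
    exact Nat.find_min' h1 ⟨a', c', W', Z', h', rfl⟩
  · intro a' c' W' Z' h' hW'
    have h3 := hlen h'
    have := Nat.find_min' h2 (m := Fintype.card V - Z'.length)
      ⟨a', c', W', Z', h', hW'.trans hW, by omega⟩
    omega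

/-- The ends following the corners `a`, `t`, `c` are at x, d, z and those preceding `c`, `t`, `a` at
y, w, v. The pairs d, z and w, v are bounded from the two orientations of the triangle; the
left-over x, y are the ends of `W`. -/
theorem IsMinConfig.false {S : Set V} {a c : V} {W Z : List V} (h : IsMinConfig G S a c W Z)
    (hG : G.IsKChordal 5) (hdeg : G.LargeRemoteDegrees) : False := by
  obtain ⟨t, ht, hat, htc⟩ := h.exists_common hG
  obtain ⟨A, D, eW⟩ := List.append_of_mem ht
  have hS := h.spineless
  have hT := h.isTri eW hat htc
  have hT' := hT.reflect
  have hlen : W.length = A.length + 1 + D.length := by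
    rw [eW, List.length_append, List.length_cons]; omega
  have hmin : ∀ W' Z', IsOddConfig G a c W' Z' → A.length + 1 + D.length ≤ W'.length :=
    fun W' Z' h' => hlen ▸ h.min _ _ _ _ h'
  have hmin' : ∀ W' Z', IsOddConfig G c a W' Z' →
      D.reverse.length + 1 + A.reverse.length ≤ W'.length := fun W' Z' h' => by
    have := h.min _ _ _ _ h'
    rw [List.length_reverse, List.length_reverse]
    omega
  obtain ⟨x, x', A₁, eA⟩ := hT.exists_cons_cons hS
  obtain ⟨d, d', D₁, eD⟩ := hT.rotate.exists_cons_cons hS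
  obtain ⟨z, z', Z₁, eZ⟩ := hT.rotate.rotate.exists_cons_cons hS
  obtain ⟨y, y', D₂, eD'⟩ := hT'.exists_cons_cons hS
  obtain ⟨w, w', A₂, eA'⟩ := hT'.rotate.exists_cons_cons hS
  obtain ⟨v, v', Z₂, eZ'⟩ := hT'.rotate.rotate.exists_cons_cons hS
  have hW : ∃ W₁, W = x :: x' :: W₁ := ⟨A₁ ++ t :: D, by rw [eW, eA]; simp⟩
  have hWr : ∃ W₁, W.reverse = y :: y' :: W₁ := ⟨D₂ ++ t :: A.reverse, by
    rw [eW, List.reverse_append, List.reverse_cons, eD']; simp⟩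
  rw [eA, eD, eZ] at hT
  rw [eA', eD', eZ'] at hT'
  rw [eA, eD] at hmin
  rw [eA', eD'] at hmin'
  obtain ⟨ux, hx⟩ := exists_isEnd (S := S) hT.rotate.rotate.adj_ends.2
  obtain ⟨ud, hd⟩ := exists_isEnd (S := S) hT.adj_ends.2
  obtain ⟨uz, hz⟩ := exists_isEnd (S := S) hT.rotate.adj_ends.2
  obtain ⟨uy, hy⟩ := exists_isEnd (S := S) hT'.rotate.rotate.adj_ends.2
  obtain ⟨uw, hw⟩ := exists_isEnd (S := S) hT'.adj_ends.2
  obtain ⟨uv, hv⟩ := exists_isEnd (S := S) hT'.rotate.adj_ends.2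
  have d1 := hdeg _ hx.1 _ hd.1 _ hz.1 (hT.rotate.rotate.remote_ends hS hx hd)
    (hT.rotate.remote_ends hS hz hx).symm (hT.remote_ends hS hd hz)
  have d2 := hdeg _ hy.1 _ hw.1 _ hv.1 (hT'.rotate.rotate.remote_ends hS hy hw)
    (hT'.rotate.remote_ends hS hv hy).symm (hT'.remote_ends hS hw hv)
  have s1 := hT.edgeDegree_add_le hS hx hd hz hmin
  have s2 := hT'.edgeDegree_add_le hS hy hw hv hmin'
  have s3 := IsArc.edgeDegree_add_le ⟨h, hW, hWr, hx, hy, hG⟩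
  have r1 : (G.edgeDegree s(d, ud) : ℝ) + G.edgeDegree s(z, uz) + 3 ≤ Fintype.card V := by
    exact_mod_cast s1
  have r2 : (G.edgeDegree s(w, uw) : ℝ) + G.edgeDegree s(v, uv) + 3 ≤ Fintype.card V := by
    exact_mod_cast s2
  have r3 : (G.edgeDegree s(x, ux) : ℝ) + G.edgeDegree s(y, uy) + 3 ≤ Fintype.card V := by
    exact_mod_cast s3
  linarith

/-- A dominating cycle gives a spine. -/
theorem exists_spine_of_dominates (hG : G.IsKChordal 5) (hdeg : G.LargeRemoteDegrees) {u v : V}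
    {l : List V} (hl : G.ListPath u v l) (ha : G.Adj v u) (hn : l.Nodup) (hd : G.Dominates l) :
    G.EvenSpine ∨ G.DoubleSpine := by
  by_contra! hcon
  rcases Nat.even_or_odd l.length with he | ho
  · exact hcon.1 ⟨u, v, l, hl, ha, he, hn, hd⟩
  · obtain ⟨W, rfl⟩ : ∃ W, l = u :: (W ++ [v]) := by
      cases l with
      | nil => exact absurd rfl hl.ne_nil
      | cons x l =>
        obtain rfl := hl.of_cons
        rcases List.eq_nil_or_concat l with rfl | ⟨W, y, rfl⟩
        · have : v = u := hl.of_concat (l := [])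
          exact absurd this ha.ne
        · rw [List.concat_eq_append] at hl ⊢
          have : v = y := hl.of_concat (l := u :: W)
          exact ⟨W, by rw [this]⟩
    -- The closing edge of an odd cycle serves as the chord, with an empty arc `Z`.
    have hc : IsOddConfig G u v W [] := by
      refine ⟨hl, (ListPath.single u).cons ha, ha.symm, ?_, by simp, hn, hd⟩
      rw [Nat.odd_iff] at ho
      simp only [List.length_cons, List.length_append, List.length_nil] at ho
      omega
    obtain ⟨S, a, c, W, Z, h⟩ := hc.exists_isMinConfig hcon.1 hcon.2
    exact h.false hG hdeg

end OddCycle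

/-! ### Cycles that cannot be improved towards a component outside of them -/

section Island

variable {V : Type*} {G : SimpleGraph V} {S K : Set V}

/-- `K` is a nontrivial component outside `S`, and no cycle arises from a cycle through `S` by
a swap that adds a vertex of `K`. -/
structure IsIsland (G : SimpleGraph V) (S K : Set V) : Prop where
  out : ∀ p ∈ K, p ∉ S
  closed : ∀ p ∈ K, ∀ q ∉ S, G.Adj p q → q ∈ K
  nontrivial : ∃ p ∈ K, ∃ q ∈ K, p ≠ q
  conn : ∀ p ∈ K, ∀ q ∈ K, ∃ l, G.ListPath p q l ∧ l.Nodup ∧ ∀ v ∈ l, v ∈ K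
  no_cycle : ∀ (I R C l : List V) (u v : V), Swap G S I R → IsListing S C → G.ListPath u v l →
    G.Adj v u → 3 ≤ l.length → (R ++ l).Perm (I ++ C) → (∃ i ∈ I, i ∈ K) → False

theorem IsIsland.swap_append (hK : IsIsland G S K) {I R P : List V} (h : Swap G S I R)
    (hP : P.Nodup) (hPK : ∀ v ∈ P, v ∈ K) (hI : ∀ i ∈ I, i ∉ K) : Swap G S (P ++ I) R := by
  refine ⟨?_, ?_, h.rem⟩
  · rw [List.nodup_append]
    refine ⟨hP, h.nodup, ?_⟩
    rintro p hp i hi rfl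
    exact hI p hi (hPK p hp)
  · intro i hi
    rcases List.mem_append.1 hi with hi | hi
    exacts [hK.out _ (hPK i hi), h.out i hi]

/-- Two arcs that form a cycle through `S` and whose last vertices are joined by a path in `K`. -/
structure IsTwoArcs (G : SimpleGraph V) (S K : Set V) (x x' b y y' a : V) (M N P : List V) :
    Prop where
  pathM : G.ListPath x' b M
  pathN : G.ListPath y' a N
  adjx : G.Adj x x'
  adjy : G.Adj y y'
  ax : G.Adj a x
  bry : G.Adj b y
  listing : IsListing S (x :: (M ++ y :: N))
  nodup : P.Nodup
  sub : ∀ v ∈ P, v ∈ K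
  link : ∃ p q, G.Adj b p ∧ G.ListPath p q P ∧ G.Adj q a

namespace IsTwoArcs

variable {x x' b y y' a ux uy : V} {M N P : List V} {ℓ ℓ' : ℕ} {u u' p q : V}
  {E I R E' I' R' : List V}

theorem symm (h : IsTwoArcs G S K x x' b y y' a M N P) :
    IsTwoArcs G S K y y' a x x' b N M P.reverse := by
  obtain ⟨p, q, hp, hP, hq⟩ := h.link
  refine ⟨h.pathN, h.pathM, h.adjy, h.adjx, h.bry, h.ax, h.listing.perm ?_, by simpa using h.nodup,
    by simpa using h.sub, q, p, hq.symm, hP.reverse, hp.symm⟩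
  classical
  refine List.perm_iff_count.2 fun z => ?_
  simp only [List.count_append, List.count_cons]
  ring

variable (hK : IsIsland G S K) (h : IsTwoArcs G S K x x' b y y' a M N P)
include hK h

/-- The cycle would run along both arcs to `a`, then through K to `k` and back to `u`. -/
theorem not_adj_island (hP : IsPrefix G S x x' ℓ u E I R) (hI : ∀ i ∈ I, i ∉ K) {k : V}
    (hk : k ∈ K) : ¬ G.Adj u k := by
  intro huk
  obtain ⟨p, q, -, hPq, hqa⟩ := h.link
  obtain ⟨Q, hQ, hQn, hQK⟩ := hK.conn q (h.sub _ hPq.last_mem) k hk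
  have h1 := (((hP.path _ _ h.pathM).append h.bry (h.pathN.cons h.adjy)).append hqa.symm hQ)
  have l1 := List.length_pos_of_ne_nil h.pathM.ne_nil
  have l2 := List.length_pos_of_ne_nil h.pathN.ne_nil
  refine hK.no_cycle (Q ++ I) R _ _ _ _ (hK.swap_append hP.swap hQn hQK hI) h.listing h1 huk.symm
    ?_ ?_ ⟨k, by simp [hQ.last_mem], hk⟩
  · simp only [List.length_append, List.length_cons]; omega
  · classical
    refine List.perm_iff_count.2 fun w => ?_
    have e2 := hP.count w
    simp only [List.count_append, List.count_cons, List.count_nil] at e2 ⊢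
    linarith

theorem end_notMem (hx : IsEnd G S x x' ux) : ux ∉ K := fun hu =>
  h.not_adj_island hK (isPrefix_zero h.adjx) (by simp) hu hx.1

section Two

variable (hP : IsPrefix G S x x' ℓ u E I R) (hP' : IsPrefix G S y y' ℓ' u' E' I' R')
  (hsw : Swap G S (I ++ I') (R ++ R')) (hI : ∀ i ∈ I ++ I', i ∉ K)
include hP hP' hsw hI

theorem not_adj : ¬ G.Adj u' u := by
  intro ha
  obtain ⟨p, q, hp, hPq, hq⟩ := h.link
  have h1 := ((hP.path _ _ h.pathM).append hp hPq).append hq (hP'.path _ _ h.pathN).reverse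
  have l1 := List.length_pos_of_ne_nil h.pathM.ne_nil
  have l2 := List.length_pos_of_ne_nil h.pathN.ne_nil
  have l3 := List.length_pos_of_ne_nil hPq.ne_nil
  refine hK.no_cycle (P ++ (I ++ I')) (R ++ R') _ _ _ _ (hK.swap_append hsw h.nodup h.sub hI)
    h.listing h1 ha ?_ ?_ ⟨p, by simp [hPq.head_mem], h.sub p hPq.head_mem⟩
  · simp only [List.length_append, List.length_reverse]; omega
  · classical
    refine List.perm_iff_count.2 fun w => ?_
    have e2 := hP.count w
    have e3 := hP'.count w
    simp only [List.count_append, List.count_cons, List.count_reverse, List.count_nil] at e2 e3 ⊢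
    linarith

theorem not_common {w : V} (hw : w ∉ S) (hwI : w ∉ I ++ I') (hu : G.Adj u w) :
    ¬ G.Adj u' w := by
  intro ha
  have hI1 : ∀ i ∈ I, i ∉ K := fun i hi => hI i (by simp [hi])
  have hwK : w ∉ K := fun hk => h.not_adj_island hK hP hI1 hk hu
  obtain ⟨p, q, hp, hPq, hq⟩ := h.link
  have h1 := (((hP.path _ _ h.pathM).append hp hPq).append hq
    (hP'.path _ _ h.pathN).reverse).concat ha
  have l1 := List.length_pos_of_ne_nil h.pathM.ne_nil
  have l2 := List.length_pos_of_ne_nil h.pathN.ne_nil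
  have l3 := List.length_pos_of_ne_nil hPq.ne_nil
  refine hK.no_cycle (P ++ (w :: (I ++ I'))) (R ++ R') _ _ _ _
    (hK.swap_append (hsw.insert hw hwI) h.nodup h.sub ?_)
    h.listing h1 hu.symm ?_ ?_ ⟨p, by simp [hPq.head_mem], h.sub p hPq.head_mem⟩
  · intro i hi
    rcases List.mem_cons.1 hi with rfl | hi
    exacts [hwK, hI i hi]
  · simp only [List.length_append, List.length_reverse]; omega
  · classical
    refine List.perm_iff_count.2 fun w => ?_
    have e2 := hP.count w
    have e3 := hP'.count w
    simp only [List.count_append, List.count_cons, List.count_reverse, List.count_nil] at e2 e3 ⊢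
    linarith

/-- The path M, P and N reversed can be cut between `p` and `q` and reconnected at `u` and `u'` to a
cycle that contains vertices of K. -/
theorem no_cross {k₁ k₂ : List V} (e : M ++ (P ++ N.reverse) = k₁ ++ p :: q :: k₂)
    (hp : G.Adj u' p) : ¬ G.Adj u q := by
  intro hq
  obtain ⟨r, s, hr, hPq, hs⟩ := h.link
  have h0 := h.pathM.append hr (hPq.append hs h.pathN.reverse)
  rw [e] at h0
  have h1 := (hP.path _ _ h0.split.1).append hp.symm
    (hP'.path _ _ (by simpa using h0.split.2.2.reverse))
  have l1 := List.length_pos_of_ne_nil h.pathM.ne_nil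
  have l2 := List.length_pos_of_ne_nil h.pathN.ne_nil
  have l3 := List.length_pos_of_ne_nil hPq.ne_nil
  refine hK.no_cycle (P ++ (I ++ I')) (R ++ R') _ _ _ _ (hK.swap_append hsw h.nodup h.sub hI)
    h.listing h1 hq.symm ?_ ?_ ⟨r, by simp [hPq.head_mem], h.sub r hPq.head_mem⟩
  · have := congrArg List.length e
    simp only [List.length_append, List.length_reverse, List.length_cons, List.length_nil] at this ⊢
    omega
  · classical
    refine List.perm_iff_count.2 fun w => ?_
    have e1 := congrArg (List.count w) e
    have e2 := hP.count w
    have e3 := hP'.count w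
    simp only [List.count_append, List.count_cons, List.count_reverse, List.count_nil]
      at e1 e2 e3 ⊢
    linarith

end Two

variable (hx : IsEnd G S x x' ux) (hy : IsEnd G S y y' uy)

theorem not_adj_zero : ¬ G.Adj x y := fun ha =>
  h.not_adj hK (isPrefix_zero h.adjx) (isPrefix_zero h.adjy) Swap.nil (by simp) ha.symm

omit hK in
theorem nodup_facts : x ∉ M ∧ x ∉ N ∧ y ∉ M ∧ y ∉ N ∧ x ≠ y ∧ ∀ v ∈ M, v ∉ N := by
  have hn := h.listing.1
  simp only [List.nodup_cons, List.mem_append, List.mem_cons, not_or, List.nodup_append] at hn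
  exact ⟨hn.1.1, hn.1.2.2, fun h' => hn.2.2.2 y h' y (Or.inl rfl) rfl, hn.2.2.1.1, hn.1.2.1,
    fun v hv hv' => hn.2.2.2 v hv v (Or.inr hv') rfl⟩

include hx hy

theorem end_ne_end : ux ≠ uy := by
  rintro rfl
  by_cases hu : ux ∈ S
  · have h1 := hx.2.resolve_left (fun h' => h' hu)
    have h2 := hy.2.resolve_left (fun h' => h' hu)
    have h3 := h.pathM.head_mem
    have h4 := h.pathN.head_mem
    rw [← h1.1] at h3
    rw [← h2.1] at h4
    exact h.nodup_facts.2.2.2.2.2 _ h3 h4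
  · exact h.not_common hK (isPrefix_zero h.adjx) (isPrefix_zero h.adjy) Swap.nil (by simp) hu
      (by simp) hx.1 hy.1

theorem swap_ends (hP : IsPrefix G S x x' ℓ u E I R) (hP' : IsPrefix G S y y' ℓ' u' E' I' R')
    (hI : ∀ i ∈ I, i = ux) (hI' : ∀ i ∈ I', i = uy) :
    Swap G S (I ++ I') (R ++ R') ∧ ∀ i ∈ I ++ I', i ∉ K := by
  refine ⟨hP.swap_two hP' (fun i hi hi' => h.end_ne_end hK hx hy
    ((hI i hi).symm.trans (hI' i hi'))) (h.not_adj_zero hK), fun i hi => ?_⟩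
  rcases List.mem_append.1 hi with hi | hi
  · exact hI i hi ▸ h.end_notMem hK hx
  · exact hI' i hi ▸ h.symm.end_notMem hK hy

theorem remote_ends : G.Remote s(x, ux) s(y, uy) := by
  have hm := h.listing.2
  obtain ⟨n1, n2, n3, n4, n5, n6⟩ := h.nodup_facts
  obtain ⟨E, I, R, hP⟩ := hx.isPrefix h.adjx
  obtain ⟨E', I', R', hP'⟩ := hy.isPrefix h.adjy
  have s1 := h.swap_ends hK hx hy (isPrefix_zero h.adjx) hP' (by simp) hP'.mem
  have s2 := h.swap_ends hK hx hy hP (isPrefix_zero h.adjy) hP.mem (by simp)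
  have s3 := h.swap_ends hK hx hy hP hP' hP.mem hP'.mem
  refine remote_mk ⟨n5, h.not_adj_zero hK⟩ ⟨?_, fun ha => ?_⟩ ⟨?_, fun ha => ?_⟩
    ⟨h.end_ne_end hK hx hy, fun ha => ?_⟩
  · rintro rfl
    have h1 := hy.2.resolve_left (fun h' => h' ((hm _).2 (by simp)))
    exact n2 (h1.1 ▸ h.pathN.head_mem)
  · exact h.not_adj hK (isPrefix_zero h.adjx) hP' s1.1 s1.2 ha.symm
  · rintro rfl
    have h1 := hx.2.resolve_left (fun h' => h' ((hm _).2 (by simp)))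
    exact n3 (h1.1 ▸ h.pathM.head_mem)
  · exact h.not_adj hK hP (isPrefix_zero h.adjy) s2.1 s2.2 ha.symm
  · exact h.not_adj hK hP hP' s3.1 s3.2 ha.symm

theorem not_hits_of_notMem {w : V} (hw : w ∉ S) (h₁ : Hits G x ux w) : ¬ Hits G y uy w := by
  intro h₂
  obtain ⟨ℓ, u, E, I, R, hP, -, hI, hu⟩ := hx.exists_of_hits h.adjx h₁
  obtain ⟨ℓ', u', E', I', R', hP', -, hI', hu'⟩ := hy.exists_of_hits h.adjy h₂
  obtain ⟨s1, s2⟩ := h.swap_ends hK hx hy hP hP' hI hI'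
  refine h.not_common hK hP hP' s1 s2 hw ?_ hu hu'
  rw [List.mem_append]
  rintro (hi | hi)
  · exact h₁.2.1 (hI _ hi)
  · exact h₂.2.1 (hI' _ hi)

theorem not_hits_pair {k₁ k₂ : List V} (e : M ++ (P ++ N.reverse) = k₁ ++ p :: q :: k₂)
    (h₂ : Hits G y uy p) : ¬ Hits G x ux q := by
  intro h₁
  obtain ⟨ℓ, u, E, I, R, hP, -, hI, hu⟩ := hx.exists_of_hits h.adjx h₁
  obtain ⟨ℓ', u', E', I', R', hP', -, hI', hu'⟩ := hy.exists_of_hits h.adjy h₂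
  obtain ⟨s1, s2⟩ := h.swap_ends hK hx hy hP hP' hI hI'
  exact h.no_cross hK hP hP' s1 s2 e hu' hu

omit hy in
theorem not_hits_island {k : V} (hk : k ∈ K) : ¬ Hits G x ux k := by
  intro h₁
  obtain ⟨ℓ, u, E, I, R, hP, -, hI, hu⟩ := hx.exists_of_hits h.adjx h₁
  exact h.not_adj_island hK hP (fun i hi => hI i hi ▸ h.end_notMem hK hx) hk hu

open Classical in
-- The pairs on the two arcs leave at most |S| for the hits in S. Two further units are saved by the
-- end edges, and two by vertices of K, which are hit from neither end.
theorem edgeDegree_add_le [Fintype V] :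
    G.edgeDegree s(x, ux) + G.edgeDegree s(y, uy) + 4 ≤ Fintype.card V := by
  have rxy := h.remote_ends hK hx hy
  rw [edgeDegree_eq_sum, edgeDegree_eq_sum]
  set f : V → ℕ := fun v => if Hits G x ux v then 1 else 0 with hf
  set g : V → ℕ := fun v => if Hits G y uy v then 1 else 0 with hg
  have f1 : ∀ v, f v ≤ 1 := fun v => by simp only [hf]; split_ifs <;> omega
  have g1 : ∀ v, g v ≤ 1 := fun v => by simp only [hg]; split_ifs <;> omega
  have f0 : ∀ v, ¬ Hits G x ux v → f v = 0 := fun v hv => if_neg hv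
  have g0 : ∀ v, ¬ Hits G y uy v → g v = 0 := fun v hv => if_neg hv
  have pair : ∀ p q, ¬ (Hits G y uy p ∧ Hits G x ux q) → g p + f q ≤ 1 := by
    intro p q hpq
    simp only [hf, hg]
    split_ifs <;> simp_all
  have fx := f0 x not_hits_left
  have fux := f0 ux not_hits_right
  have fy := f0 y rxy.not_hits.1
  have fuy := f0 uy rxy.not_hits.2
  have gy := g0 y not_hits_left
  have guy := g0 uy not_hits_right
  have gx := g0 x rxy.symm.not_hits.1
  have gux := g0 ux rxy.symm.not_hits.2
  obtain ⟨k, hk, k', hk', hkk⟩ := hK.nontrivial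
  have hnx := h.end_notMem hK hx
  have hny := h.symm.end_notMem hK hy
  have hk0 : ∀ k ∈ K, f k + g k = 0 := fun k hk => by
    have := f0 k (h.not_hits_island hK hx hk)
    have := g0 k (h.symm.not_hits_island hK hy hk)
    omega
  have hout := sum_outside_le (S := S) (h := fun v => f v + g v) (P := [ux, uy, k, k']) ?_ ?_ ?_
  rotate_left
  · intro w hw
    rw [add_comm]
    exact pair w w fun hpq => h.not_hits_of_notMem hK hx hy hw hpq.2 hpq.1
  · have h1 := h.end_ne_end hK hx hy
    have h2 : ∀ {u k}, u ∉ K → k ∈ K → u ≠ k := fun hu hk e => hu (e ▸ hk)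
    simp [h1, hkk, h2 hnx hk, h2 hnx hk', h2 hny hk, h2 hny hk']
  · intro w hw _
    show f w + g w = 0
    simp only [List.mem_cons, List.not_mem_nil, or_false] at hw
    rcases hw with rfl | rfl | rfl | rfl
    · omega
    · omega
    · exact hk0 _ hk
    · exact hk0 _ hk'
  obtain ⟨M', eM⟩ : ∃ M', M = x' :: M' := by
    have := h.pathM
    cases hM : M with
    | nil => exact absurd hM this.ne_nil
    | cons r k => rw [hM] at this; exact ⟨k, by rw [this.of_cons]⟩
  obtain ⟨N', eN⟩ : ∃ N', N = y' :: N' := by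
    have := h.pathN
    cases hM : N with
    | nil => exact absurd hM this.ne_nil
    | cons r k => rw [hM] at this; exact ⟨k, by rw [this.of_cons]⟩
  have sumM := (h.pathM.cons h.adjx).sum_eq (f := f) (g := g)
  have sumN := (h.pathN.cons h.adjy).reverse.sum_eq (f := f) (g := g)
  have bM : pairSum g f M ≤ _ := pairSum_le fun k₁ p q k₂ e =>
    pair p q fun hpq => h.not_hits_pair hK hx hy (k₁ := k₁) (k₂ := k₂ ++ (P ++ N.reverse))
      (by rw [e]; simp) hpq.1 hpq.2
  have bN : pairSum g f N.reverse ≤ _ := pairSum_le fun k₁ p q k₂ e =>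
    pair p q fun hpq => h.not_hits_pair hK hx hy (k₁ := M ++ (P ++ k₁)) (k₂ := k₂)
      (by rw [e]; simp) hpq.1 hpq.2
  have eN' : (y :: N).reverse = N'.reverse ++ y' :: [y] := by rw [eN]; simp
  have e2 : pairSum g f [y] = 0 := by simp [pairSum]
  have e3 : N.reverse = N'.reverse ++ [y'] := by rw [eN]; simp
  have pM : pairSum g f (x :: M) = g x + f x' + pairSum g f M := by rw [eM]; rfl
  have pN : pairSum g f (y :: N).reverse = pairSum g f N.reverse + (g y' + f y) := by
    rw [eN', pairSum_append, pairSum_cons_cons, e2, e3]; rfl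
  have sx : f x' + (if ux ∈ S then 1 else 0) ≤ 1 := by
    have := f1 x'
    split_ifs with hu
    · have h1 := hx.2.resolve_left (fun h' => h' hu)
      rw [← h1.1]
      omega
    · omega
  have sy : g y' + (if uy ∈ S then 1 else 0) ≤ 1 := by
    have := g1 y'
    split_ifs with hu
    · have h1 := hy.2.resolve_left (fun h' => h' hu)
      rw [← h1.1]
      omega
    · omega
  have hind : ∀ u : V, (if u ∈ S then 0 else 1) + (if u ∈ S then 1 else 0) = 1 := by
    intro u; split_ifs <;> rfl
  have i1 := hind ux
  have i2 := hind uy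
  have gb := g1 b
  have fa := f1 a
  have lM := congrArg List.length eM
  have lN := congrArg List.length eN
  rw [h.listing.sum_eq f, h.listing.sum_eq g, h.listing.card_eq]
  rw [Finset.sum_add_distrib] at hout
  rw [List.map_reverse, List.map_reverse, List.sum_reverse, List.sum_reverse, pN] at sumN
  rw [pM] at sumM
  simp only [List.map_cons, List.map_append, List.sum_append, List.map_nil, List.sum_cons,
    List.sum_nil, List.length_cons, List.length_append, List.length_reverse, if_neg (hK.out _ hk),
    if_neg (hK.out _ hk')] at hout sumM sumN bM bN lM lN ⊢
  omega

end IsTwoArcs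

end Island

/-! ### A dominating cycle -/

theorem Walk.listPath_support {V : Type*} {G : SimpleGraph V} {u v : V} (p : G.Walk u v) :
    G.ListPath u v p.support := by
  refine ⟨p.isChain_adj_support, ?_, ?_⟩
  · rw [List.head?_eq_some_head p.support_ne_nil, Walk.head_support]
  · rw [List.getLast?_eq_some_getLast p.support_ne_nil, Walk.getLast_support]

theorem ListPath.exists_nodup {V : Type*} {G : SimpleGraph V} {u v : V} {l : List V}
    (h : G.ListPath u v l) : ∃ l', G.ListPath u v l' ∧ l'.Nodup ∧ ∀ x ∈ l', x ∈ l := by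
  classical
  obtain ⟨p, rfl⟩ := h.exists_walk
  exact ⟨p.bypass.support, p.bypass.listPath_support, p.bypass_isPath.support_nodup,
    p.support_bypass_subset_support⟩

/-! ### Three attachments of an outside component contradict the degree condition -/

section ThreeArcs

variable {V : Type*} {G : SimpleGraph V} {S K : Set V}

/-- A cycle through `S`, divided into three arcs at vertices with neighbours in `K`. -/
structure IsThreeArcs (G : SimpleGraph V) (S K : Set V) (a b c : V) (A B Z : List V) : Prop where
  pathA : G.ListPath a b (a :: (A ++ [b]))
  pathB : G.ListPath b c (b :: (B ++ [c]))
  pathZ : G.ListPath c a (c :: (Z ++ [a]))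
  listing : IsListing S (a :: (A ++ b :: (B ++ c :: Z)))
  linkA : ∃ p ∈ K, G.Adj a p
  linkB : ∃ p ∈ K, G.Adj b p
  linkC : ∃ p ∈ K, G.Adj c p

namespace IsThreeArcs

variable {a b c : V} {A B Z : List V}

theorem rotate (h : IsThreeArcs G S K a b c A B Z) : IsThreeArcs G S K b c a B Z A where
  pathA := h.pathB
  pathB := h.pathZ
  pathZ := h.pathA
  listing := h.listing.perm <| by
    classical
    refine List.perm_iff_count.2 fun z => ?_
    simp only [List.count_append, List.count_cons]
    ring
  linkA := h.linkB
  linkB := h.linkC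
  linkC := h.linkA

theorem exists_link (hK : IsIsland G S K) (h : IsThreeArcs G S K a b c A B Z) :
    ∃ P, P.Nodup ∧ (∀ v ∈ P, v ∈ K) ∧ ∃ p q, G.Adj b p ∧ G.ListPath p q P ∧ G.Adj q a := by
  obtain ⟨q, hq, haq⟩ := h.linkA
  obtain ⟨p, hp, hbp⟩ := h.linkB
  obtain ⟨P, h1, h2, h3⟩ := hK.conn p hp q hq
  exact ⟨P, h2, h3, p, q, hbp, h1, haq.symm⟩

theorem ne_nil (hK : IsIsland G S K) (h : IsThreeArcs G S K a b c A B Z) : A ≠ [] := by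
  rintro rfl
  obtain ⟨P, hP, hPK, p, q, hp, hPq, hq⟩ := h.exists_link hK
  have h1 := (ListPath.join (l := b :: B) (by simpa using h.pathB) h.pathZ).append hq.symm
    hPq.reverse
  refine hK.no_cycle P [] _ _ _ _ (by simpa using hK.swap_append Swap.nil hP hPK (by simp))
    h.listing h1 hp.symm (by simp; omega) ?_ ⟨p, hPq.head_mem, hPK _ hPq.head_mem⟩
  classical
  refine List.perm_iff_count.2 fun z => ?_
  simp only [List.count_append, List.count_cons, List.count_nil, List.count_reverse]
  ring

theorem exists_cons (hK : IsIsland G S K) (h : IsThreeArcs G S K a b c A B Z) :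
    ∃ x x' A', A = x :: A' ∧ G.Adj a x ∧ G.Adj x x' ∧ G.ListPath x' b (A' ++ [b]) := by
  obtain ⟨x, A', rfl⟩ := List.exists_cons_of_ne_nil (h.ne_nil hK)
  have h1 := h.pathA.uncons
  obtain ⟨x', hx, hx'⟩ := h1.2.exists_tail
  exact ⟨x, x', A', rfl, h1.1, hx, hx'⟩

theorem exists_isTwoArcs {x x' y y' : V} {A' B' : List V} (hK : IsIsland G S K)
    (h : IsThreeArcs G S K a b c (x :: A') (y :: B') Z) (hx : G.Adj x x')
    (hA : G.ListPath x' b (A' ++ [b])) (hy : G.Adj y y') (hB : G.ListPath y' c (B' ++ [c])) :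
    ∃ M N P, IsTwoArcs G S K x x' b y y' a M N P := by
  obtain ⟨P, hP, hPK, hl⟩ := h.exists_link hK
  refine ⟨A' ++ [b], B' ++ c :: (Z ++ [a]), P, hA, hB.join h.pathZ, hx, hy, h.pathA.uncons.1,
    h.pathB.uncons.1, h.listing.perm ?_, hP, hPK, hl⟩
  classical
  refine List.perm_iff_count.2 fun z => ?_
  simp only [List.count_append, List.count_cons, List.count_nil]
  ring

/-- Adding the bounds |V| - 4 for the three pairs bounds the sum of the three degrees by 3(|V| -
4)/2, below the required 3(|V| - 3)/2. -/
theorem not_largeRemoteDegrees [Fintype V] (hK : IsIsland G S K)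
    (h : IsThreeArcs G S K a b c A B Z) (hdeg : G.LargeRemoteDegrees) : False := by
  obtain ⟨x, x', A', rfl, -, hx, hA⟩ := h.exists_cons hK
  obtain ⟨y, y', B', rfl, -, hy, hB⟩ := h.rotate.exists_cons hK
  obtain ⟨z, z', Z', rfl, -, hz, hZ⟩ := h.rotate.rotate.exists_cons hK
  obtain ⟨M₁, N₁, P₁, h₁⟩ := h.exists_isTwoArcs hK hx hA hy hB
  obtain ⟨M₂, N₂, P₂, h₂⟩ := h.rotate.exists_isTwoArcs hK hy hB hz hZ
  obtain ⟨M₃, N₃, P₃, h₃⟩ := h.rotate.rotate.exists_isTwoArcs hK hz hZ hx hA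
  obtain ⟨ux, hux⟩ := exists_isEnd (S := S) hx
  obtain ⟨uy, huy⟩ := exists_isEnd (S := S) hy
  obtain ⟨uz, huz⟩ := exists_isEnd (S := S) hz
  have key := hdeg s(x, ux) hux.1 s(y, uy) huy.1 s(z, uz) huz.1 (h₁.remote_ends hK hux huy)
    (h₃.remote_ends hK huz hux).symm (h₂.remote_ends hK huy huz)
  have e₁ := h₁.edgeDegree_add_le hK hux huy
  have e₂ := h₂.edgeDegree_add_le hK huy huz
  have e₃ := h₃.edgeDegree_add_le hK huz hux
  rify at e₁ e₂ e₃
  linarith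

end IsThreeArcs

end ThreeArcs

/-! ### Existence of a dominating cycle -/

/-- `l` lists the vertices of a cycle of `G` in cyclic order. -/
def IsCycleList {V : Type*} (G : SimpleGraph V) (l : List V) : Prop :=
  ∃ u v, G.ListPath u v l ∧ G.Adj v u ∧ l.Nodup ∧ 3 ≤ l.length

section DominatingCycle

variable {V : Type*} {G : SimpleGraph V}

theorem IsCycleList.rotate {a : V} {l : List V} (h : G.IsCycleList l) (ha : a ∈ l) :
    ∃ v k, G.ListPath a v (a :: k) ∧ G.Adj v a ∧ l.Perm (a :: k) := by
  obtain ⟨u, v, hl, hvu, -, -⟩ := h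
  obtain ⟨s, t, rfl⟩ := List.append_of_mem ha
  cases s with
  | nil =>
    obtain rfl := hl.of_cons
    exact ⟨v, t, hl, hvu, List.Perm.refl _⟩
  | cons r s =>
    obtain ⟨y, z, h1, h2, h3⟩ := hl.split_append (by simp) (by simp)
    obtain rfl := h3.of_cons
    exact ⟨y, t ++ r :: s, by simpa using h3.append hvu h1, h2, List.perm_append_comm⟩

theorem IsCycleList.exists_isThreeArcs {S K : Set V} {l : List V} (h : G.IsCycleList l)
    (hS : ∀ v, v ∈ S ↔ v ∈ l) {a b c : V} (ha : a ∈ l) (hb : b ∈ l) (hc : c ∈ l)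
    (hab : a ≠ b) (hac : a ≠ c) (hbc : b ≠ c) (hKa : ∃ p ∈ K, G.Adj a p)
    (hKb : ∃ p ∈ K, G.Adj b p) (hKc : ∃ p ∈ K, G.Adj c p) :
    ∃ a b c A B Z, IsThreeArcs G S K a b c A B Z := by
  obtain ⟨v, k, hk, hva, hp⟩ := h.rotate ha
  have hL : IsListing S (a :: k) :=
    IsListing.perm ⟨h.choose_spec.choose_spec.2.2.1, hS⟩ hp
  have key : ∀ b c, (∃ p ∈ K, G.Adj b p) → (∃ p ∈ K, G.Adj c p) →
      (∃ A B Z, k = A ++ b :: (B ++ c :: Z)) → ∃ a b c A B Z, IsThreeArcs G S K a b c A B Z := by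
    rintro b c hKb hKc ⟨A, B, Z, rfl⟩
    have h1 := hk.split_at (l₁ := a :: A)
    have h2 := h1.2.split_at (l₁ := b :: B)
    exact ⟨a, b, c, A, B, Z, by simpa using h1.1, by simpa using h2.1,
      by simpa using h2.2.concat hva, hL, hKa, hKb, hKc⟩
  have hb' : b ∈ k := by simpa [hab.symm] using hp.mem_iff.1 hb
  have hc' : c ∈ k := by simpa [hac.symm] using hp.mem_iff.1 hc
  rcases exists_append_of_mem_of_ne hb' hc' hbc with h | h
  exacts [key b c hKb hKc h, key c b hKc hKb h]

/-- The vertices that can be reached from `p` outside of `S`. -/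
def outerComponent (G : SimpleGraph V) (S : Set V) (p : V) : Set V :=
  {q | ∃ l, G.ListPath p q l ∧ ∀ v ∈ l, v ∉ S}

theorem mem_outerComponent_of_listPath {S : Set V} {p q r : V} {l : List V}
    (hq : q ∈ outerComponent G S p) (hl : G.ListPath q r l) (h : ∀ v ∈ l, v ∉ S) :
    r ∈ outerComponent G S p := by
  obtain ⟨m, hm, hmS⟩ := hq
  cases hl' : l with
  | nil => exact absurd hl' hl.ne_nil
  | cons y k =>
    subst hl'
    obtain rfl := hl.of_cons
    cases k with
    | nil =>
      obtain rfl := hl.of_concat (l := [])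
      exact ⟨m, hm, hmS⟩
    | cons z k =>
      obtain ⟨h1, h2⟩ := hl.uncons
      refine ⟨m ++ z :: k, hm.append h1 h2, fun v hv => ?_⟩
      rcases List.mem_append.1 hv with hv | hv
      exacts [hmS v hv, h v (List.mem_cons_of_mem _ hv)]

theorem mem_outerComponent_symm {S : Set V} {p q : V} (hq : q ∈ outerComponent G S p) :
    p ∈ outerComponent G S q := by
  obtain ⟨m, hm, hmS⟩ := hq
  exact ⟨m.reverse, hm.reverse, by simpa using hmS⟩

theorem outerComponent_conn {S : Set V} {o p q : V} (hp : p ∈ outerComponent G S o)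
    (hq : q ∈ outerComponent G S o) :
    ∃ l, G.ListPath p q l ∧ l.Nodup ∧ ∀ v ∈ l, v ∈ outerComponent G S o := by
  obtain ⟨m, hm, hmS⟩ := hq
  obtain ⟨k, hk, hkS⟩ := mem_outerComponent_of_listPath (mem_outerComponent_symm hp) hm hmS
  obtain ⟨l, hl, hn, hlk⟩ := hk.exists_nodup
  refine ⟨l, hl, hn, fun v hv => ?_⟩
  obtain ⟨s, t, rfl⟩ := List.append_of_mem hv
  refine mem_outerComponent_of_listPath hp hl.split_at.1 fun w hw => hkS w (hlk w ?_)
  simp only [List.mem_append, List.mem_cons, List.not_mem_nil, or_false] at hw ⊢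
  tauto

/-- The pairs of adjacent vertices that are not on the list `l`. -/
def outerDarts (G : SimpleGraph V) (l : List V) : Set (V × V) :=
  {e | e.1 ∉ l ∧ e.2 ∉ l ∧ G.Adj e.1 e.2}

/-- A swap creates no undominated edge. Adding a vertex of the component dominates an edge that was
not dominated before, so a cycle obtained in this way would contradict minimality. -/
theorem isIsland_outerComponent [Finite V] {C : List V}
    (hmin : ∀ l, G.IsCycleList l → (G.outerDarts C).ncard ≤ (G.outerDarts l).ncard) {o q : V}
    (ho : o ∉ C) (hq : q ∉ C) (hoq : G.Adj o q) :
    IsIsland G {v | v ∈ C} (outerComponent G {v | v ∈ C} o) := by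
  set S : Set V := {v | v ∈ C} with hS
  have hoK : o ∈ outerComponent G S o := ⟨[o], .single o, by simpa [hS] using ho⟩
  have hout : ∀ p ∈ outerComponent G S o, p ∉ S := fun p ⟨l, hl, h⟩ => h p hl.last_mem
  have hclosed : ∀ p ∈ outerComponent G S o, ∀ q ∉ S, G.Adj p q → q ∈ outerComponent G S o :=
    fun p hp q hq hpq => mem_outerComponent_of_listPath hp ((ListPath.single p).concat hpq)
      (by simp [hout p hp, hq])
  refine ⟨hout, hclosed, ⟨o, hoK, q, hclosed o hoK q hq hoq, hoq.ne⟩,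
    fun p hp q hq => outerComponent_conn hp hq, ?_⟩
  rintro I R C' l u v hs hL hl hvu hlen hperm ⟨i, hi, hiK⟩
  have hn : (I ++ C').Nodup := by
    rw [List.nodup_append]
    refine ⟨hs.nodup, hL.1, ?_⟩
    rintro x hx y hy rfl
    exact hs.out _ hx ((hL.2 _).2 hy)
  have hnl := List.nodup_append.1 (hperm.nodup_iff.2 hn)
  refine absurd (hmin l ⟨u, v, hl, hvu, hnl.2.1, hlen⟩) (not_le.2 ?_)
  have hmem : ∀ x ∈ S, x ∉ l → x ∈ R := fun x hx hxl =>
    (List.mem_append.1 (hperm.mem_iff.2 (List.mem_append_right _ ((hL.2 x).1 hx)))).resolve_right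
      hxl
  have key : ∀ x y, x ∉ l → y ∉ l → G.Adj x y → x ∉ S := fun x y hx hy hxy hxS => by
    have h1 := hs.rem x (hmem x hxS hx) y hxy
    exact h1.2 (hmem y h1.1 hy)
  have hsub : G.outerDarts l ⊆ G.outerDarts C := fun e he =>
    ⟨key _ _ he.1 he.2.1 he.2.2, key _ _ he.2.1 he.1 he.2.2.symm, he.2.2⟩
  obtain ⟨j, hj, hij⟩ : ∃ j, j ∉ S ∧ G.Adj i j := by
    by_cases hio : i = o
    · exact ⟨q, hq, hio ▸ hoq⟩
    · obtain ⟨m, hm, hmS⟩ := mem_outerComponent_symm hiK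
      match m, hm, hmS with
      | [], hm, _ => exact absurd rfl hm.ne_nil
      | [x], hm, _ =>
        obtain rfl := hm.of_cons
        exact absurd (hm.of_concat (l := [])).symm hio
      | x :: y :: m, hm, hmS =>
        obtain rfl := hm.of_cons
        exact ⟨y, hmS y (by simp), hm.uncons.1⟩
  have hil : i ∈ l := (List.mem_append.1 (hperm.mem_iff.2 (List.mem_append_left _ hi))).resolve_left
    fun hR => hj (hs.rem i hR j hij).1
  refine Set.ncard_lt_ncard ⟨hsub, fun h => ?_⟩ (Set.toFinite _)
  exact (h (show (i, j) ∈ G.outerDarts C from ⟨hout i hiK, hj, hij⟩)).1 hil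

variable [Fintype V]

/-- All neighbours of the first vertex of a longest path lie on the path, and one of them other than
the second vertex closes a cycle. -/
theorem IsTough.exists_isCycleList {ε : ℝ} (hε : 0 < ε) (h : G.IsTough (1 + ε))
    (hV : 4 ≤ Fintype.card V) : ∃ l, G.IsCycleList l := by
  classical
  let Q : ℕ → Prop := fun n => ∃ u v l, G.ListPath u v l ∧ l.Nodup ∧ l.length = n
  have hQ : ∃ n ≤ Fintype.card V, Q n := by
    obtain ⟨o⟩ : Nonempty V := Fintype.card_pos_iff.1 (by omega)
    exact ⟨1, by omega, o, o, [o], .single o, by simp, rfl⟩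
  obtain ⟨n₀, hn₀, hQ₀⟩ := hQ
  obtain ⟨u, v, l, hl, hn, hlen⟩ := Nat.findGreatest_spec hn₀ hQ₀
  have hmax : ∀ w, G.Adj w u → w ∈ l := by
    intro w hw
    by_contra hwl
    have h1 : (w :: l).Nodup := List.nodup_cons.2 ⟨hwl, hn⟩
    have h2 := Nat.le_findGreatest (P := Q) h1.length_le_card ⟨w, v, _, hl.cons hw, h1, rfl⟩
    simp only [List.length_cons, hlen] at h2
    omega
  match l, hl, hn, hmax with
  | [], hl, _, _ => exact absurd rfl hl.ne_nil
  | [x], hl, _, hmax =>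
    obtain rfl := hl.of_cons
    obtain ⟨w, hw, -, -⟩ := h.exists_adj hε hV u u u
    exact absurd (List.mem_singleton.1 (hmax w hw.symm)) hw.ne'
  | x :: y :: k, hl, hn, hmax =>
    obtain rfl := hl.of_cons
    obtain ⟨w, hw, hwy, -⟩ := h.exists_adj hε hV u y y
    have hwk : w ∈ k := by
      have := hmax w hw.symm
      simpa [hw.ne', hwy] using this
    obtain ⟨s, t, rfl⟩ := List.append_of_mem hwk
    refine ⟨u :: y :: (s ++ [w]), u, w, (hl.split_at (l₁ := u :: y :: s)).1, hw.symm, ?_, by simp⟩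
    exact hn.sublist (((List.singleton_sublist.2 (by simp)).append_left s).cons_cons y |>.cons_cons u)

theorem exists_dominating_cycle {ε : ℝ} (hε : 0 < ε) (h : G.IsTough (1 + ε))
    (hdeg : G.LargeRemoteDegrees) (hV : 4 ≤ Fintype.card V) :
    ∃ u v l, G.ListPath u v l ∧ G.Adj v u ∧ l.Nodup ∧ G.Dominates l := by
  classical
  have hex : ∃ n l, G.IsCycleList l ∧ (G.outerDarts l).ncard = n := by
    obtain ⟨l, hl⟩ := h.exists_isCycleList hε hV
    exact ⟨_, l, hl, rfl⟩
  obtain ⟨C, hC, hCn⟩ := Nat.find_spec hex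
  have hmin : ∀ l, G.IsCycleList l → (G.outerDarts C).ncard ≤ (G.outerDarts l).ncard :=
    fun l hl => hCn ▸ Nat.find_min' hex ⟨l, hl, rfl⟩
  by_contra hcon
  obtain ⟨u, v, hl, hvu, hn, hlen⟩ := id hC
  obtain ⟨o, q, ho, hq, hoq⟩ : ∃ o q, o ∉ C ∧ q ∉ C ∧ G.Adj o q := by
    by_contra! h'
    exact hcon ⟨u, v, C, hl, hvu, hn, h'⟩
  have hK := isIsland_outerComponent hmin ho hq hoq
  set K := G.outerComponent {v | v ∈ C} o
  have hoK : o ∈ K := ⟨[o], .single o, by simpa using ho⟩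
  -- The neighbours of K on the cycle separate K from any other vertex of the cycle, so there are at
  -- least three. If there is no other vertex, the whole cycle consists of neighbours of K.
  have hcard : 2 < (C.toFinset.filter fun v => ∃ p ∈ K, G.Adj v p).card := by
    by_cases hs : ∃ s ∈ C, ¬ ∃ p ∈ K, G.Adj s p
    · obtain ⟨s, hs, hsN⟩ := hs
      refine h.two_lt_of_separates hε _ K ?_ hoK (fun hsK => hK.out s hsK hs) (by simp [ho])
        (by simpa [hs] using hsN)
      intro x hx y hy _ hyN hxy
      by_cases hyC : y ∈ C
      · exact hyN (by simpa [hyC] using ⟨x, hx, hxy.symm⟩)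
      · exact hy (hK.closed x hx y hyC hxy)
    · push Not at hs
      rw [Finset.filter_true_of_mem (by simpa using hs), List.toFinset_card_of_nodup hn]
      omega
  obtain ⟨a, ha, b, hb, c, hc, hab, hac, hbc⟩ := Finset.two_lt_card.1 hcard
  simp only [Finset.mem_filter, List.mem_toFinset] at ha hb hc
  obtain ⟨_, _, _, _, _, _, hT⟩ := hC.exists_isThreeArcs (S := {v | v ∈ C}) (fun _ => Iff.rfl)
    ha.1 hb.1 hc.1 hab hac hbc ha.2 hb.2 hc.2
  exact hT.not_largeRemoteDegrees hK hdeg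

end DominatingCycle

/-! ### Small graphs and the conclusion -/

/-- In a graph with at most three vertices, every edge is a dominating cycle of length two. -/
theorem IsTough.evenSpine_of_card_le {V : Type*} [Fintype V] {G : SimpleGraph V} {ε : ℝ}
    (hε : 0 < ε) (h : G.IsTough (1 + ε)) (hV : 2 ≤ Fintype.card V) (hV' : Fintype.card V ≤ 3) :
    G.EvenSpine := by
  classical
  obtain ⟨a, b, hab⟩ := Fintype.one_lt_card_iff.1 hV
  obtain ⟨v, hav⟩ : ∃ v, G.Adj a v := by
    by_contra! hcon
    have := h.two_lt_degree hε hab.symm (hcon b) ∅ (fun w hw => absurd hw (hcon w)) (by simp)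
      (by simp)
    simp at this
  refine ⟨a, v, [a, v], (ListPath.single v).cons hav, hav.symm, by simp, by simpa using hav.ne, ?_⟩
  intro p q hp hq hpq
  simp only [List.mem_cons, List.not_mem_nil, or_false, not_or] at hp hq
  have hn : [p, q, a, v].Nodup := by simp [hp, hq, hpq.ne, hav.ne]
  have := hn.length_le_card
  simp only [List.length_cons, List.length_nil] at this
  omega

end SimpleGraph

theorem mainTheorem4 {V : Type*} [Fintype V] [DecidableEq V] (G : SimpleGraph V)
    (hV : 2 ≤ Fintype.card V) (ε : ℝ) (hε : 0 < ε)
    (hTough : G.IsTough (1 + ε)) (hChordal : G.IsKChordal 5)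
    (hDeg : ∀ e₁ ∈ G.edgeSet, ∀ e₂ ∈ G.edgeSet, ∀ e₃ ∈ G.edgeSet,
      G.Remote e₁ e₂ → G.Remote e₁ e₃ → G.Remote e₂ e₃ →
        (3 / 2 : ℝ) * ((Fintype.card V : ℝ) - 3) <
          (G.edgeDegree e₁ : ℝ) + (G.edgeDegree e₂ : ℝ) + (G.edgeDegree e₃ : ℝ)) :
    G.IsPrismHamiltonian := by
  rcases Nat.lt_or_ge 3 (Fintype.card V) with h | h
  · obtain ⟨u, v, l, hl, hvu, hn, hd⟩ := SimpleGraph.exists_dominating_cycle hε hTough hDeg h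
    rcases SimpleGraph.exists_spine_of_dominates hChordal hDeg hl hvu hn hd with hs | hs
    exacts [hs.isPrismHamiltonian hε hTough, hs.isPrismHamiltonian hε hTough]
  · exact (hTough.evenSpine_of_card_le hε hV h).isPrismHamiltonian hε hTough
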